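/- Let $n\ge 1$, let $\Omega\subset\mathbb R^n$ be a bounded connected open set with $C^\infty$ boundary, and let $\varepsilon_0>0$, $m_0>0$, $\lambda,V_0\in\mathbb R$. Let $q\in[1,\infty]$ if $n=1$ and $q\in[2,\infty]$ if $n\ge2$. For $0<\varepsilon<\varepsilon_0$ let $V_\varepsilon\in L^q(\Omega)$ satisfy $V_\varepsilon+\lambda\ge m_0$ a.e. in $\Omega$ and $\|V_\varepsilon-V_0\|_{L^q(\Omega)}\le\tau(\varepsilon)$, where $\tau$ is positive and nondecreasing and $\tau(\varepsilon)\to0$ as $\varepsilon\to0^+$; let $p_\varepsilon$ be smooth on $\overline\Omega$ with $p_\varepsilon\ge m_0$ and $p(\varepsilon):=\min_{\overline\Omega}p_\varepsilon\to\infty$ as $\varepsilon\to0^+$. Let $f\in C^1(\mathbb R)$ satisfy $\limsup_{|s|\to\infty}f(s)/s<0$ and the following growth condition: if $n=2$, for every $\eta>0$ there is $C_\eta>0$ with $|f(s)-f(t)|\le C_\eta(e^{\eta|s|^2}+e^{\eta|t|^2})|s-t|$ for all $s,t\in\mathbb R$; if $n\ge3$, there is $\tilde C>0$ with $|f(s)-f(t)|\le\tilde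 C|s-t|(|s|^{4/(n-2)}+|t|^{4/(n-2)}+1)$ for all $s,t\in\mathbb R$. Let $X_\varepsilon^{1/2}=\{u\in H^1(\Omega):\int_\Omega(\lambda+V_\varepsilon)u^2\,dx<\infty\}$ (which is $H^1(\Omega)$ if $n\le4$ or $q\ge n/2$), with scalar product $$\langle u,v\rangle_{X_\varepsilon^{1/2}}=\int_\Omega p_\varepsilon\nabla u\cdot\nabla v\,dx+\int_\Omega(\lambda+V_\varepsilon)uv\,dx ,$$ and let $A_\varepsilon$ be the associated operator in $L^2(\Omega)$, the realization of $-\operatorname{div}(p_\varepsilon\nabla u)+(\lambda+V_\varepsilon)u$ with homogeneous Neumann boundary condition: for $u \in X_\varepsilon^{1/2}$ and $g\in L^2(\Omega)$, $u\in D(A_\varepsilon)$ and $A_\varepsilon u=g$ mean $\langle u,\varphi\rangle_{X_\varepsilon^{1/2}}=\int_\Omega g\varphi\,dx$ for all $\varphi\in X_\varepsilon^{1/2}$. Let $u_*^0\in\mathbb R$ be an equilibrium of the limit equation $\dot u+(\lambda+V_0)u=f(u)$, that is, $(\lambda+V_0)u_*^0=f(u_*^0)$, which is hyperbolic, that is,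 the spectrum of the linearization $\lambda+V_0-f'(u_*^0)$ does not meet the imaginary axis. Regard $u_*^0$ as a constant function on $\Omega$. Then there are $\delta>0$, $\varepsilon_1\in(0,\varepsilon_0)$ and $C>0$, independent of $\varepsilon$, such that for every $\varepsilon\in(0,\varepsilon_1]$ there is $u_*^\varepsilon\in D(A_\varepsilon)$ with $f(u_*^\varepsilon)\in L^2(\Omega)$, $A_\varepsilon u_*^\varepsilon-f(u_*^\varepsilon)=0$, $\|u_*^\varepsilon-u_*^0\|_{X_\varepsilon^{1/2}}\le\delta$, and $$\|u_*^\varepsilon-u_*^0\|_{X_\varepsilon^{1/2}}\le C\bigl(\tau(\varepsilon)+p(\varepsilon)^{-1/2}\bigr).$$ Moreover $u_*^\varepsilon$ is the only weak solution of $A_\varepsilon u=f(u)$ in this ball: if $u\in X_\varepsilon^{1/2}$ satisfies $\|u-u_*^0\|_{X_\varepsilon^{1/2}}\le\delta$ and, for all $\varphi\in X_\varepsilon^{1/2}$, $f(u)\varphi$ is integrable and $\langle u,\varphi\rangle_{X_\varepsilon^{1/2}}=\int_\Omega f(u)\varphi\,dx$, then $u=u_*^\varepsilon$. -/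

import Mathlib

open MeasureTheory Filter Topology
open scoped ENNReal ContDiff

noncomputable section

namespace LargeDiffusion

/-- Euclidean space `ℝⁿ`. -/
abbrev Rn (n : ℕ) : Type := EuclideanSpace ℝ (Fin n)

variable {n : ℕ}

/-- The boundary of `Ω` is `C^∞`: near each boundary point, `Ω` is, after a choice of a unit
direction `ν`, the set of points lying strictly above the graph of a smooth function `g` of the
coordinates orthogonal to `ν`. -/
def HasSmoothBoundary (Ω : Set (Rn n)) : Prop :=
  ∀ x ∈ frontier Ω, ∃ r : ℝ, 0 < r ∧ ∃ ν : Rn n, ‖ν‖ = 1 ∧ ∃ g : Rn n → ℝ,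
    ContDiff ℝ ∞ g ∧ (∀ y : Rn n, ∀ t : ℝ, g (y + t • ν) = g y) ∧
      ∀ y ∈ Metric.ball x r, (y ∈ Ω ↔ g y < inner ℝ y ν)

/-- `G` is the weak (distributional) gradient of `u` in `Ω`. -/
def HasWeakGradient (Ω : Set (Rn n)) (u : Rn n → ℝ) (G : Rn n → Rn n) : Prop :=
  ∀ φ : Rn n → ℝ, ContDiff ℝ ∞ φ → HasCompactSupport φ → tsupport φ ⊆ Ω →
    ∀ v : Rn n, ∫ x in Ω, u x * fderiv ℝ φ x v = - ∫ x in Ω, inner ℝ (G x) v * φ x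

/-- The space `L²(Ω) × L²(Ω; ℝⁿ)`. -/
abbrev L2Pair (Ω : Set (Rn n)) : Type :=
  Lp ℝ 2 (volume.restrict Ω) × Lp (Rn n) 2 (volume.restrict Ω)

theorem integrable_mul_test {Ω : Set (Rn n)} (u : Lp ℝ 2 (volume.restrict Ω)) {ψ : Rn n → ℝ}
    (hψ : Continuous ψ) (hc : HasCompactSupport ψ) :
    Integrable (fun x => u x * ψ x) (volume.restrict Ω) :=
  MemLp.integrable_mul (p := 2) (q := 2) (Lp.memLp u) (hψ.memLp_of_hasCompactSupport hc)

theorem integrable_inner_mul_test {Ω : Set (Rn n)} (G : Lp (Rn n) 2 (volume.restrict Ω)) (v : Rn n)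
    {ψ : Rn n → ℝ} (hψ : Continuous ψ) (hc : HasCompactSupport ψ) :
    Integrable (fun x => inner ℝ (G x) v * ψ x) (volume.restrict Ω) :=
  MemLp.integrable_mul (p := 2) (q := 2) ((Lp.memLp G).inner_const v) (hψ.memLp_of_hasCompactSupport hc)

/-- The Sobolev space `H¹(Ω)`, realised as the space of pairs `(u, ∇u)` in
`L²(Ω) × L²(Ω; ℝⁿ)`, where `∇u` is the weak gradient of `u`. -/
def H1 (Ω : Set (Rn n)) : Submodule ℝ (L2Pair Ω) where
  carrier := {w | HasWeakGradient Ω w.1 w.2}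
  zero_mem' := by
    intro φ hφ hc hs v
    have h1 : (fun x => ((0 : L2Pair Ω).1 : Rn n → ℝ) x * fderiv ℝ φ x v)
        =ᵐ[volume.restrict Ω] 0 := by
      filter_upwards [Lp.coeFn_zero ℝ 2 (volume.restrict Ω)] with x hx
      rw [Prod.fst_zero, hx]
      simp
    have h2 : (fun x => inner ℝ (((0 : L2Pair Ω).2 : Rn n → Rn n) x) v * φ x)
        =ᵐ[volume.restrict Ω] 0 := by
      filter_upwards [Lp.coeFn_zero (Rn n) 2 (volume.restrict Ω)] with x hx
      rw [Prod.snd_zero, hx]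
      simp
    rw [integral_congr_ae h1, integral_congr_ae h2]
    simp
  add_mem' := by
    intro a b ha hb φ hφ hc hs v
    have hdc : Continuous (fun x => fderiv ℝ φ x v) :=
      (hφ.continuous_fderiv (by simp)).clm_apply continuous_const
    have hds : HasCompactSupport (fun x => fderiv ℝ φ x v) := hc.fderiv_apply ℝ v
    have h1 : (fun x => ((a + b).1 : Rn n → ℝ) x * fderiv ℝ φ x v)
        =ᵐ[volume.restrict Ω]
          (fun x => (a.1 : Rn n → ℝ) x * fderiv ℝ φ x v + (b.1 : Rn n → ℝ) x * fderiv ℝ φ x v) := by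
      filter_upwards [Lp.coeFn_add a.1 b.1] with x hx
      rw [Prod.fst_add, hx, Pi.add_apply, add_mul]
    have h2 : (fun x => inner ℝ (((a + b).2 : Rn n → Rn n) x) v * φ x)
        =ᵐ[volume.restrict Ω]
          (fun x => inner ℝ ((a.2 : Rn n → Rn n) x) v * φ x
            + inner ℝ ((b.2 : Rn n → Rn n) x) v * φ x) := by
      filter_upwards [Lp.coeFn_add a.2 b.2] with x hx
      rw [Prod.snd_add, hx, Pi.add_apply, inner_add_left, add_mul]
    rw [integral_congr_ae h1, integral_congr_ae h2,
      integral_add (integrable_mul_test a.1 hdc hds) (integrable_mul_test b.1 hdc hds),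
      integral_add (integrable_inner_mul_test a.2 v hφ.continuous hc)
        (integrable_inner_mul_test b.2 v hφ.continuous hc),
      ha φ hφ hc hs v, hb φ hφ hc hs v]
    ring
  smul_mem' := by
    intro c a ha φ hφ hc hs v
    have h1 : (fun x => ((c • a).1 : Rn n → ℝ) x * fderiv ℝ φ x v)
        =ᵐ[volume.restrict Ω] (fun x => c * ((a.1 : Rn n → ℝ) x * fderiv ℝ φ x v)) := by
      filter_upwards [Lp.coeFn_smul c a.1] with x hx
      simp [hx, mul_assoc]
    have h2 : (fun x => inner ℝ (((c • a).2 : Rn n → Rn n) x) v * φ x)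
        =ᵐ[volume.restrict Ω] (fun x => c * (inner ℝ ((a.2 : Rn n → Rn n) x) v * φ x)) := by
      filter_upwards [Lp.coeFn_smul c a.2] with x hx
      simp [hx, inner_smul_left, mul_assoc]
    rw [integral_congr_ae h1, integral_congr_ae h2, integral_const_mul, integral_const_mul,
      ha φ hφ hc hs v]
    ring

/-- The underlying function `u ∈ L²(Ω)` of an element of `H¹(Ω)`. -/
def fn {Ω : Set (Rn n)} (u : H1 Ω) : Lp ℝ 2 (volume.restrict Ω) := u.1.1

/-- The weak gradient `∇u ∈ L²(Ω; ℝⁿ)` of an element of `H¹(Ω)`. -/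
def grad {Ω : Set (Rn n)} (u : H1 Ω) : Lp (Rn n) 2 (volume.restrict Ω) := u.1.2

theorem memLp_const_of_isBounded {Ω : Set (Rn n)} (hΩ : Bornology.IsBounded Ω) (c : ℝ) :
    MemLp (fun _ : Rn n => c) 2 (volume.restrict Ω) :=
  haveI : IsFiniteMeasure (volume.restrict Ω) := isFiniteMeasure_restrict.2 hΩ.measure_lt_top.ne
  memLp_const c

theorem hasWeakGradient_const (Ω : Set (Rn n)) (c : ℝ) :
    HasWeakGradient Ω (fun _ => c) (fun _ => 0) := by
  intro φ hφ hc hs v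
  have hdc : Continuous (fun x => fderiv ℝ φ x v) :=
    (hφ.continuous_fderiv (by simp)).clm_apply continuous_const
  have hds : HasCompactSupport (fun x => fderiv ℝ φ x v) := hc.fderiv_apply ℝ v
  have hsup : ∀ x, x ∉ Ω → c * fderiv ℝ φ x v = 0 := by
    intro x hx
    have : fderiv ℝ φ x = 0 := by
      by_contra h
      exact hx (hs (support_fderiv_subset ℝ h))
    simp [this]
  rw [setIntegral_eq_integral_of_forall_compl_eq_zero hsup]
  have := integral_mul_fderiv_eq_neg_fderiv_mul_of_integrable (μ := (volume : Measure (Rn n)))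
    (f := fun _ : Rn n => c) (g := φ) (v := v) (by simp)
    ((hdc.integrable_of_hasCompactSupport hds).const_mul c)
    ((hφ.continuous.integrable_of_hasCompactSupport hc).const_mul c)
    (fun x _ => differentiableAt_const c)
    (fun x _ => (hφ.differentiable (by simp)) x)
  rw [this]
  simp

/-- The constant function `c` as an element of `H¹(Ω)`, for a bounded set `Ω`. -/
def constH1 {Ω : Set (Rn n)} (hΩ : Bornology.IsBounded Ω) (c : ℝ) : H1 Ω :=
  ⟨((memLp_const_of_isBounded hΩ c).toLp _, 0), by
    intro φ hφ hc hs v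
    have h1 : (fun x => ((memLp_const_of_isBounded hΩ c).toLp _ : Rn n → ℝ) x * fderiv ℝ φ x v)
        =ᵐ[volume.restrict Ω] (fun x => c * fderiv ℝ φ x v) := by
      filter_upwards [(memLp_const_of_isBounded hΩ c).coeFn_toLp] with x hx
      rw [hx]
    have h2 : (fun x => inner ℝ ((0 : Lp (Rn n) 2 (volume.restrict Ω)) x) v * φ x)
        =ᵐ[volume.restrict Ω] (fun x => inner ℝ (0 : Rn n) v * φ x) := by
      filter_upwards [Lp.coeFn_zero (Rn n) 2 (volume.restrict Ω)] with x hx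
      rw [hx]
      simp
    exact (integral_congr_ae h1).trans
      ((hasWeakGradient_const Ω c φ hφ hc hs v).trans
        (congrArg Neg.neg (integral_congr_ae h2).symm))⟩

/-- The energy space `X^{1/2}` for the potential `a = λ + V`: the functions `u ∈ H¹(Ω)` for which
`∫_Ω |a| u² < ∞`, that is, `|a|^{1/2} u ∈ L²(Ω)`. -/
def energySpace (Ω : Set (Rn n)) (a : Rn n → ℝ) : Submodule ℝ (H1 Ω) where
  carrier := {u | MemLp (fun x => √|a x| * fn u x) 2 (volume.restrict Ω)}
  zero_mem' := by
    refine (memLp_congr_ae ?_).2 (MemLp.zero (p := 2) (μ := volume.restrict Ω) (ε := ℝ))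
    filter_upwards [Lp.coeFn_zero ℝ 2 (volume.restrict Ω)] with x hx
    have : fn (0 : H1 Ω) = 0 := rfl
    simp only [this]
    rw [hx]
    simp
  add_mem' := by
    intro u v hu hv
    refine (memLp_congr_ae ?_).2 (MemLp.add hu hv)
    filter_upwards [Lp.coeFn_add (fn u) (fn v)] with x hx
    have : fn (u + v) = fn u + fn v := rfl
    simp only [this, hx, Pi.add_apply, mul_add]
  smul_mem' := by
    intro c u hu
    refine (memLp_congr_ae ?_).2 (MemLp.const_mul hu c)
    filter_upwards [Lp.coeFn_smul c (fn u)] with x hx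
    have : fn (c • u) = c • fn u := rfl
    simp only [this, hx, Pi.smul_apply, smul_eq_mul]
    ring

/-- The scalar product `∫_Ω d ∇u·∇v dx + ∫_Ω a u v dx` of `X^{1/2}`, with diffusion coefficient `d`
and potential `a = λ + V`. -/
def energyForm {Ω : Set (Rn n)} (d a : Rn n → ℝ) (u v : H1 Ω) : ℝ :=
  (∫ x in Ω, d x * inner ℝ (grad u x) (grad v x)) + ∫ x in Ω, a x * (fn u x * fn v x)

/-- The norm of `X^{1/2}`. -/
def energyNorm {Ω : Set (Rn n)} (d a : Rn n → ℝ) (u : H1 Ω) : ℝ :=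
  √(energyForm d a u u)

/-- `u ∈ X^{1/2}` is a weak equilibrium: `A u = f(u)` holds when tested against every
`φ ∈ X^{1/2}`, with the Neumann boundary condition as natural boundary condition. -/
structure IsWeakEquilibrium {Ω : Set (Rn n)} (d a : Rn n → ℝ) (f : ℝ → ℝ) (u : H1 Ω) : Prop where
  mem : u ∈ energySpace Ω a
  integrable : ∀ φ ∈ energySpace Ω a,
    Integrable (fun x => f (fn u x) * fn φ x) (volume.restrict Ω)
  eq : ∀ φ ∈ energySpace Ω a, energyForm d a u φ = ∫ x in Ω, f (fn u x) * fn φ x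

/-- `u ∈ D(A)` and `A u = g`, where `A u = -div(d ∇u) + a u` with Neumann boundary condition is the
operator in `L²(Ω)` that is associated with the scalar product of `X^{1/2}`. -/
structure OperatorEq {Ω : Set (Rn n)} (d a : Rn n → ℝ) (u : H1 Ω)
    (g : Lp ℝ 2 (volume.restrict Ω)) : Prop where
  mem : u ∈ energySpace Ω a
  eq : ∀ φ ∈ energySpace Ω a, energyForm d a u φ = ∫ x in Ω, g x * fn φ x

/-- `u` is an equilibrium: `u ∈ D(A)`, `f(u) ∈ L²(Ω)` and `A u - f(u) = 0` in `L²(Ω)`. -/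
def IsEquilibrium {Ω : Set (Rn n)} (d a : Rn n → ℝ) (f : ℝ → ℝ) (u : H1 Ω) : Prop :=
  ∃ g : Lp ℝ 2 (volume.restrict Ω),
    (g : Rn n → ℝ) =ᵐ[volume.restrict Ω] (fun x => f (fn u x)) ∧ OperatorEq d a u g

/-- The equilibria of the limit equation `u' + lbar u = f(u)`, where `lbar = λ + V₀`. -/
def limitEquilibria (lbar : ℝ) (f : ℝ → ℝ) : Set ℝ := {c | lbar * c - f c = 0}

/-- The linearised operator `A₀ - f'(c)`, which is multiplication by `λ + V₀ - f'(c)`, on the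
complexification `ℂ` of the one-dimensional space of constant functions. -/
def limitLinearization (lbar : ℝ) (f : ℝ → ℝ) (c : ℝ) : Module.End ℂ ℂ :=
  ((lbar - deriv f c : ℝ) : ℂ) • (1 : Module.End ℂ ℂ)

/-- Hyperbolicity: the spectrum of the linearised operator does not meet the imaginary axis. -/
def IsHyperbolic (lbar : ℝ) (f : ℝ → ℝ) (c : ℝ) : Prop :=
  spectrum ℂ (limitLinearization lbar f c) ∩ {μ : ℂ | μ.re = 0} = ∅

/-- Growth condition on the nonlinearity in dimension `n` (no condition if `n = 1`). -/
def GrowthCondition (n : ℕ) (f : ℝ → ℝ) : Prop :=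
  (n = 2 → ∀ η : ℝ, 0 < η → ∃ K : ℝ, 0 < K ∧ ∀ s t : ℝ,
    |f s - f t| ≤ K * (Real.exp (η * |s| ^ 2) + Real.exp (η * |t| ^ 2)) * |s - t|) ∧
  (3 ≤ n → ∃ K : ℝ, 0 < K ∧ ∀ s t : ℝ,
    |f s - f t| ≤
      K * |s - t| * (|s| ^ (4 / ((n : ℝ) - 2)) + |t| ^ (4 / ((n : ℝ) - 2)) + 1))

/-- Dissipativity: `limsup_{|s| → ∞} f(s) / s < 0` (the limsup taken in `[-∞, ∞]`). -/
def Dissipative (f : ℝ → ℝ) : Prop :=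
  limsup (fun s : ℝ => ((f s / s : ℝ) : EReal)) (cocompact ℝ) < 0

/-- The minimum of the diffusion coefficient `d` over the closure of `Ω`. -/
def minDiffusion (Ω : Set (Rn n)) (d : Rn n → ℝ) : ℝ := sInf (d '' closure Ω)

end LargeDiffusion

end

/-!
Equilibria are found by a contraction argument in the energy space `X^{1/2}`, with constants that do
not depend on the coefficients `d` and `a`. Write `ℓ = λ + V₀` and `b = f'(c)`; hyperbolicity means
`ℓ ≠ b`.

*Truncation.* Dissipativity gives `M > |c|` such that `f ≤ 0` on `[M, ∞)` and `f ≥ 0` on `(-∞, -M]`.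
Testing the equation with a regularisation of `(u - M)⁺` shows that every weak equilibrium satisfies
`|u| ≤ M` almost everywhere (`IsWeakEquilibrium.ae_abs_le`). The same holds for the truncation
`s ↦ f (max (-M) (min M s))`, so both nonlinearities have the same weak equilibria, and `f` may be
taken to be globally Lipschitz, with slope close to `b` near `c`. For the equilibria, which are
bounded, `f(u) ∈ L²` is automatic. Testing with a function of `u` needs a chain rule for weak
gradients, `HasWeakGradient.comp`.

*Large diffusion.* The Poincaré inequality on `Ω` (`HasSmoothBoundary.poincareOn`) bounds the distance
in `L²` of `u` from the constants by a multiple of `‖∇u‖`, hence by `σ ‖u‖` in the energy norm with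
`σ` proportional to `p(ε)^{-1/2}`. It is proved on balls by averaging the increments of `u`, carried
to the boundary by translation, and put together by a chaining argument on the connected set `Ω`.

*Linear part.* For `w = z + m` with `m` constant and `z` of mean `0`, the form
`⟨w, φ⟩ - b ∫ w φ` is close to `‖z‖² + (ℓ - b) |Ω| m²`. It is indefinite if `ℓ < b`, but coercive
when tested with `z + sign (ℓ - b) m`, so the linearisation is invertible with a uniform bound on
its inverse (`shiftedOp_bijective_and_bound`).

*Nonlinear part.* The remainder `g(s) = f(c + s) - ℓ c - b s` has small slope near `0` only, and
energy bounds need not be pointwise bounds. But for `w = z + m` the change of `g(w)` with `z` costs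
the global Lipschitz constant times `σ`, and the change with `m` costs only the small slope, except
where `|z|` is large, a set that is controlled by `‖z‖ ≤ σ ‖w‖` (`norm_compLp_sub_le`). So `g` is a
small Lipschitz perturbation on a ball of fixed radius.

*Residual.* Inserting the constant `c` into the equation leaves the functional
`φ ↦ c ∫ (V_ε - V₀) φ`, of size `O(τ(ε))` (`exists_abs_integral_mul_fn_le`); in dimension one with
`q < 2` this uses that `H¹` functions on an interval are bounded. The contraction principle gives
existence, uniqueness in the ball, and the estimate (`exists_uniform_equilibria`).
-/

open scoped NNReal

namespace LargeDiffusion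

variable {n : ℕ} {Ω : Set (Rn n)}

/-! ### Translates of weakly differentiable functions -/

theorem abs_integral_mul_le_eLpNorm {α : Type*} [MeasurableSpace α] {μ : Measure α} {f g : α → ℝ}
    (hf : MemLp f 2 μ) (hg : MemLp g 2 μ) :
    |∫ x, f x * g x ∂μ| ≤ (eLpNorm f 2 μ).toReal * (eLpNorm g 2 μ).toReal := by
  have h := norm_inner_le_norm (𝕜 := ℝ) (hg.toLp g) (hf.toLp f)
  rw [Lp.norm_toLp, Lp.norm_toLp, L2.inner_def, Real.norm_eq_abs] at h
  rw [mul_comm]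
  refine le_of_eq_of_le ?_ h
  congr 1
  refine integral_congr_ae ?_
  filter_upwards [hf.coeFn_toLp, hg.coeFn_toLp] with x h1 h2
  simp [h1, h2]

/-- The `L²` norm on an open set is determined by testing against smooth functions with compact
support in that set: these are dense, as only `0` is orthogonal to all of them. -/
theorem eLpNorm_le_of_forall_test {K : Set (Rn n)} (hK : IsOpen K) {D : Rn n → ℝ}
    (hD : MemLp D 2 (volume.restrict K)) {M : ℝ} (hM : 0 ≤ M)
    (h : ∀ ψ : Rn n → ℝ, ContDiff ℝ ∞ ψ → HasCompactSupport ψ → tsupport ψ ⊆ K →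
      ∫ x in K, D x * ψ x ≤ M * (eLpNorm ψ 2 (volume.restrict K)).toReal) :
    eLpNorm D 2 (volume.restrict K) ≤ ENNReal.ofReal M := by
  set μ := (volume : Measure (Rn n)).restrict K with hμ
  let S : Submodule ℝ (Lp ℝ 2 μ) :=
    { carrier := {w | ∃ ψ : Rn n → ℝ, ContDiff ℝ ∞ ψ ∧ HasCompactSupport ψ ∧ tsupport ψ ⊆ K ∧
        (w : Rn n → ℝ) =ᵐ[μ] ψ}
      zero_mem' := ⟨0, contDiff_const, HasCompactSupport.zero, by simp [tsupport],
        Lp.coeFn_zero ℝ 2 μ⟩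
      add_mem' := by
        rintro a b ⟨ψ, h1, h2, h3, h4⟩ ⟨χ, k1, k2, k3, k4⟩
        refine ⟨ψ + χ, h1.add k1, h2.add k2,
          (tsupport_add ψ χ).trans (Set.union_subset h3 k3), ?_⟩
        filter_upwards [Lp.coeFn_add a b, h4, k4] with x e1 e2 e3
        rw [e1, Pi.add_apply, e2, e3, Pi.add_apply]
      smul_mem' := by
        rintro r a ⟨ψ, h1, h2, h3, h4⟩
        refine ⟨fun x => r * ψ x, contDiff_const.mul h1, h2.mul_left,
          (closure_mono (Function.support_mul_subset_right _ _)).trans h3, ?_⟩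
        filter_upwards [Lp.coeFn_smul r a, h4] with x e1 e2
        rw [e1, Pi.smul_apply, e2, smul_eq_mul] }
  have hS : S.topologicalClosure = ⊤ := by
    rw [Submodule.topologicalClosure_eq_top_iff, Submodule.eq_bot_iff]
    intro w hw
    rw [Submodule.mem_orthogonal] at hw
    have hloc : LocallyIntegrableOn (w : Rn n → ℝ) K volume :=
      locallyIntegrableOn_of_locallyIntegrable_restrict
        ((Lp.memLp w).locallyIntegrable (by norm_num))
    have h0 := hK.ae_eq_zero_of_integral_contDiff_smul_eq_zero hloc (fun g g1 g2 g3 => by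
      have gm : MemLp g 2 μ := g1.continuous.memLp_of_hasCompactSupport g2
      have := hw (gm.toLp g) ⟨g, g1, g2, g3, gm.coeFn_toLp⟩
      rw [L2.inner_def] at this
      rw [← setIntegral_eq_integral_of_forall_compl_eq_zero (s := K), ← this]
      · refine integral_congr_ae ?_
        filter_upwards [gm.coeFn_toLp] with x hx
        simp [hx, mul_comm]
      · intro x hx
        rw [image_eq_zero_of_notMem_tsupport (fun h => hx (g3 h)), zero_smul])
    refine (Lp.eq_zero_iff_ae_eq_zero (f := w)).2 ?_
    exact (ae_restrict_iff' hK.measurableSet).2 h0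
  have hcl : ∀ w : Lp ℝ 2 μ, inner ℝ (hD.toLp D) w ≤ M * ‖w‖ := by
    intro w
    have hw : w ∈ closure (S : Set (Lp ℝ 2 μ)) := by
      have : w ∈ S.topologicalClosure := by rw [hS]; trivial
      exact this
    refine closure_minimal (s := (S : Set (Lp ℝ 2 μ)))
      (t := {w | inner ℝ (hD.toLp D) w ≤ M * ‖w‖}) ?_ ?_ hw
    · rintro a ⟨ψ, h1, h2, h3, h4⟩
      have := h ψ h1 h2 h3
      rw [← eLpNorm_congr_ae h4, ← Lp.norm_def] at this
      refine le_of_eq_of_le ?_ this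
      rw [L2.inner_def]
      refine integral_congr_ae ?_
      filter_upwards [hD.coeFn_toLp, h4] with x e1 e2
      simp [e1, e2, mul_comm]
    · exact isClosed_le (by fun_prop) (by fun_prop)
  have h1 := hcl (hD.toLp D)
  rw [real_inner_self_eq_norm_sq, sq] at h1
  have h2 : ‖hD.toLp D‖ ≤ M := by
    rcases (norm_nonneg (hD.toLp D)).eq_or_lt with h0 | h0
    · rw [← h0]; exact hM
    · exact le_of_mul_le_mul_right h1 h0
  rw [Lp.norm_toLp] at h2
  rw [← ENNReal.ofReal_toReal hD.eLpNorm_ne_top]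
  exact ENNReal.ofReal_le_ofReal h2

/-- The derivative falls on the smooth factor, so only integrability of `u` is needed. -/
theorem hasDerivAt_integral_mul_translate {u : Rn n → ℝ} (hu : Integrable u (volume.restrict Ω))
    {ψ : Rn n → ℝ} (hψ : ContDiff ℝ ∞ ψ) (hc : HasCompactSupport ψ) (h : Rn n) (t : ℝ) :
    HasDerivAt (fun t : ℝ => ∫ x in Ω, u x * ψ (x - t • h))
      (-∫ x in Ω, u x * fderiv ℝ ψ (x - t • h) h) t := by
  have hdc : Continuous (fun x => fderiv ℝ ψ x h) :=
    (hψ.continuous_fderiv (by simp)).clm_apply continuous_const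
  have hds : HasCompactSupport (fun x => fderiv ℝ ψ x h) := hc.fderiv_apply ℝ h
  obtain ⟨C, hC⟩ := hdc.bounded_above_of_compact_support hds
  obtain ⟨C', hC'⟩ := hψ.continuous.bounded_above_of_compact_support hc
  have hsh : ∀ s : ℝ, Continuous (fun x : Rn n => x - s • h) := fun s => by fun_prop
  have hmeas : ∀ s : ℝ, AEStronglyMeasurable (fun x => u x * ψ (x - s • h)) (volume.restrict Ω) :=
    fun s => hu.aestronglyMeasurable.mul (hψ.continuous.comp (hsh s)).aestronglyMeasurable
  have key := (hasDerivAt_integral_of_dominated_loc_of_deriv_le (μ := volume.restrict Ω)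
    (F := fun (t : ℝ) x => u x * ψ (x - t • h))
    (F' := fun (t : ℝ) x => -(u x * fderiv ℝ ψ (x - t • h) h)) (x₀ := t) (s := Set.univ)
    (bound := fun x => C * ‖u x‖) univ_mem
    (Eventually.of_forall hmeas) ?_ ?_ ?_ ?_ ?_).2
  · rw [integral_neg] at key
    exact key
  · refine (hu.norm.const_mul C').mono' (hmeas t) (Eventually.of_forall fun x => ?_)
    rw [norm_mul, mul_comm]
    exact mul_le_mul_of_nonneg_right (hC' _) (norm_nonneg _)
  · exact (hu.aestronglyMeasurable.mul (hdc.comp (hsh t)).aestronglyMeasurable).neg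
  · refine Eventually.of_forall fun x s _ => ?_
    rw [norm_neg, norm_mul, mul_comm]
    exact mul_le_mul_of_nonneg_right (hC _) (norm_nonneg _)
  · exact hu.norm.const_mul C
  · refine Eventually.of_forall fun x s _ => ?_
    have h1 : HasDerivAt (fun s : ℝ => x - s • h) (-h) s := by
      simpa using ((hasDerivAt_id s).smul_const h).const_sub x
    have h2 := ((hψ.differentiable (by simp)) (x - s • h)).hasFDerivAt.comp_hasDerivAt s h1
    simpa using h2.const_mul (u x)

theorem integral_mul_translate_eq {K : Set (Rn n)} {F ψ : Rn n → ℝ} (h : Rn n)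
    (hψK : tsupport ψ ⊆ K) (hKΩ : ∀ x ∈ K, x + h ∈ Ω) :
    ∫ x in Ω, F x * ψ (x - h) = ∫ x in K, F (x + h) * ψ x := by
  rw [setIntegral_eq_integral_of_forall_compl_eq_zero,
    setIntegral_eq_integral_of_forall_compl_eq_zero,
    ← integral_add_right_eq_self (fun x => F x * ψ (x - h)) h]
  · simp
  · intro x hx
    rw [image_eq_zero_of_notMem_tsupport (fun h => hx (hψK h)), mul_zero]
  · intro x hx
    rw [image_eq_zero_of_notMem_tsupport (f := ψ), mul_zero]
    intro h'
    exact hx (by simpa using hKΩ _ (hψK h'))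

theorem eLpNorm_translate_le {E : Type*} [NormedAddCommGroup E] {K : Set (Rn n)} {f : Rn n → E}
    (hΩ : MeasurableSet Ω)
    (hf : AEStronglyMeasurable f (volume.restrict Ω)) (h : Rn n) (hKΩ : ∀ x ∈ K, x + h ∈ Ω) :
    AEStronglyMeasurable (fun x => f (x + h)) (volume.restrict K) ∧
    eLpNorm (fun x => f (x + h)) 2 (volume.restrict K) ≤ eLpNorm f 2 (volume.restrict Ω) := by
  have hmp : MeasurePreserving (fun x : Rn n => x + h)
      (volume.restrict ((fun x : Rn n => x + h) ⁻¹' Ω)) (volume.restrict Ω) :=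
    (measurePreserving_add_right volume h).restrict_preimage hΩ
  have hle : (volume : Measure (Rn n)).restrict K
      ≤ volume.restrict ((fun x : Rn n => x + h) ⁻¹' Ω) := Measure.restrict_mono_set _ hKΩ
  constructor
  · exact (hf.comp_measurePreserving hmp).mono_measure hle
  · refine (eLpNorm_mono_measure _ hle).trans ?_
    exact (eLpNorm_comp_measurePreserving hf hmp).le

theorem MemLp.translate {E : Type*} [NormedAddCommGroup E] {K : Set (Rn n)} {f : Rn n → E}
    (hΩ : MeasurableSet Ω) (hf : MemLp f 2 (volume.restrict Ω)) (h : Rn n)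
    (hKΩ : ∀ x ∈ K, x + h ∈ Ω) :
    MemLp (fun x => f (x + h)) 2 (volume.restrict K) :=
  have := eLpNorm_translate_le hΩ hf.1 h hKΩ
  ⟨this.1, this.2.trans_lt hf.2⟩

theorem HasWeakGradient.integral_translate {u : Rn n → ℝ} {G : Rn n → Rn n}
    (hG : HasWeakGradient Ω u G) {ψ : Rn n → ℝ} (hψ : ContDiff ℝ ∞ ψ) (hc : HasCompactSupport ψ)
    (h : Rn n) (hs : ∀ x ∈ tsupport ψ, x + h ∈ Ω) (v : Rn n) :
    ∫ x in Ω, u x * fderiv ℝ ψ (x - h) v = - ∫ x in Ω, inner ℝ (G x) v * ψ (x - h) := by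
  have hsub : tsupport (fun x => ψ (x - h)) ⊆ (fun x => x - h) ⁻¹' tsupport ψ :=
    tsupport_comp_subset_preimage ψ (by fun_prop)
  have := hG (fun x => ψ (x - h)) (hψ.comp (contDiff_id.sub contDiff_const))
    (hc.comp_homeomorph (Homeomorph.subRight h)) (fun x hx => by
      simpa using hs _ (hsub hx)) v
  simpa only [fderiv_comp_sub] using this

/-- The increment of a weakly differentiable function along `h` is controlled by its weak
gradient: the pairing of the translate `u(· + t h)` with a test function is differentiable in `t`,
so the mean value inequality applies. -/
theorem HasWeakGradient.eLpNorm_increment_sub_le {u : Rn n → ℝ} {G : Rn n → Rn n}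
    (hΩ : IsOpen Ω) (hΩb : Bornology.IsBounded Ω)
    (hu : MemLp u 2 (volume.restrict Ω)) (hGm : MemLp G 2 (volume.restrict Ω))
    (hG : HasWeakGradient Ω u G) {K : Set (Rn n)} (hK : IsOpen K) (h : Rn n)
    (hKΩ : ∀ x ∈ K, ∀ t ∈ Set.Icc (0 : ℝ) 1, x + t • h ∈ Ω)
    {H : Rn n → ℝ} (hH : MemLp H 2 (volume.restrict K)) {M : ℝ} (hM : 0 ≤ M)
    (hGH : ∀ t ∈ Set.Icc (0 : ℝ) 1,
      eLpNorm (fun x => inner ℝ (G (x + t • h)) h - H x) 2 (volume.restrict K)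
        ≤ ENNReal.ofReal M) :
    eLpNorm (fun x => u (x + h) - u x - H x) 2 (volume.restrict K) ≤ ENNReal.ofReal M := by
  have : IsFiniteMeasure (volume.restrict Ω) := isFiniteMeasure_restrict.2 hΩb.measure_lt_top.ne
  have hK1 : ∀ x ∈ K, x + h ∈ Ω := fun x hx => by simpa using hKΩ x hx 1 (by simp)
  have hK0 : ∀ x ∈ K, x + (0 : Rn n) ∈ Ω := fun x hx => by simpa using hKΩ x hx 0 (by simp)
  have huh := MemLp.translate hΩ.measurableSet hu h hK1
  have hu0 : MemLp u 2 (volume.restrict K) := by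
    simpa using MemLp.translate hΩ.measurableSet hu 0 hK0
  refine eLpNorm_le_of_forall_test hK ((huh.sub hu0).sub hH) hM fun ψ hψ hc hs => ?_
  have hψm : MemLp ψ 2 (volume.restrict K) := hψ.continuous.memLp_of_hasCompactSupport hc
  set N := (eLpNorm ψ 2 (volume.restrict K)).toReal
  have int_mul : ∀ {f : Rn n → ℝ}, MemLp f 2 (volume.restrict K) →
      Integrable (fun x => f x * ψ x) (volume.restrict K) :=
    fun hf => MemLp.integrable_mul (p := 2) (q := 2) hf hψm
  have hmv := norm_image_sub_le_of_norm_deriv_le_segment_01'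
    (f := fun t : ℝ => (∫ x in Ω, u x * ψ (x - t • h)) - t * ∫ x in K, H x * ψ x)
    (f' := fun t => (-∫ x in Ω, u x * fderiv ℝ ψ (x - t • h) h) - ∫ x in K, H x * ψ x)
    (C := M * N)
    (fun t _ => ((hasDerivAt_integral_mul_translate (hu.integrable (by norm_num)) hψ hc h t).sub
      (by simpa using (hasDerivAt_id t).mul_const (∫ x in K, H x * ψ x))).hasDerivWithinAt)
    (fun t ht => by
      have ht' : t ∈ Set.Icc (0 : ℝ) 1 := ⟨ht.1, ht.2.le⟩
      have hKt : ∀ x ∈ K, x + t • h ∈ Ω := fun x hx => hKΩ x hx t ht'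
      have hGt : MemLp (fun x => inner ℝ (G (x + t • h)) h) 2 (volume.restrict K) :=
        (MemLp.translate hΩ.measurableSet hGm (t • h) hKt).inner_const h
      rw [hG.integral_translate hψ hc (t • h) (fun x hx => hKt x (hs hx)) h, neg_neg,
        integral_mul_translate_eq (F := fun x => inner ℝ (G x) h) (t • h) hs hKt,
        ← integral_sub (int_mul hGt) (int_mul hH), Real.norm_eq_abs]
      simp_rw [← sub_mul]
      refine (abs_integral_mul_le_eLpNorm (hGt.sub hH) hψm).trans ?_
      exact mul_le_mul_of_nonneg_right (ENNReal.toReal_le_of_le_ofReal hM (hGH t ht'))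
        ENNReal.toReal_nonneg)
  refine le_trans (le_of_eq ?_) ((le_abs_self _).trans hmv)
  simp only [zero_smul, sub_zero, one_smul, one_mul, zero_mul]
  rw [integral_mul_translate_eq h hs hK1]
  have e0 := integral_mul_translate_eq (F := u) (0 : Rn n) hs hK0
  simp only [sub_zero, add_zero] at e0
  rw [e0, ← integral_sub (int_mul huh) (int_mul hH),
    ← integral_sub (by exact (int_mul huh).sub (int_mul hH)) (int_mul hu0)]
  refine integral_congr_ae (Eventually.of_forall fun x => ?_)
  simp only [Pi.sub_apply]
  ring

theorem HasWeakGradient.eLpNorm_increment_le {u : Rn n → ℝ} {G : Rn n → Rn n}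
    (hΩ : IsOpen Ω) (hΩb : Bornology.IsBounded Ω)
    (hu : MemLp u 2 (volume.restrict Ω)) (hGm : MemLp G 2 (volume.restrict Ω))
    (hG : HasWeakGradient Ω u G) {K : Set (Rn n)} (hK : IsOpen K) (h : Rn n)
    (hKΩ : ∀ x ∈ K, ∀ t ∈ Set.Icc (0 : ℝ) 1, x + t • h ∈ Ω) :
    eLpNorm (fun x => u (x + h) - u x) 2 (volume.restrict K)
      ≤ ENNReal.ofReal ‖h‖ * eLpNorm G 2 (volume.restrict Ω) := by
  have hfin := hGm.eLpNorm_ne_top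
  have hR : ENNReal.ofReal (‖h‖ * (eLpNorm G 2 (volume.restrict Ω)).toReal)
      = ENNReal.ofReal ‖h‖ * eLpNorm G 2 (volume.restrict Ω) := by
    rw [ENNReal.ofReal_mul (norm_nonneg h), ENNReal.ofReal_toReal hfin]
  rw [← hR]
  have := hG.eLpNorm_increment_sub_le hΩ hΩb hu hGm hK h hKΩ (H := fun _ => 0)
    (MemLp.zero (p := 2)) (M := ‖h‖ * (eLpNorm G 2 (volume.restrict Ω)).toReal) (by positivity)
    (fun t ht => by
      rw [hR]
      refine le_trans ?_ (mul_le_mul_right (eLpNorm_translate_le hΩ.measurableSet hGm.1 (t • h)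
        (fun x hx => hKΩ x hx t ht)).2 _)
      refine eLpNorm_le_mul_eLpNorm_of_ae_le_mul (Eventually.of_forall fun x => ?_) 2
      rw [sub_zero, mul_comm]
      exact norm_inner_le_norm _ _)
  simpa using this

/-! ### The Poincaré inequality -/

theorem eLpNorm_two_sq {α E : Type*} [MeasurableSpace α] [NormedAddCommGroup E] (f : α → E)
    (μ : Measure α) : eLpNorm f 2 μ ^ 2 = ∫⁻ x, ‖f x‖ₑ ^ 2 ∂μ := by
  have := eLpNorm_nnreal_pow_eq_lintegral (f := f) (μ := μ) (p := 2) (by norm_num)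
  simpa using this

/-- `W ⊆ Ω` satisfies a Poincaré inequality relative to `Ω`: each weakly differentiable function
is, up to a constant, controlled in `L²(W)` by its gradient in `L²(Ω)`. -/
def PoincareOn (Ω W : Set (Rn n)) : Prop :=
  ∃ C : ℝ≥0, ∀ (u : Rn n → ℝ) (G : Rn n → Rn n), MemLp u 2 (volume.restrict Ω) →
    MemLp G 2 (volume.restrict Ω) → HasWeakGradient Ω u G →
      ∃ m : ℝ, eLpNorm (fun x => u x - m) 2 (volume.restrict W)
        ≤ C * eLpNorm G 2 (volume.restrict Ω)

theorem PoincareOn.mono {W W' : Set (Rn n)} (h : PoincareOn Ω W) (hW : W' ⊆ W) :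
    PoincareOn Ω W' := by
  obtain ⟨C, hC⟩ := h
  refine ⟨C, fun u G hu hG huG => ?_⟩
  obtain ⟨m, hm⟩ := hC u G hu hG huG
  exact ⟨m, (eLpNorm_mono_measure _ (Measure.restrict_mono_set _ hW)).trans hm⟩

/-- Poincaré inequalities on two overlapping sets combine: on the overlap, both constants are close
to the function, hence to each other. -/
theorem PoincareOn.union {W₁ W₂ : Set (Rn n)} (h₁ : PoincareOn Ω W₁) (h₂ : PoincareOn Ω W₂)
    (hW₁ : W₁ ⊆ Ω) (hW₂ : W₂ ⊆ Ω) (hfin : volume W₂ ≠ ⊤) (hne : volume (W₁ ∩ W₂) ≠ 0) :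
    PoincareOn Ω (W₁ ∪ W₂) := by
  obtain ⟨C₁, h₁⟩ := h₁
  obtain ⟨C₂, h₂⟩ := h₂
  have hfin' : volume (W₁ ∩ W₂) ≠ ⊤ := ne_top_of_le_ne_top hfin (measure_mono Set.inter_subset_right)
  have hb0 : volume (W₁ ∩ W₂) ^ (1 / 2 : ℝ) ≠ 0 := by
    simpa using fun h => (hne h).elim
  have hbt : volume (W₁ ∩ W₂) ^ (1 / 2 : ℝ) ≠ ⊤ := ENNReal.rpow_ne_top_of_nonneg (by norm_num) hfin'
  obtain ⟨ρ, hρ⟩ : ∃ ρ : ℝ≥0, (ρ : ℝ≥0∞) =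
      volume W₂ ^ (1 / 2 : ℝ) / volume (W₁ ∩ W₂) ^ (1 / 2 : ℝ) :=
    ENNReal.canLift.prf _
      (ENNReal.div_ne_top (ENNReal.rpow_ne_top_of_nonneg (by norm_num) hfin) hb0)
  refine ⟨C₁ + (C₂ + ρ * (C₁ + C₂)), fun u G hu hG huG => ?_⟩
  obtain ⟨m₁, hm₁⟩ := h₁ u G hu hG huG
  obtain ⟨m₂, hm₂⟩ := h₂ u G hu hG huG
  refine ⟨m₁, ?_⟩
  have hmeas : ∀ W ⊆ Ω, ∀ m : ℝ, AEStronglyMeasurable (fun x => u x - m) (volume.restrict W) :=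
    fun W hW m => (hu.1.mono_measure (Measure.restrict_mono_set _ hW)).sub
      aestronglyMeasurable_const
  have hI : eLpNorm (fun _ : Rn n => m₂ - m₁) 2 (volume.restrict (W₁ ∩ W₂))
      ≤ (C₁ + C₂) * eLpNorm G 2 (volume.restrict Ω) := by
    have : (fun _ : Rn n => m₂ - m₁) = (fun x => u x - m₁) - (fun x => u x - m₂) := by
      funext x; simp
    have hsub : W₁ ∩ W₂ ⊆ Ω := Set.inter_subset_left.trans hW₁
    rw [this, add_mul]
    refine (eLpNorm_sub_le (hmeas _ hsub _) (hmeas _ hsub _) (by norm_num)).trans (add_le_add ?_ ?_)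
    · exact (eLpNorm_mono_measure _ (Measure.restrict_mono_set _ Set.inter_subset_left)).trans hm₁
    · exact (eLpNorm_mono_measure _ (Measure.restrict_mono_set _ Set.inter_subset_right)).trans hm₂
  have hc : eLpNorm (fun _ : Rn n => m₂ - m₁) 2 (volume.restrict W₂)
      = ρ * eLpNorm (fun _ : Rn n => m₂ - m₁) 2 (volume.restrict (W₁ ∩ W₂)) := by
    rw [eLpNorm_const' _ (by norm_num) (by norm_num), eLpNorm_const' _ (by norm_num) (by norm_num),
      hρ]
    simp only [Measure.restrict_apply_univ, ENNReal.toReal_ofNat]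
    rw [mul_left_comm, ENNReal.div_mul_cancel hb0 hbt]
  have hW2 : eLpNorm (fun x => u x - m₁) 2 (volume.restrict W₂)
      ≤ (C₂ + ρ * (C₁ + C₂)) * eLpNorm G 2 (volume.restrict Ω) := by
    have : (fun x => u x - m₁) = (fun x => u x - m₂) + fun _ => m₂ - m₁ := by
      funext x; simp
    rw [this, add_mul]
    refine (eLpNorm_add_le (hmeas _ hW₂ _) aestronglyMeasurable_const (by norm_num)).trans
      (add_le_add hm₂ ?_)
    rw [hc, mul_assoc]
    gcongr
  push_cast
  rw [add_mul]
  refine le_trans ?_ (add_le_add hm₁ hW2)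
  refine (ENNReal.pow_le_pow_left_iff two_ne_zero).1 ?_
  calc _ ≤ eLpNorm (fun x => u x - m₁) 2 (volume.restrict W₁) ^ 2
        + eLpNorm (fun x => u x - m₁) 2 (volume.restrict W₂) ^ 2 := by
        rw [eLpNorm_two_sq, eLpNorm_two_sq, eLpNorm_two_sq]
        exact lintegral_union_le _ _ _
    _ ≤ _ := by
        rw [add_sq']
        exact le_self_add

theorem HasWeakGradient.congr_left {u u' : Rn n → ℝ} {G : Rn n → Rn n}
    (h : HasWeakGradient Ω u G) (huu' : u =ᵐ[volume.restrict Ω] u') : HasWeakGradient Ω u' G := by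
  intro φ h1 h2 h3 v
  rw [← h φ h1 h2 h3 v]
  refine integral_congr_ae ?_
  filter_upwards [huu'] with x hx
  rw [hx]

/-- On a ball, averaging the increment estimate over all increments bounds
`∬ |u x - u y|² dx dy`; then some value `u y` is a suitable constant. -/
theorem poincareOn_ball (hΩ : IsOpen Ω) (hΩb : Bornology.IsBounded Ω) {x₀ : Rn n} {R : ℝ}
    (hR : 0 < R) (hB : Metric.ball x₀ R ⊆ Ω) : PoincareOn Ω (Metric.ball x₀ R) := by
  set B := Metric.ball x₀ R with hBdef
  have hBm : MeasurableSet B := measurableSet_ball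
  have hB0 : volume B ≠ 0 := (Metric.measure_ball_pos volume x₀ hR).ne'
  have hBt : volume B ≠ ⊤ := measure_ball_lt_top.ne
  set C₀ : ℝ≥0∞ := volume (Metric.ball (0 : Rn n) (2 * R)) * ENNReal.ofReal (2 * R) ^ 2 / volume B
    with hC₀
  have hC₀t : C₀ ≠ ⊤ := ENNReal.div_ne_top
    (ENNReal.mul_ne_top measure_ball_lt_top.ne (ENNReal.pow_ne_top ENNReal.ofReal_ne_top)) hB0
  refine ⟨1 + C₀.toNNReal, fun u₀ G hu₀ hGm hu₀G => ?_⟩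
  set u := hu₀.1.mk u₀ with hudef
  have huu : u₀ =ᵐ[volume.restrict Ω] u := hu₀.1.ae_eq_mk
  have hum : Measurable u := hu₀.1.stronglyMeasurable_mk.measurable
  have hu : MemLp u 2 (volume.restrict Ω) := (memLp_congr_ae huu).1 hu₀
  have hG : HasWeakGradient Ω u G := hu₀G.congr_left huu
  set g := eLpNorm G 2 (volume.restrict Ω) with hg
  let F : Rn n → Rn n → ℝ≥0∞ := fun x y =>
    B.indicator 1 x * (B.indicator 1 y * ‖u y - u x‖ₑ ^ 2)
  have hind : Measurable (B.indicator (1 : Rn n → ℝ≥0∞)) := measurable_one.indicator hBm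
  have hFm : Measurable (fun q : Rn n × Rn n => F q.1 q.2) := by
    refine (hind.comp measurable_fst).mul ((hind.comp measurable_snd).mul ?_)
    exact ((hum.comp measurable_snd).sub (hum.comp measurable_fst)).enorm.pow_const 2
  have hslice : ∀ h : Rn n, ∫⁻ x, F x (x + h) ≤
      (Metric.ball (0 : Rn n) (2 * R)).indicator (fun _ => ENNReal.ofReal (2 * R) ^ 2 * g ^ 2) h := by
    intro h
    by_cases hh : h ∈ Metric.ball (0 : Rn n) (2 * R)
    · rw [Set.indicator_of_mem hh]
      set K := B ∩ (fun x => x + h) ⁻¹' B with hK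
      have hKo : IsOpen K := Metric.isOpen_ball.inter (Metric.isOpen_ball.preimage (by fun_prop))
      have h1 : ∫⁻ x, F x (x + h) = ∫⁻ x in K, ‖u (x + h) - u x‖ₑ ^ 2 := by
        rw [← lintegral_indicator hKo.measurableSet]
        refine lintegral_congr fun x => ?_
        by_cases hx : x ∈ B <;> by_cases hx' : x + h ∈ B <;>
          simp [F, K, hx, hx']
      rw [h1, ← eLpNorm_two_sq, ← mul_pow]
      refine pow_le_pow_left₀ zero_le ?_ 2
      refine (hG.eLpNorm_increment_le hΩ hΩb hu hGm hKo h ?_).trans ?_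
      · intro x hx t ht
        refine hB ?_
        have := (convex_ball x₀ R).add_smul_sub_mem hx.1 hx.2 ht
        rwa [add_sub_cancel_left] at this
      · gcongr
        exact (mem_ball_zero_iff.1 hh).le
    · rw [Set.indicator_of_notMem hh, nonpos_iff_eq_zero, lintegral_eq_zero_iff' (by
        exact (hFm.comp (measurable_id.prodMk (measurable_id.add_const h))).aemeasurable)]
      refine Eventually.of_forall fun x => ?_
      by_contra hne
      have hx : x ∈ B := by
        by_contra hx
        simp [F, hx] at hne
      have hx' : x + h ∈ B := by
        by_contra hx'
        simp [F, hx'] at hne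
      refine hh (mem_ball_zero_iff.2 ?_)
      rw [hBdef, mem_ball_iff_norm] at hx hx'
      calc ‖h‖ = ‖(x + h - x₀) - (x - x₀)‖ := by congr 1; abel
        _ ≤ ‖x + h - x₀‖ + ‖x - x₀‖ := norm_sub_le _ _
        _ < 2 * R := by linarith
  have hdouble : ∫⁻ x in B, ∫⁻ y in B, ‖u y - u x‖ₑ ^ 2
      ≤ volume (Metric.ball (0 : Rn n) (2 * R)) * ENNReal.ofReal (2 * R) ^ 2 * g ^ 2 := by
    calc ∫⁻ x in B, ∫⁻ y in B, ‖u y - u x‖ₑ ^ 2 = ∫⁻ x, ∫⁻ y, F x y := by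
          rw [← lintegral_indicator hBm]
          refine lintegral_congr fun x => ?_
          by_cases hx : x ∈ B
          · rw [Set.indicator_of_mem hx, ← lintegral_indicator hBm]
            refine lintegral_congr fun y => ?_
            by_cases hy : y ∈ B <;> simp [F, hx, hy]
          · simp [F, hx]
      _ = ∫⁻ x, ∫⁻ h, F x (x + h) := by
          refine lintegral_congr fun x => ?_
          exact (lintegral_add_left_eq_self (fun y => F x y) x).symm
      _ = ∫⁻ h, ∫⁻ x, F x (x + h) := by
          refine lintegral_lintegral_swap ?_
          exact (hFm.comp (measurable_fst.prodMk (measurable_fst.add measurable_snd))).aemeasurable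
      _ ≤ ∫⁻ h, (Metric.ball (0 : Rn n) (2 * R)).indicator
            (fun _ => ENNReal.ofReal (2 * R) ^ 2 * g ^ 2) h := lintegral_mono hslice
      _ = _ := by
          rw [lintegral_indicator measurableSet_ball, setLIntegral_const]
          ring
  obtain ⟨y, -, hy⟩ := exists_le_setLAverage (μ := (volume : Measure (Rn n))) hB0 hBt
    (f := fun x => ∫⁻ y in B, ‖u y - u x‖ₑ ^ 2) (by
      refine Measurable.aemeasurable ?_
      refine Measurable.lintegral_prod_right' (f := fun q : Rn n × Rn n => ‖u q.2 - u q.1‖ₑ ^ 2) ?_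
      exact ((hum.comp measurable_snd).sub (hum.comp measurable_fst)).enorm.pow_const 2)
  refine ⟨u y, ?_⟩
  have hae : eLpNorm (fun x => u₀ x - u y) 2 (volume.restrict B)
      = eLpNorm (fun x => u x - u y) 2 (volume.restrict B) := by
    refine eLpNorm_congr_ae ?_
    filter_upwards [ae_restrict_of_ae_restrict_of_subset hB huu] with x hx
    rw [hx]
  rw [hae]
  refine (ENNReal.pow_le_pow_left_iff two_ne_zero).1 ?_
  rw [eLpNorm_two_sq, mul_pow]
  refine hy.trans ?_
  rw [setLAverage_eq]
  calc _ ≤ volume (Metric.ball (0 : Rn n) (2 * R)) * ENNReal.ofReal (2 * R) ^ 2 * g ^ 2 / volume B := by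
        gcongr
    _ = C₀ * g ^ 2 := by
        rw [hC₀, div_eq_mul_inv, div_eq_mul_inv]; ring
    _ ≤ _ := by
        gcongr
        push_cast
        rw [ENNReal.coe_toNNReal hC₀t]
        calc C₀ ≤ 1 + C₀ := le_add_self
          _ = (1 + C₀) * 1 := (mul_one _).symm
          _ ≤ (1 + C₀) * (1 + C₀) := by gcongr; exact le_self_add
          _ = _ := (sq _).symm

/-- Near a boundary point, `Ω` is translated into an interior ball along the direction in which the
boundary is a graph, so the Poincaré inequality there follows from the one on that ball. -/
theorem HasSmoothBoundary.exists_poincareOn (hS : HasSmoothBoundary Ω) (hΩ : IsOpen Ω)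
    (hΩb : Bornology.IsBounded Ω) {x : Rn n} (hx : x ∈ frontier Ω) :
    ∃ ρ : ℝ, 0 < ρ ∧ PoincareOn Ω (Ω ∩ Metric.ball x ρ) := by
  obtain ⟨r, hr, ν, hν, g, hg, hginv, hmem⟩ := hS x hx
  have hgc : Continuous g := hg.continuous
  have hinner : ∀ (y : Rn n) (t : ℝ), inner ℝ (y + t • ν) ν = inner ℝ y ν + t := by
    intro y t
    rw [inner_add_left, inner_smul_left, real_inner_self_eq_norm_sq, hν]
    simp
  have hle : g x ≤ inner ℝ x ν := by
    have hcl : x ∈ closure (Ω ∩ Metric.ball x r) := by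
      rw [Set.inter_comm]
      exact Metric.isOpen_ball.inter_closure ⟨Metric.mem_ball_self hr, frontier_subset_closure hx⟩
    have hclosed : IsClosed {y : Rn n | g y ≤ inner ℝ y ν} :=
      isClosed_le hgc (by fun_prop)
    exact closure_minimal (fun y hy => ((hmem y hy.2).1 hy.1).le) hclosed hcl
  have hev : ∀ᶠ y in 𝓝 x, g y - inner ℝ y ν < r / 2 := by
    have : ContinuousAt (fun y : Rn n => g y - inner ℝ y ν) x := by fun_prop
    exact this.eventually_lt continuousAt_const (by linarith)
  obtain ⟨ρ₀, hρ₀, hball⟩ := Metric.eventually_nhds_iff_ball.1 hev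
  set ρ := min ρ₀ (r / 2) with hρ
  have hρpos : 0 < ρ := lt_min hρ₀ (by positivity)
  set h : Rn n := (r / 2) • ν with hh
  have hnear : ∀ y ∈ Metric.ball x ρ, ∀ t ∈ Set.Icc (0 : ℝ) 1, y + t • h ∈ Metric.ball x r := by
    intro y hy t ht
    rw [mem_ball_iff_norm] at hy ⊢
    have h1 : ‖t • h‖ ≤ r / 2 := by
      rw [hh, norm_smul, norm_smul, hν, Real.norm_of_nonneg ht.1, Real.norm_of_nonneg (by positivity)]
      nlinarith [ht.2]
    calc ‖y + t • h - x‖ = ‖(y - x) + t • h‖ := by congr 1; abel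
      _ ≤ ‖y - x‖ + ‖t • h‖ := norm_add_le _ _
      _ < r := by linarith [min_le_right ρ₀ (r / 2)]
  have hball' : Metric.ball (x + h) ρ ⊆ Ω := by
    intro y hy
    have hy' : y - h ∈ Metric.ball x ρ := by
      rw [mem_ball_iff_norm] at hy ⊢
      rwa [sub_sub, add_comm h x]
    have h1 := hnear _ hy' 1 (by simp)
    rw [one_smul, sub_add_cancel] at h1
    rw [hmem y h1]
    have h2 := hball (y - h) (Metric.ball_subset_ball (min_le_left _ _) hy')
    have h3 := hinner (y - h) (r / 2)
    have h4 := hginv (y - h) (r / 2)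
    rw [← hh, sub_add_cancel] at h3 h4
    rw [h3, h4]
    linarith
  obtain ⟨C, hC⟩ := poincareOn_ball hΩ hΩb hρpos hball'
  refine ⟨ρ, hρpos, ‖h‖₊ + C, fun u G hu hGm huG => ?_⟩
  obtain ⟨m, hm⟩ := hC u G hu hGm huG
  refine ⟨m, ?_⟩
  set K := Ω ∩ Metric.ball x ρ with hK
  have hKo : IsOpen K := hΩ.inter Metric.isOpen_ball
  have hKΩ : ∀ y ∈ K, ∀ t ∈ Set.Icc (0 : ℝ) 1, y + t • h ∈ Ω := by
    intro y hy t ht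
    have h1 := hnear y hy.2 t ht
    rw [hmem _ h1, hh, smul_smul, hinner, hginv]
    have h0 := hnear y hy.2 0 (by simp)
    rw [zero_smul, add_zero] at h0
    have := (hmem y h0).1 hy.1
    have : 0 ≤ t * (r / 2) := mul_nonneg ht.1 (by positivity)
    linarith
  have hKB : ∀ y ∈ K, y + h ∈ Metric.ball (x + h) ρ := by
    intro y hy
    have := hy.2
    rw [mem_ball_iff_norm] at this ⊢
    rwa [add_sub_add_right_eq_sub]
  have huB : AEStronglyMeasurable (fun y => u y - m) (volume.restrict (Metric.ball (x + h) ρ)) :=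
    (hu.1.mono_measure (Measure.restrict_mono_set _ hball')).sub aestronglyMeasurable_const
  have htr := eLpNorm_translate_le measurableSet_ball huB h hKB
  have huK : AEStronglyMeasurable u (volume.restrict K) :=
    hu.1.mono_measure (Measure.restrict_mono_set _ Set.inter_subset_left)
  have hKΩ1 : ∀ y ∈ K, y + h ∈ Ω := fun y hy => by simpa using hKΩ y hy 1 (by simp)
  have huh := (eLpNorm_translate_le hΩ.measurableSet hu.1 h hKΩ1).1
  have hsplit : (fun y => u y - m) = (fun y => u (y + h) - m) - fun y => u (y + h) - u y := by
    funext y; simp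
  rw [hsplit]
  refine (eLpNorm_sub_le htr.1 (huh.sub huK) (by norm_num)).trans ?_
  push_cast
  rw [add_comm (‖h‖₊ : ℝ≥0∞), add_mul]
  refine add_le_add (htr.2.trans hm) ?_
  refine (huG.eLpNorm_increment_le hΩ hΩb hu hGm hKo h hKΩ).trans (le_of_eq ?_)
  rw [ofReal_norm]
  rfl

/-- Near each point of `closure Ω` there is a Poincaré inequality; connectedness lets these be
chained to any point, and compactness lets finitely many of them suffice. -/
theorem HasSmoothBoundary.poincareOn (hS : HasSmoothBoundary Ω) (hΩ : IsOpen Ω)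
    (hΩb : Bornology.IsBounded Ω) (hΩc : IsConnected Ω) : PoincareOn Ω Ω := by
  have hfin : ∀ W ⊆ Ω, volume W ≠ ⊤ := fun W hW =>
    ne_top_of_le_ne_top hΩb.measure_lt_top.ne (measure_mono hW)
  have hloc : ∀ x ∈ closure Ω, ∃ N : Set (Rn n), IsOpen N ∧ x ∈ N ∧ PoincareOn Ω (Ω ∩ N) := by
    intro x hx
    by_cases hxΩ : x ∈ Ω
    · obtain ⟨R, hR, hB⟩ := Metric.isOpen_iff.1 hΩ x hxΩ
      exact ⟨Metric.ball x R, Metric.isOpen_ball, Metric.mem_ball_self hR,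
        (poincareOn_ball hΩ hΩb hR hB).mono Set.inter_subset_right⟩
    · obtain ⟨ρ, hρ, hP⟩ := hS.exists_poincareOn hΩ hΩb (x := x) (by
        rw [hΩ.frontier_eq]; exact ⟨hx, hxΩ⟩)
      exact ⟨Metric.ball x ρ, Metric.isOpen_ball, Metric.mem_ball_self hρ, hP⟩
  have hunion : ∀ N₁ N₂ : Set (Rn n), IsOpen N₁ → IsOpen N₂ → PoincareOn Ω (Ω ∩ N₁) →
      PoincareOn Ω (Ω ∩ N₂) → (closure Ω ∩ (N₁ ∩ N₂)).Nonempty →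
      PoincareOn Ω (Ω ∩ (N₁ ∪ N₂)) := by
    intro N₁ N₂ ho₁ ho₂ h₁ h₂ ⟨y, hy, hyN⟩
    rw [Set.inter_union_distrib_left]
    refine h₁.union h₂ Set.inter_subset_left Set.inter_subset_left
      (hfin _ Set.inter_subset_left) ?_
    rw [← Set.inter_inter_distrib_left]
    refine ((hΩ.inter (ho₁.inter ho₂)).measure_pos volume ?_).ne'
    obtain ⟨z, hz, hz'⟩ := mem_closure_iff.1 hy _ (ho₁.inter ho₂) hyN
    exact ⟨z, hz', hz⟩
  obtain ⟨x₀, hx₀⟩ := hΩc.nonempty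
  have hx₀' := subset_closure hx₀
  -- the points of `Ω` that lie in a common set with `x₀` on which a Poincaré inequality holds
  let U : Set (Rn n) := ⋃₀ {W | ∃ N, IsOpen N ∧ x₀ ∈ N ∧ PoincareOn Ω (Ω ∩ N) ∧ W = Ω ∩ N}
  have hstep : ∀ y ∈ closure Ω, y ∈ closure U →
      ∃ N, IsOpen N ∧ x₀ ∈ N ∧ y ∈ N ∧ PoincareOn Ω (Ω ∩ N) := by
    intro y hyΩ hyU
    obtain ⟨N, h1, h2, h3⟩ := hloc y hyΩ
    obtain ⟨z, hz, W, ⟨N', k1, k2, k3, rfl⟩, hz'⟩ := mem_closure_iff.1 hyU N h1 h2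
    exact ⟨N ∪ N', h1.union k1, Or.inr k2, Or.inl h2,
      hunion N N' h1 k1 h3 k3 ⟨z, subset_closure hz'.1, hz, hz'.2⟩⟩
  have hcover : Ω ⊆ U := by
    refine hΩc.isPreconnected.subset_of_closure_inter_subset
      (isOpen_sUnion ?_) ?_ ?_
    · rintro W ⟨N, h1, -, -, rfl⟩
      exact hΩ.inter h1
    · obtain ⟨N, h1, h2, h3⟩ := hloc x₀ hx₀'
      exact ⟨x₀, hx₀, _, ⟨N, h1, h2, h3, rfl⟩, hx₀, h2⟩
    · rintro y ⟨hyU, hyΩ⟩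
      obtain ⟨N, h1, h2, h3, h4⟩ := hstep y (subset_closure hyΩ) hyU
      exact ⟨_, ⟨N, h1, h2, h4, rfl⟩, hyΩ, h3⟩
  have hcpt : IsCompact (closure Ω) := hΩb.isCompact_closure
  have := hcpt.induction_on
    (p := fun T => ∃ N : Set (Rn n), IsOpen N ∧ x₀ ∈ N ∧ T ⊆ N ∧ PoincareOn Ω (Ω ∩ N)) ?_ ?_ ?_ ?_
  · obtain ⟨N, -, -, hN, hP⟩ := this
    exact hP.mono fun x hx => ⟨hx, hN (subset_closure hx)⟩
  · obtain ⟨N, h1, h2, h3⟩ := hloc x₀ hx₀'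
    exact ⟨N, h1, h2, Set.empty_subset _, h3⟩
  · rintro s t hst ⟨N, h1, h2, h3, h4⟩
    exact ⟨N, h1, h2, hst.trans h3, h4⟩
  · rintro s t ⟨N, h1, h2, h3, h4⟩ ⟨N', k1, k2, k3, k4⟩
    exact ⟨N ∪ N', h1.union k1, Or.inl h2, Set.union_subset_union h3 k3,
      hunion N N' h1 k1 h4 k4 ⟨x₀, hx₀', h2, k2⟩⟩
  · intro x hx
    obtain ⟨N, h1, h2, hxN, h3⟩ := hstep x hx (closure_mono hcover hx)
    exact ⟨N, mem_nhdsWithin_of_mem_nhds (h1.mem_nhds hxN), N, h1, h2, le_rfl, h3⟩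

/-! ### The chain rule for weak gradients -/

theorem tendsto_eLpNorm_translate_sub {f : Rn n → ℝ} (hf : MemLp f 2 volume) :
    Tendsto (fun h : Rn n => eLpNorm (fun x => f (x + h) - f x) 2 volume) (𝓝 0) (𝓝 0) := by
  have hfact : Fact ((2 : ℝ≥0∞) ≠ ⊤) := ⟨by norm_num⟩
  have h1 : Continuous (fun h : Rn n => DomAddAct.mk h +ᵥ hf.toLp f) :=
    (DomAddAct.continuous_mk).vadd continuous_const
  have h2 : Tendsto (fun h : Rn n => edist (DomAddAct.mk h +ᵥ hf.toLp f)
      (DomAddAct.mk (0 : Rn n) +ᵥ hf.toLp f)) (𝓝 0) (𝓝 0) := by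
    have := (h1.edist (continuous_const (y := DomAddAct.mk (0 : Rn n) +ᵥ hf.toLp f))).tendsto 0
    simpa using this
  refine h2.congr fun h => ?_
  rw [DomAddAct.mk_vadd_toLp, DomAddAct.mk_vadd_toLp, Lp.edist_toLp_toLp]
  refine eLpNorm_congr_ae (Eventually.of_forall fun x => ?_)
  simp [vadd_eq_add, add_comm h x]

theorem setIntegral_mul_test_eq {K : Set (Rn n)} (hK : K ⊆ Ω) {F ψ : Rn n → ℝ}
    (hψ : tsupport ψ ⊆ K) : ∫ x in Ω, F x * ψ x = ∫ x in K, F x * ψ x := by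
  have h0 : ∀ x, x ∉ K → F x * ψ x = 0 := fun x hx => by
    rw [image_eq_zero_of_notMem_tsupport (fun h => hx (hψ h)), mul_zero]
  rw [setIntegral_eq_integral_of_forall_compl_eq_zero (fun x hx => h0 x fun h => hx (hK h)),
    setIntegral_eq_integral_of_forall_compl_eq_zero h0]

/-- Difference quotients of a weakly differentiable function converge in `L²` on compact parts of
the domain. -/
theorem HasWeakGradient.exists_diffQuotient_le {u : Rn n → ℝ} {G : Rn n → Rn n}
    (hΩ : IsOpen Ω) (hΩb : Bornology.IsBounded Ω)
    (hu : MemLp u 2 (volume.restrict Ω)) (hGm : MemLp G 2 (volume.restrict Ω))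
    (hG : HasWeakGradient Ω u G) {K : Set (Rn n)} (hK : IsOpen K) {r : ℝ} (hr : 0 < r)
    (hKΩ : ∀ x ∈ K, ∀ h : Rn n, ‖h‖ ≤ r → x + h ∈ Ω) (v : Rn n) {η : ℝ} (hη : 0 < η) :
    ∀ᶠ s in 𝓝[>] (0 : ℝ), eLpNorm (fun x => u (x + s • v) - u x - s * inner ℝ (G x) v) 2
      (volume.restrict K) ≤ ENNReal.ofReal (s * η) := by
  have hKΩ0 : K ⊆ Ω := fun x hx => by simpa using hKΩ x hx 0 (by simpa using hr.le)
  let γ : Rn n → ℝ := Ω.indicator fun x => inner ℝ (G x) v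
  have hγ : MemLp γ 2 volume := (memLp_indicator_iff_restrict hΩ.measurableSet).2 (hGm.inner_const v)
  have hH : MemLp (fun x => inner ℝ (G x) v) 2 (volume.restrict K) :=
    (hGm.inner_const v).mono_measure (Measure.restrict_mono_set _ hKΩ0)
  obtain ⟨ρ, hρ, hball⟩ := Metric.eventually_nhds_iff_ball.1
    ((tendsto_eLpNorm_translate_sub hγ).eventually_le_const (ENNReal.ofReal_pos.2 hη))
  have hs : ∀ᶠ s in 𝓝[>] (0 : ℝ), s * ‖v‖ < min r ρ := by
    have : Tendsto (fun s : ℝ => s * ‖v‖) (𝓝[>] 0) (𝓝 0) := by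
      have h : Tendsto (fun s : ℝ => s * ‖v‖) (𝓝 0) (𝓝 (0 * ‖v‖)) := tendsto_id.mul_const _
      rw [zero_mul] at h
      exact h.mono_left nhdsWithin_le_nhds
    exact this.eventually_lt_const (lt_min hr hρ)
  filter_upwards [hs, self_mem_nhdsWithin] with s hsv hs0
  have hs0 : 0 < s := hs0
  have hnorm : ∀ t ∈ Set.Icc (0 : ℝ) 1, ‖t • s • v‖ < min r ρ := by
    intro t ht
    refine lt_of_le_of_lt ?_ hsv
    rw [norm_smul, norm_smul, Real.norm_of_nonneg ht.1, Real.norm_of_nonneg hs0.le]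
    exact mul_le_of_le_one_left (by positivity) ht.2
  have hKt : ∀ x ∈ K, ∀ t ∈ Set.Icc (0 : ℝ) 1, x + t • s • v ∈ Ω :=
    fun x hx t ht => hKΩ x hx _ ((hnorm t ht).le.trans (min_le_left _ _))
  refine hG.eLpNorm_increment_sub_le hΩ hΩb hu hGm hK (s • v) hKt (hH.const_mul s)
    (by positivity) fun t ht => ?_
  have h1 := hball (t • s • v) (mem_ball_zero_iff.2 ((hnorm t ht).trans_le (min_le_right _ _)))
  have h2 : eLpNorm (fun x => inner ℝ (G (x + t • s • v)) (s • v) - s * inner ℝ (G x) v) 2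
      (volume.restrict K)
      = eLpNorm (s • fun x => γ (x + t • s • v) - γ x) 2 (volume.restrict K) := by
    refine eLpNorm_congr_ae ?_
    filter_upwards [ae_restrict_mem hK.measurableSet] with x hx
    simp only [γ, Pi.smul_apply, Set.indicator_of_mem (hKt x hx t ht),
      Set.indicator_of_mem (hKΩ0 hx), inner_smul_right, smul_eq_mul]
    ring
  rw [h2, eLpNorm_const_smul, ENNReal.ofReal_mul hs0.le, ← Real.enorm_of_nonneg hs0.le]
  gcongr
  exact (eLpNorm_mono_measure _ Measure.restrict_le_self).trans h1

theorem lipschitz_of_hasDerivAt {F F' : ℝ → ℝ} (hF : ∀ s, HasDerivAt F (F' s) s)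
    (hF' : ∀ s, |F' s| ≤ 1) (a b : ℝ) : |F a - F b| ≤ |a - b| := by
  have := (convex_univ).norm_image_sub_le_of_norm_hasDerivWithin_le (f := F) (f' := F') (C := 1)
    (fun s _ => (hF s).hasDerivWithinAt) (fun s _ => hF' s) (Set.mem_univ b) (Set.mem_univ a)
  simpa using this

/-- Chain rule for a differentiable outer function with slope at most `1`. The difference quotients
of `F ∘ u` are compared with those of `s ↦ F (u + s ⟪G, v⟫)`, since `u (x + s v)` differs from
`u x + s ⟪G x, v⟫` by `o(s)` in `L²` near the support of the test function. -/
theorem HasWeakGradient.comp {u : Rn n → ℝ} {G : Rn n → Rn n}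
    (hΩ : IsOpen Ω) (hΩb : Bornology.IsBounded Ω)
    (hu : MemLp u 2 (volume.restrict Ω)) (hGm : MemLp G 2 (volume.restrict Ω))
    (hG : HasWeakGradient Ω u G) {F F' : ℝ → ℝ} (hF : ∀ s, HasDerivAt F (F' s) s)
    (hF' : ∀ s, |F' s| ≤ 1) :
    HasWeakGradient Ω (fun x => F (u x)) (fun x => F' (u x) • G x) := by
  intro φ hφ hc hsupp v
  have : IsFiniteMeasure (volume.restrict Ω) := isFiniteMeasure_restrict.2 hΩb.measure_lt_top.ne
  have hLip := lipschitz_of_hasDerivAt hF hF'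
  have hFc : Continuous F := continuous_iff_continuousAt.2 fun s => (hF s).continuousAt
  obtain ⟨r, hr, hrΩ⟩ := hc.exists_cthickening_subset_open hΩ hsupp
  set K := Metric.thickening (r / 2) (tsupport φ) with hKdef
  have hK : IsOpen K := Metric.isOpen_thickening
  have hφK : tsupport φ ⊆ K := Metric.self_subset_thickening (by positivity) _
  have hKΩ : ∀ x ∈ K, ∀ h : Rn n, ‖h‖ ≤ r / 2 → x + h ∈ Ω := by
    intro x hx h hh
    refine hrΩ (Metric.thickening_subset_cthickening _ _ ?_)
    obtain ⟨z, hz, hxz⟩ := Metric.mem_thickening_iff.1 hx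
    refine Metric.mem_thickening_iff.2 ⟨z, hz, ?_⟩
    calc dist (x + h) z ≤ dist (x + h) x + dist x z := dist_triangle _ _ _
      _ < r := by rw [dist_self_add_left]; linarith
  have hKΩ0 : K ⊆ Ω := fun x hx => by simpa using hKΩ x hx 0 (by simp; positivity)
  have huK : MemLp u 2 (volume.restrict K) := hu.mono_measure (Measure.restrict_mono_set _ hKΩ0)
  have hFu : MemLp (fun x => F (u x)) 2 (volume.restrict Ω) := by
    refine ((memLp_const |F 0|).add hu.abs).mono' (hFc.comp_aestronglyMeasurable hu.1)
      (Eventually.of_forall fun x => ?_)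
    have := hLip (u x) 0
    rw [sub_zero] at this
    simp only [Pi.add_apply, Real.norm_eq_abs]
    calc |F (u x)| = |F 0 + (F (u x) - F 0)| := by congr 1; ring
      _ ≤ |F 0| + |F (u x) - F 0| := abs_add_le _ _
      _ ≤ _ := by gcongr; exact this
  have hφm : MemLp φ 2 (volume.restrict K) := hφ.continuous.memLp_of_hasCompactSupport hc
  set N := (eLpNorm φ 2 (volume.restrict K)).toReal
  let g : Rn n → ℝ := fun x => inner ℝ (G x) v
  have hg : MemLp g 2 (volume.restrict K) :=
    (hGm.inner_const v).mono_measure (Measure.restrict_mono_set _ hKΩ0)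
  have int_mul : ∀ {f : Rn n → ℝ}, MemLp f 2 (volume.restrict K) →
      Integrable (fun x => f x * φ x) (volume.restrict K) :=
    fun hf => MemLp.integrable_mul (p := 2) (q := 2) hf hφm
  -- difference quotients of `F ∘ u` along `v`, paired with `φ`
  have hA : Tendsto (fun s : ℝ => s⁻¹ * ((∫ x in Ω, F (u x) * φ (x - s • v)) -
      ∫ x in Ω, F (u x) * φ x)) (𝓝[>] 0) (𝓝 (-∫ x in Ω, F (u x) * fderiv ℝ φ x v)) := by
    have h := hasDerivAt_integral_mul_translate (hFu.integrable (by norm_num)) hφ hc v 0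
    simp only [zero_smul, sub_zero] at h
    have := h.tendsto_slope_zero_right
    simpa using this
  have hQ : Tendsto (fun s : ℝ => ∫ x in K, s⁻¹ * (F (u x + s * g x) - F (u x)) * φ x)
      (𝓝[>] 0) (𝓝 (∫ x in K, F' (u x) * g x * φ x)) := by
    refine tendsto_integral_filter_of_dominated_convergence (fun x => |g x| * |φ x|) ?_ ?_ ?_ ?_
    · refine Eventually.of_forall fun s => ?_
      refine AEStronglyMeasurable.mul ?_ hφm.1
      exact ((hFc.comp_aestronglyMeasurable (huK.1.add (hg.1.const_mul s))).sub
        (hFc.comp_aestronglyMeasurable huK.1)).const_mul _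
    · filter_upwards [self_mem_nhdsWithin] with s hs
      have hs : 0 < s := hs
      refine Eventually.of_forall fun x => ?_
      rw [norm_mul, norm_mul, norm_inv, Real.norm_of_nonneg hs.le]
      refine mul_le_mul_of_nonneg_right ?_ (norm_nonneg _)
      rw [inv_mul_le_iff₀ hs]
      refine (hLip _ _).trans (le_of_eq ?_)
      rw [add_sub_cancel_left, abs_mul, abs_of_pos hs]
    · simpa [abs_mul] using (int_mul hg).abs
    · refine Eventually.of_forall fun x => Tendsto.mul_const _ ?_
      have h1 : HasDerivAt (fun s : ℝ => F (u x + s * g x)) (F' (u x) * g x) 0 := by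
        have h2 : HasDerivAt (fun s : ℝ => u x + s * g x) (g x) 0 := by
          simpa using ((hasDerivAt_id (0 : ℝ)).mul_const (g x)).const_add (u x)
        have h3 : HasDerivAt F (F' (u x)) (u x + 0 * g x) := by simpa using hF (u x)
        exact h3.comp (0 : ℝ) h2
      have := h1.tendsto_slope_zero_right
      simpa using this
  have hdiff : Tendsto (fun s : ℝ => s⁻¹ * ((∫ x in Ω, F (u x) * φ (x - s • v)) -
      ∫ x in Ω, F (u x) * φ x) - ∫ x in K, s⁻¹ * (F (u x + s * g x) - F (u x)) * φ x)
      (𝓝[>] 0) (𝓝 0) := by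
    rw [Metric.tendsto_nhds]
    intro κ hκ
    have hN : 0 ≤ N := ENNReal.toReal_nonneg
    have hη : 0 < κ / (N + 1) := by positivity
    have hsmall : ∀ᶠ s in 𝓝[>] (0 : ℝ), s * ‖v‖ < r / 2 := by
      have h : Tendsto (fun s : ℝ => s * ‖v‖) (𝓝 0) (𝓝 (0 * ‖v‖)) := tendsto_id.mul_const _
      rw [zero_mul] at h
      exact (h.mono_left nhdsWithin_le_nhds).eventually_lt_const (by positivity)
    filter_upwards [hG.exists_diffQuotient_le hΩ hΩb hu hGm hK (half_pos hr) hKΩ v hη, hsmall,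
      self_mem_nhdsWithin] with s hs hsv hs0
    have hs0 : 0 < s := hs0
    have hKs : ∀ x ∈ K, x + s • v ∈ Ω := fun x hx => hKΩ x hx _ (by
      rw [norm_smul, Real.norm_of_nonneg hs0.le]; exact hsv.le)
    have hus : MemLp (fun x => u (x + s • v)) 2 (volume.restrict K) :=
      MemLp.translate hΩ.measurableSet hu _ hKs
    have hFus : MemLp (fun x => F (u (x + s • v))) 2 (volume.restrict K) :=
      MemLp.translate hΩ.measurableSet hFu _ hKs
    have hFuK : MemLp (fun x => F (u x)) 2 (volume.restrict K) :=
      hFu.mono_measure (Measure.restrict_mono_set _ hKΩ0)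
    set E : Rn n → ℝ := fun x => u (x + s • v) - u x - s * g x with hE
    have hEm : MemLp E 2 (volume.restrict K) := (hus.sub huK).sub (hg.const_mul s)
    set R : Rn n → ℝ := fun x => F (u (x + s • v)) - F (u x + s * g x) with hR
    have hRE : ∀ x, |R x| ≤ |E x| := fun x => by
      refine (hLip _ _).trans (le_of_eq ?_)
      rw [hE]; congr 1; ring
    have hRm : MemLp R 2 (volume.restrict K) := by
      refine hEm.abs.mono' ?_ (Eventually.of_forall fun x => by simpa using hRE x)
      exact hFus.1.sub (hFc.comp_aestronglyMeasurable (huK.1.add (hg.1.const_mul s)))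
    have hFg : MemLp (fun x => F (u x + s * g x)) 2 (volume.restrict K) := by
      have := hFus.sub hRm
      refine (memLp_congr_ae (Eventually.of_forall fun x => ?_)).1 this
      simp [hR]
    have heq : s⁻¹ * ((∫ x in Ω, F (u x) * φ (x - s • v)) - ∫ x in Ω, F (u x) * φ x)
        - ∫ x in K, s⁻¹ * (F (u x + s * g x) - F (u x)) * φ x = s⁻¹ * ∫ x in K, R x * φ x := by
      rw [integral_mul_translate_eq (F := fun x => F (u x)) (s • v) hφK hKs,
        setIntegral_mul_test_eq hKΩ0 hφK]
      simp_rw [mul_assoc]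
      rw [integral_const_mul, ← mul_sub, ← integral_sub (int_mul hFus) (int_mul hFuK),
        ← integral_sub (by exact (int_mul hFus).sub (int_mul hFuK))
          (by exact int_mul (hFg.sub hFuK))]
      congr 1
      refine integral_congr_ae (Eventually.of_forall fun x => ?_)
      simp only [hR]
      ring
    rw [dist_zero_right, heq, norm_mul, norm_inv, Real.norm_of_nonneg hs0.le,
      inv_mul_lt_iff₀ hs0]
    have hle : (eLpNorm R 2 (volume.restrict K)).toReal ≤ s * (κ / (N + 1)) :=
      ENNReal.toReal_le_of_le_ofReal (by positivity)
        ((eLpNorm_mono fun x => hRE x).trans hs)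
    calc ‖∫ x in K, R x * φ x‖ ≤ (eLpNorm R 2 (volume.restrict K)).toReal * N :=
          abs_integral_mul_le_eLpNorm hRm hφm
      _ ≤ s * (κ / (N + 1)) * N := by gcongr
      _ = s * (κ * (N / (N + 1))) := by ring
      _ < s * κ := by
          have : N / (N + 1) < 1 := (div_lt_one (by positivity)).2 (by linarith)
          have : κ * (N / (N + 1)) < κ * 1 := by gcongr
          rw [mul_one] at this
          gcongr
  have hlim := tendsto_nhds_unique hA (by simpa using hdiff.add hQ)
  rw [← neg_eq_iff_eq_neg, hlim, ← setIntegral_mul_test_eq hKΩ0 hφK]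
  refine integral_congr_ae (Eventually.of_forall fun x => ?_)
  simp [g, inner_smul_left]

/-! ### The maximum principle -/

theorem HasWeakGradient.congr {u u' : Rn n → ℝ} {G G' : Rn n → Rn n}
    (h : HasWeakGradient Ω u G) (huu' : u =ᵐ[volume.restrict Ω] u')
    (hGG' : G =ᵐ[volume.restrict Ω] G') : HasWeakGradient Ω u' G' := by
  intro φ h1 h2 h3 v
  refine ((h.congr_left huu') φ h1 h2 h3 v).trans (congrArg Neg.neg (integral_congr_ae ?_))
  filter_upwards [hGG'] with x hx
  rw [hx]

theorem HasWeakGradient.exists_H1 {u : Rn n → ℝ} {G : Rn n → Rn n}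
    (hu : MemLp u 2 (volume.restrict Ω)) (hG : MemLp G 2 (volume.restrict Ω))
    (h : HasWeakGradient Ω u G) :
    ∃ w : H1 Ω, fn w =ᵐ[volume.restrict Ω] u ∧ grad w =ᵐ[volume.restrict Ω] G :=
  ⟨⟨(hu.toLp u, hG.toLp G), h.congr hu.coeFn_toLp.symm hG.coeFn_toLp.symm⟩,
    hu.coeFn_toLp, hG.coeFn_toLp⟩

theorem fn_neg (u : H1 Ω) : fn (-u) =ᵐ[volume.restrict Ω] fun x => -fn u x :=
  Lp.coeFn_neg (fn u)

theorem grad_neg (u : H1 Ω) : grad (-u) =ᵐ[volume.restrict Ω] fun x => -grad u x :=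
  Lp.coeFn_neg (grad u)

/-- A `C¹` function vanishing on `(-∞, 0]`, positive and increasing on `(0, ∞)`, with slope at
most `1`: a regularisation of the positive part. -/
theorem exists_smooth_positivePart : ∃ F F' : ℝ → ℝ, (∀ s, HasDerivAt F (F' s) s) ∧
    Continuous F' ∧ (∀ s, 0 ≤ F' s) ∧ (∀ s, F' s ≤ 1) ∧ (∀ s ≤ 0, F s = 0) ∧
    (∀ s, 0 < s → 0 < F s) := by
  have hc : Continuous fun t : ℝ => max 0 (min t 1) := by fun_prop
  refine ⟨fun s => ∫ t in (0 : ℝ)..s, max 0 (min t 1), fun t => max 0 (min t 1),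
    fun s => hc.integral_hasStrictDerivAt 0 s |>.hasDerivAt, hc, fun s => le_max_left _ _,
    fun s => max_le zero_le_one (min_le_right _ _), fun s hs => ?_, fun s hs => ?_⟩
  · refine (intervalIntegral.integral_congr (g := fun _ => 0) fun t ht => ?_).trans (by simp)
    rw [Set.uIcc_of_ge hs] at ht
    exact max_eq_left ((min_le_left _ _).trans ht.2)
  · refine intervalIntegral.intervalIntegral_pos_of_pos_on (hc.intervalIntegrable _ _)
      (fun t ht => ?_) hs
    exact lt_max_of_lt_right (lt_min ht.1 one_pos)

/-- The energy identity tested with a regularisation of `(u - M)⁺` shows that a weak equilibrium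
stays below any level above which the nonlinearity is nonpositive. -/
theorem IsWeakEquilibrium.ae_le (hΩ : IsOpen Ω) (hΩb : Bornology.IsBounded Ω)
    {d a : Rn n → ℝ} {f : ℝ → ℝ} {m₀ M : ℝ} (hm₀ : 0 < m₀)
    (hd : ∀ᵐ x ∂(volume.restrict Ω), 0 ≤ d x)
    (ham : AEStronglyMeasurable a (volume.restrict Ω))
    (ha : ∀ᵐ x ∂(volume.restrict Ω), m₀ ≤ a x) (hM : 0 ≤ M) (hfM : ∀ s, M < s → f s ≤ 0)
    {u : H1 Ω} (hu : IsWeakEquilibrium d a f u) :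
    ∀ᵐ x ∂(volume.restrict Ω), fn u x ≤ M := by
  obtain ⟨F, F', hF, hF'c, hF'0, hF'1, hF0, hFpos⟩ := exists_smooth_positivePart
  have hFm : ∀ s, HasDerivAt (fun s => F (s - M)) (F' (s - M)) s := fun s =>
    (hF (s - M)).comp_sub_const s M
  have habs : ∀ s, |F' (s - M)| ≤ 1 := fun s => by
    rw [abs_of_nonneg (hF'0 _)]; exact hF'1 _
  have hFc : Continuous F := continuous_iff_continuousAt.2 fun s => (hF s).continuousAt
  have hFnn : ∀ s, 0 ≤ F s := fun s => by
    rcases le_or_gt s 0 with hs | hs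
    · exact (hF0 s hs).ge
    · exact (hFpos s hs).le
  have hFle : ∀ s, |F (s - M)| ≤ |s| := fun s => by
    rcases le_or_gt s M with hs | hs
    · rw [hF0 _ (by linarith), abs_zero]; exact abs_nonneg s
    · have := lipschitz_of_hasDerivAt hF (fun s => by
        rw [abs_of_nonneg (hF'0 _)]; exact hF'1 _) (s - M) 0
      rw [hF0 0 le_rfl, sub_zero, sub_zero, abs_of_pos (sub_pos.2 hs)] at this
      rw [abs_of_pos (hM.trans_lt hs)]
      linarith
  have hum : MemLp (fn u) 2 (volume.restrict Ω) := Lp.memLp _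
  have hgm : MemLp (grad u) 2 (volume.restrict Ω) := Lp.memLp _
  have hwg : HasWeakGradient Ω (fun x => F (fn u x - M)) (fun x => F' (fn u x - M) • grad u x) :=
    HasWeakGradient.comp hΩ hΩb hum hgm u.2 hFm habs
  have hFu_meas : AEStronglyMeasurable (fun x => F (fn u x - M)) (volume.restrict Ω) :=
    hFc.comp_aestronglyMeasurable (hum.1.sub aestronglyMeasurable_const)
  have hFum : MemLp (fun x => F (fn u x - M)) 2 (volume.restrict Ω) :=
    hum.abs.mono' hFu_meas (Eventually.of_forall fun x => hFle _)
  have hFgm : MemLp (fun x => F' (fn u x - M) • grad u x) 2 (volume.restrict Ω) := by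
    refine hgm.norm.mono' ((hF'c.comp_aestronglyMeasurable
      (hum.1.sub aestronglyMeasurable_const)).smul hgm.1) (Eventually.of_forall fun x => ?_)
    rw [norm_smul]
    exact mul_le_of_le_one_left (norm_nonneg _) (habs _)
  obtain ⟨w, hw, hgw⟩ := hwg.exists_H1 hFum hFgm
  have hsqm : AEStronglyMeasurable (fun x => √|a x|) (volume.restrict Ω) :=
    (Real.continuous_sqrt.comp continuous_abs).comp_aestronglyMeasurable ham
  have hau : MemLp (fun x => √|a x| * fn u x) 2 (volume.restrict Ω) := hu.mem
  have haF : MemLp (fun x => √|a x| * F (fn u x - M)) 2 (volume.restrict Ω) := by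
    refine hau.norm.mono' (hsqm.mul hFu_meas) (Eventually.of_forall fun x => ?_)
    rw [norm_mul, norm_mul]
    exact mul_le_mul_of_nonneg_left (hFle _) (norm_nonneg _)
  have hwE : w ∈ energySpace Ω a := by
    refine (memLp_congr_ae ?_).1 haF
    filter_upwards [hw] with x hx
    rw [hx]
  have heq := hu.eq w hwE
  have hint : Integrable (fun x => a x * (fn u x * F (fn u x - M))) (volume.restrict Ω) := by
    refine (MemLp.integrable_mul (p := 2) (q := 2) hau haF).congr ?_
    filter_upwards [ha] with x hx
    have ha0 : 0 ≤ a x := hm₀.le.trans hx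
    have := Real.mul_self_sqrt ha0
    rw [Pi.mul_apply, abs_of_nonneg ha0]
    linear_combination (fn u x * F (fn u x - M)) * this
  have huF : ∀ s, 0 ≤ s * F (s - M) := fun s => by
    rcases le_or_gt s M with hs | hs
    · rw [hF0 _ (by linarith), mul_zero]
    · exact mul_nonneg (hM.trans hs.le) (hFnn _)
  have hnn : 0 ≤ᵐ[volume.restrict Ω] fun x => a x * (fn u x * F (fn u x - M)) := by
    filter_upwards [ha] with x hx
    exact mul_nonneg (hm₀.le.trans hx) (huF _)
  have h1 : 0 ≤ ∫ x in Ω, d x * inner ℝ (grad u x) (grad w x) := by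
    refine integral_nonneg_of_ae ?_
    filter_upwards [hd, hgw] with x hx hgx
    rw [hgx, inner_smul_right, real_inner_self_eq_norm_sq]
    exact mul_nonneg hx (mul_nonneg (hF'0 _) (sq_nonneg _))
  have h2 : ∫ x in Ω, a x * (fn u x * fn w x) = ∫ x in Ω, a x * (fn u x * F (fn u x - M)) := by
    refine integral_congr_ae ?_
    filter_upwards [hw] with x hx
    rw [hx]
  have h3 : ∫ x in Ω, f (fn u x) * fn w x ≤ 0 := by
    refine integral_nonpos_of_ae ?_
    filter_upwards [hw] with x hx
    rw [hx]
    rcases le_or_gt (fn u x) M with hs | hs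
    · simp [hF0 _ (sub_nonpos.2 hs)]
    · exact mul_nonpos_of_nonpos_of_nonneg (hfM _ hs) (hFnn _)
  have h4 : ∫ x in Ω, a x * (fn u x * F (fn u x - M)) = 0 := by
    refine le_antisymm ?_ (integral_nonneg_of_ae hnn)
    rw [energyForm, h2] at heq
    linarith
  have h5 := (integral_eq_zero_iff_of_nonneg_ae hnn hint).1 h4
  filter_upwards [h5, ha] with x hx hax
  by_contra! hlt
  have : 0 < a x * (fn u x * F (fn u x - M)) :=
    mul_pos (hm₀.trans_le hax) (mul_pos (hM.trans_lt hlt) (hFpos _ (sub_pos.2 hlt)))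
  exact this.ne' hx

theorem energyForm_neg_left (d a : Rn n → ℝ) (u v : H1 Ω) :
    energyForm d a (-u) v = -energyForm d a u v := by
  rw [energyForm, energyForm, neg_add, ← integral_neg, ← integral_neg]
  congr 1
  · refine integral_congr_ae ?_
    filter_upwards [grad_neg u] with x hx
    rw [hx, inner_neg_left, mul_neg]
  · refine integral_congr_ae ?_
    filter_upwards [fn_neg u] with x hx
    rw [hx]; ring

theorem IsWeakEquilibrium.neg {d a : Rn n → ℝ} {f : ℝ → ℝ} {u : H1 Ω}
    (hu : IsWeakEquilibrium d a f u) : IsWeakEquilibrium d a (fun s => -f (-s)) (-u) where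
  mem := neg_mem hu.mem
  integrable φ hφ := by
    refine (hu.integrable φ hφ).neg.congr ?_
    filter_upwards [fn_neg u] with x hx
    rw [hx, neg_neg, Pi.neg_apply, neg_mul]
  eq φ hφ := by
    rw [energyForm_neg_left, hu.eq φ hφ, ← integral_neg]
    refine integral_congr_ae ?_
    filter_upwards [fn_neg u] with x hx
    rw [hx, neg_neg, neg_mul]

/-- The lower bound is the upper bound for `-u`, a weak equilibrium for `s ↦ -f (-s)`. -/
theorem IsWeakEquilibrium.ae_abs_le (hΩ : IsOpen Ω) (hΩb : Bornology.IsBounded Ω)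
    {d a : Rn n → ℝ} {f : ℝ → ℝ} {m₀ M : ℝ} (hm₀ : 0 < m₀)
    (hd : ∀ᵐ x ∂(volume.restrict Ω), 0 ≤ d x)
    (ham : AEStronglyMeasurable a (volume.restrict Ω))
    (ha : ∀ᵐ x ∂(volume.restrict Ω), m₀ ≤ a x) (hM : 0 ≤ M) (hfM : ∀ s, M < s → f s ≤ 0)
    (hfM' : ∀ s, s < -M → 0 ≤ f s) {u : H1 Ω} (hu : IsWeakEquilibrium d a f u) :
    ∀ᵐ x ∂(volume.restrict Ω), |fn u x| ≤ M := by
  filter_upwards [hu.ae_le hΩ hΩb hm₀ hd ham ha hM hfM,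
    hu.neg.ae_le hΩ hΩb hm₀ hd ham ha hM (fun s hs => neg_nonpos.2 (hfM' _ (by linarith))),
    fn_neg u] with x h1 h2 h3
  rw [h3] at h2
  exact abs_le.2 ⟨by linarith, h1⟩

/-! ### Boundedness of weakly differentiable functions on an interval -/

theorem convex_of_isPreconnected_one {Ω : Set (Rn 1)} (h : IsPreconnected Ω) : Convex ℝ Ω := by
  let e : Rn 1 →ₗ[ℝ] ℝ := (EuclideanSpace.proj (0 : Fin 1) : Rn 1 →L[ℝ] ℝ).toLinearMap
  have he : Continuous e := (EuclideanSpace.proj (0 : Fin 1) : Rn 1 →L[ℝ] ℝ).continuous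
  have hinj : Function.Injective e := fun x y hxy => by
    ext i
    rw [Subsingleton.elim i 0]
    exact hxy
  have hc : Convex ℝ (e '' Ω) := Real.convex_iff_isPreconnected.2 (h.image e he.continuousOn)
  have := hc.linear_preimage e
  rwa [Set.preimage_image_eq _ hinj] at this

/-- In dimension one, the integral of a nonnegative function along a segment, with respect to
arclength, is at most its total integral. -/
theorem norm_mul_integral_segment_le {ψ : Rn 1 → ℝ} (hψ0 : ∀ x, 0 ≤ ψ x)
    (hψ : Integrable ψ volume) (x h : Rn 1) :
    ‖h‖ * ∫ t in (0 : ℝ)..1, ψ (x - t • h) ≤ ∫ z, ψ z := by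
  rcases eq_or_ne h 0 with rfl | hh
  · simpa using integral_nonneg hψ0
  have hn : 0 < ‖h‖ := norm_pos_iff.2 hh
  set w : Rn 1 := ‖h‖⁻¹ • h with hw
  have hw1 : ‖w‖ = 1 := by
    rw [hw, norm_smul, norm_inv, norm_norm, inv_mul_cancel₀ hn.ne']
  let L : ℝ ≃ₗᵢ[ℝ] Rn 1 := (LinearIsometry.toSpanSingleton ℝ (Rn 1) hw1).toLinearIsometryEquiv
    (by simp)
  have hL : ∀ s, L s = s • w := fun s => rfl
  have hLm : MeasurePreserving L volume volume := L.measurePreserving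
  have h1 : ‖h‖ * ∫ t in (0 : ℝ)..1, ψ (x - t • h) = ∫ s in (0 : ℝ)..‖h‖, ψ (x - L s) := by
    have := intervalIntegral.smul_integral_comp_mul_right (a := 0) (b := 1)
      (fun s => ψ (x - L s)) ‖h‖
    rw [zero_mul, one_mul] at this
    rw [← this, smul_eq_mul]
    congr 1
    refine intervalIntegral.integral_congr fun t _ => ?_
    simp only [hL, hw, smul_smul]
    rw [mul_assoc, mul_inv_cancel₀ hn.ne', mul_one]
  have h2 : Integrable (fun z => ψ (x - z)) volume := hψ.comp_sub_left x
  have hint : Integrable (fun s => ψ (x - L s)) volume :=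
    (hLm.integrable_comp_emb L.toMeasurableEquiv.measurableEmbedding).2 h2
  rw [h1, intervalIntegral.integral_of_le hn.le]
  calc ∫ s in Set.Ioc 0 ‖h‖, ψ (x - L s) ≤ ∫ s, ψ (x - L s) :=
        setIntegral_le_integral hint (Eventually.of_forall fun s => hψ0 _)
    _ = ∫ z, ψ (x - z) := hLm.integral_comp L.toMeasurableEquiv.measurableEmbedding
          (fun z => ψ (x - z))
    _ = ∫ z, ψ z := integral_sub_left_eq_self ψ volume x

/-- Two averages of `u` against translates of one probability density differ by at most
`∫ |G|`: the derivative of the average along the segment is integrated, and the density integrates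
along the segment to at most `1`. -/
theorem HasWeakGradient.abs_average_sub_le {Ω : Set (Rn 1)} {u : Rn 1 → ℝ} {G : Rn 1 → Rn 1}
    (hu : Integrable u (volume.restrict Ω)) (hGi : Integrable G (volume.restrict Ω))
    (hG : HasWeakGradient Ω u G) {ψ : Rn 1 → ℝ} (hψ : ContDiff ℝ ∞ ψ) (hc : HasCompactSupport ψ)
    (hψ0 : ∀ x, 0 ≤ ψ x) (hψ1 : ∫ x, ψ x = 1) (h : Rn 1)
    (hs : ∀ x ∈ tsupport ψ, ∀ t ∈ Set.Icc (0 : ℝ) 1, x + t • h ∈ Ω) :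
    |(∫ x in Ω, u x * ψ (x - h)) - ∫ x in Ω, u x * ψ x| ≤ ∫ x in Ω, ‖G x‖ := by
  have hdψ : ContDiff ℝ ∞ (fun x => fderiv ℝ ψ x h) :=
    (hψ.fderiv_right (m := ∞) (by simp)).clm_apply contDiff_const
  have hJ : ∀ t : ℝ, HasDerivAt (fun t : ℝ => ∫ x in Ω, u x * ψ (x - t • h))
      (-∫ x in Ω, u x * fderiv ℝ ψ (x - t • h) h) t :=
    fun t => hasDerivAt_integral_mul_translate hu hψ hc h t
  have hcont : Continuous (fun t : ℝ => -∫ x in Ω, u x * fderiv ℝ ψ (x - t • h) h) := by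
    refine (continuous_iff_continuousAt.2 fun t => ?_).neg
    exact (hasDerivAt_integral_mul_translate hu hdψ (hc.fderiv_apply ℝ h) h t).continuousAt
  have hFTC := intervalIntegral.integral_eq_sub_of_hasDerivAt (a := 0) (b := 1)
    (fun t _ => hJ t) (hcont.intervalIntegrable _ _)
  simp only [one_smul, zero_smul, sub_zero] at hFTC
  obtain ⟨C, hC⟩ := hψ.continuous.bounded_above_of_compact_support hc
  have hint : Integrable (Function.uncurry fun (t : ℝ) (x : Rn 1) =>
      inner ℝ (G x) h * ψ (x - t • h))
      ((volume.restrict (Set.uIoc (0 : ℝ) 1)).prod (volume.restrict Ω)) := by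
    have hGh : Integrable (fun x => inner ℝ (G x) h) (volume.restrict Ω) := hGi.inner_const h
    have hfin : IsFiniteMeasure ((volume : Measure ℝ).restrict (Set.uIoc (0 : ℝ) 1)) := by
      rw [Set.uIoc_of_le zero_le_one]; infer_instance
    refine ((hGh.comp_snd (volume.restrict (Set.uIoc (0 : ℝ) 1))).norm.mul_const C).mono' ?_
      (Eventually.of_forall fun q => ?_)
    · refine AEStronglyMeasurable.mul (hGh.1.comp_snd) ?_
      exact (hψ.continuous.comp (by fun_prop : Continuous fun q : ℝ × Rn 1 =>
        q.2 - q.1 • h)).aestronglyMeasurable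
    · rw [Function.uncurry, norm_mul]
      exact mul_le_mul_of_nonneg_left (hC _) (norm_nonneg _)
  have hswap := intervalIntegral_integral_swap hint
  have hJG : ∫ t in (0 : ℝ)..1, -∫ x in Ω, u x * fderiv ℝ ψ (x - t • h) h
      = ∫ t in (0 : ℝ)..1, ∫ x in Ω, inner ℝ (G x) h * ψ (x - t • h) := by
    refine intervalIntegral.integral_congr fun t ht => ?_
    rw [Set.uIcc_of_le zero_le_one] at ht
    rw [hG.integral_translate hψ hc (t • h) (fun x hx => hs x hx t ht) h, neg_neg]
  rw [← hFTC, hJG, hswap, ← Real.norm_eq_abs]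
  refine norm_integral_le_of_norm_le hGi.norm (Eventually.of_forall fun x => ?_)
  rw [intervalIntegral.integral_const_mul, norm_mul]
  have hI0 : 0 ≤ ∫ t in (0 : ℝ)..1, ψ (x - t • h) :=
    intervalIntegral.integral_nonneg zero_le_one fun t _ => hψ0 _
  rw [Real.norm_of_nonneg hI0]
  calc ‖inner ℝ (G x) h‖ * ∫ t in (0 : ℝ)..1, ψ (x - t • h)
      ≤ (‖G x‖ * ‖h‖) * ∫ t in (0 : ℝ)..1, ψ (x - t • h) := by
        gcongr; exact norm_inner_le_norm _ _
    _ = ‖G x‖ * (‖h‖ * ∫ t in (0 : ℝ)..1, ψ (x - t • h)) := mul_assoc _ _ _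
    _ ≤ ‖G x‖ * 1 := by
        gcongr
        refine le_of_le_of_eq ?_ hψ1
        exact norm_mul_integral_segment_le hψ0
          (hψ.continuous.integrable_of_hasCompactSupport hc) x h
    _ = ‖G x‖ := mul_one _

/-- The averages of a function against a shrinking sequence of densities converge to it almost
everywhere, which turns the bound for averages into a pointwise one. -/
theorem HasWeakGradient.ae_abs_sub_le {Ω : Set (Rn 1)} (hΩ : IsOpen Ω) (hconv : Convex ℝ Ω)
    {u : Rn 1 → ℝ} {G : Rn 1 → Rn 1}
    (hu : Integrable u (volume.restrict Ω)) (hGi : Integrable G (volume.restrict Ω))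
    (hG : HasWeakGradient Ω u G) :
    ∀ᵐ x ∂(volume.restrict Ω), ∀ᵐ y ∂(volume.restrict Ω), |u y - u x| ≤ ∫ z in Ω, ‖G z‖ := by
  let bump : ℕ → ContDiffBump (0 : Rn 1) := fun k =>
    ⟨1 / ((k : ℝ) + 1), 2 * (1 / ((k : ℝ) + 1)), by positivity, by
      have : 0 < 1 / ((k : ℝ) + 1) := by positivity
      linarith⟩
  have hbump : Tendsto (fun k => (bump k).rOut) atTop (𝓝 0) := by
    have := (tendsto_one_div_add_atTop_nhds_zero_nat (𝕜 := ℝ)).const_mul 2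
    rwa [mul_zero] at this
  have hgi : Integrable (Ω.indicator u) volume := (integrable_indicator_iff hΩ.measurableSet).2 hu
  have hae := ContDiffBump.ae_convolution_tendsto_right_of_locallyIntegrable (μ := volume) hbump
    (K := 2) (Eventually.of_forall fun k => le_rfl) hgi.locallyIntegrable
  have hmain : ∀ᵐ x ∂(volume.restrict Ω), x ∈ Ω ∧ Tendsto (fun k =>
      ∫ z in Ω, u z * (bump k).normed volume (z - x)) atTop (𝓝 (u x)) := by
    filter_upwards [ae_restrict_of_ae hae, ae_restrict_mem hΩ.measurableSet] with x hx hxΩ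
    refine ⟨hxΩ, ?_⟩
    rw [Set.indicator_of_mem hxΩ] at hx
    refine hx.congr fun k => ?_
    rw [convolution_lsmul_swap, ← integral_indicator hΩ.measurableSet]
    refine integral_congr_ae (Eventually.of_forall fun z => ?_)
    by_cases hz : z ∈ Ω
    · simp only [Set.indicator_of_mem hz, smul_eq_mul]
      rw [mul_comm, ← neg_sub, ContDiffBump.normed_neg]
    · simp [Set.indicator_of_notMem hz]
  filter_upwards [hmain] with x ⟨hxΩ, hx⟩
  filter_upwards [hmain] with y ⟨hyΩ, hy⟩
  refine le_of_tendsto (hy.sub hx).abs ?_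
  obtain ⟨r, hr, hrx⟩ := Metric.isOpen_iff.1 hΩ x hxΩ
  obtain ⟨r', hr', hry⟩ := Metric.isOpen_iff.1 hΩ y hyΩ
  filter_upwards [hbump.eventually_lt_const hr, hbump.eventually_lt_const hr'] with k hk hk'
  set ψ : Rn 1 → ℝ := fun z => (bump k).normed volume (z - x) with hψ
  have hts : tsupport ψ ⊆ Metric.closedBall x (bump k).rOut := by
    refine (tsupport_comp_subset_preimage ((bump k).normed volume)
      (f := fun z => z - x) (by fun_prop)).trans fun z hz => ?_
    rw [Set.mem_preimage, ContDiffBump.tsupport_normed_eq, mem_closedBall_zero_iff] at hz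
    exact mem_closedBall_iff_norm.2 hz
  have h1 := hG.abs_average_sub_le hu hGi (ψ := ψ)
    ((bump k).contDiff_normed.comp (contDiff_id.sub contDiff_const))
    ((bump k).hasCompactSupport_normed.comp_homeomorph (Homeomorph.subRight x))
    (fun z => (bump k).nonneg_normed _)
    (by rw [hψ, integral_sub_right_eq_self (fun z => (bump k).normed volume z) x,
      (bump k).integral_normed]) (y - x) (fun z hz t ht => by
      have hz1 : ‖z - x‖ ≤ (bump k).rOut := mem_closedBall_iff_norm.1 (hts hz)
      have hzx : z ∈ Ω := hrx (mem_ball_iff_norm.2 (hz1.trans_lt hk))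
      have hzy : z + (y - x) ∈ Ω := hry (mem_ball_iff_norm.2 (by
        rw [show z + (y - x) - y = z - x by abel]
        exact hz1.trans_lt hk'))
      have := hconv.add_smul_sub_mem hzx hzy ht
      rwa [add_sub_cancel_left] at this)
  simp only [hψ, sub_sub, sub_add_cancel] at h1
  exact h1

/-! ### Potentials as functionals on the Sobolev space -/

/-- On an interval, functions in `H¹` are bounded by their `H¹` norm. -/
theorem exists_ae_abs_fn_le {Ω : Set (Rn 1)} (hΩ : IsOpen Ω) (hΩb : Bornology.IsBounded Ω)
    (hΩc : IsConnected Ω) :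
    ∃ C : ℝ, 0 ≤ C ∧ ∀ φ : H1 Ω, ∀ᵐ x ∂(volume.restrict Ω), |fn φ x| ≤ C * (‖fn φ‖ + ‖grad φ‖) := by
  have hfin : IsFiniteMeasure (volume.restrict Ω) := isFiniteMeasure_restrict.2 hΩb.measure_lt_top.ne
  set V := (volume.restrict Ω).real Set.univ with hV
  have hVpos : 0 < V := by
    rw [hV, measureReal_def, Measure.restrict_apply_univ]
    exact ENNReal.toReal_pos (hΩ.measure_pos volume hΩc.nonempty).ne' hΩb.measure_lt_top.ne
  -- `∫ |w| ≤ |Ω|^{1/2} ‖w‖` on a set of finite measure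
  have hL1 : ∀ w : Lp ℝ 2 (volume.restrict Ω), ∫ x in Ω, |w x| ≤ ‖w‖ * √V := by
    intro w
    have h1 := abs_integral_mul_le_eLpNorm (Lp.memLp w).abs (memLp_const (1 : ℝ) (p := 2)
      (μ := volume.restrict Ω))
    simp only [mul_one] at h1
    refine (le_abs_self _).trans (h1.trans (le_of_eq ?_))
    congr 1
    · rw [Lp.norm_def]
      congr 1
      exact eLpNorm_congr_norm_ae (Eventually.of_forall fun x => by simp)
    · rw [eLpNorm_const' _ (by norm_num) (by norm_num), hV, measureReal_def, Real.sqrt_eq_rpow,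
        ENNReal.toReal_rpow]
      simp
  refine ⟨(√V + V * √V) / V, by positivity, fun φ => ?_⟩
  have hGi : Integrable (grad φ) (volume.restrict Ω) := (Lp.memLp (grad φ)).integrable (by norm_num)
  have hui : Integrable (fn φ) (volume.restrict Ω) := (Lp.memLp (fn φ)).integrable (by norm_num)
  have hG : HasWeakGradient Ω (fn φ) (grad φ) := φ.2
  have hGL : ∫ x in Ω, ‖grad φ x‖ ≤ ‖grad φ‖ * √V := by
    have h := hL1 ((Lp.memLp (grad φ)).norm.toLp _)
    rw [Lp.norm_toLp, eLpNorm_norm, ← Lp.norm_def] at h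
    refine le_of_eq_of_le (integral_congr_ae ?_) h
    filter_upwards [(Lp.memLp (grad φ)).norm.coeFn_toLp] with x hx
    rw [hx, abs_of_nonneg (norm_nonneg _)]
  filter_upwards [hG.ae_abs_sub_le hΩ (convex_of_isPreconnected_one hΩc.isPreconnected) hui hGi]
    with x hx
  have h2 : V * |fn φ x| ≤ ∫ y in Ω, (|fn φ y| + ∫ z in Ω, ‖grad φ z‖) := by
    calc V * |fn φ x| = ∫ _ in Ω, |fn φ x| := by rw [integral_const, smul_eq_mul]
      _ ≤ _ := by
        refine integral_mono_ae (integrable_const _) (hui.abs.add (integrable_const _)) ?_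
        filter_upwards [hx] with y hy
        have := abs_sub_abs_le_abs_sub (fn φ x) (fn φ y)
        rw [abs_sub_comm] at this
        linarith
  rw [integral_add hui.abs (integrable_const _), integral_const, smul_eq_mul] at h2
  rw [div_mul_eq_mul_div, le_div_iff₀ hVpos]
  have h3 := hL1 (fn φ)
  have h4 : V * ∫ z in Ω, ‖grad φ z‖ ≤ V * (‖grad φ‖ * √V) := by gcongr
  have h5 : 0 ≤ √V * ‖grad φ‖ := by positivity
  have h6 : 0 ≤ V * √V * ‖fn φ‖ := by positivity
  change V * |fn φ x| ≤ (∫ y in Ω, |fn φ y|) + V * ∫ z in Ω, ‖grad φ z‖ at h2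
  nlinarith

/-- A potential that is small in `L^q` is small as a functional on `H¹(Ω)`: by the Cauchy–Schwarz
inequality if `q ≥ 2`, and by the boundedness of `H¹` functions on an interval. -/
theorem exists_abs_integral_mul_fn_le (hn : 1 ≤ n) (hΩ : IsOpen Ω) (hΩb : Bornology.IsBounded Ω)
    (hΩc : IsConnected Ω) {q : ℝ≥0∞} (hq₁ : 1 ≤ q) (hq₂ : 2 ≤ n → 2 ≤ q) :
    ∃ C : ℝ, 0 ≤ C ∧ ∀ (W : Rn n → ℝ) (t : ℝ), 0 ≤ t →
      AEStronglyMeasurable W (volume.restrict Ω) →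
      eLpNorm W q (volume.restrict Ω) ≤ ENNReal.ofReal t → ∀ φ : H1 Ω,
        Integrable (fun x => W x * fn φ x) (volume.restrict Ω) ∧
        |∫ x in Ω, W x * fn φ x| ≤ C * t * (‖fn φ‖ + ‖grad φ‖) := by
  have hfin : IsFiniteMeasure (volume.restrict Ω) := isFiniteMeasure_restrict.2 hΩb.measure_lt_top.ne
  have hΩ0 : volume.restrict Ω Set.univ ≠ 0 := by
    rw [Measure.restrict_apply_univ]
    exact (hΩ.measure_pos volume hΩc.nonempty).ne'
  have hcomp : ∀ p : ℝ≥0∞, p ≤ q → ∃ C : ℝ, 0 ≤ C ∧ ∀ (W : Rn n → ℝ) (t : ℝ), 0 ≤ t →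
      AEStronglyMeasurable W (volume.restrict Ω) →
      eLpNorm W q (volume.restrict Ω) ≤ ENNReal.ofReal t →
      eLpNorm W p (volume.restrict Ω) ≤ ENNReal.ofReal (C * t) := by
    intro p hpq
    set κ := volume.restrict Ω Set.univ ^ (1 / p.toReal - 1 / q.toReal) with hκ
    have hκt : κ ≠ ⊤ := ENNReal.rpow_ne_top_of_ne_zero hΩ0 (measure_ne_top _ _)
    refine ⟨κ.toReal, ENNReal.toReal_nonneg, fun W t ht hW h => ?_⟩
    refine (eLpNorm_le_eLpNorm_mul_rpow_measure_univ hpq hW).trans ?_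
    rw [ENNReal.ofReal_mul ENNReal.toReal_nonneg, ENNReal.ofReal_toReal hκt, mul_comm]
    gcongr
  rcases Nat.lt_or_ge n 2 with h2 | h2
  · obtain rfl : n = 1 := by omega
    obtain ⟨C, hC, hCW⟩ := hcomp 1 hq₁
    obtain ⟨D, hD, hDφ⟩ := exists_ae_abs_fn_le hΩ hΩb hΩc
    refine ⟨D * C, by positivity, fun W t ht hW h φ => ?_⟩
    have hW1 : Integrable W (volume.restrict Ω) :=
      memLp_one_iff_integrable.1 ⟨hW, (hCW W t ht hW h).trans_lt ENNReal.ofReal_lt_top⟩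
    set B := D * (‖fn φ‖ + ‖grad φ‖) with hB
    have hB0 : 0 ≤ B := by positivity
    have hbound : ∀ᵐ x ∂(volume.restrict Ω), ‖W x * fn φ x‖ ≤ B * ‖W x‖ := by
      filter_upwards [hDφ φ] with x hx
      rw [norm_mul, mul_comm]
      exact mul_le_mul_of_nonneg_right hx (norm_nonneg _)
    refine ⟨(hW1.norm.const_mul B).mono' (hW.mul (Lp.memLp (fn φ)).1) hbound, ?_⟩
    have h1 := norm_integral_le_of_norm_le (hW1.norm.const_mul B) hbound
    rw [integral_const_mul, Real.norm_eq_abs] at h1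
    have h2 : ∫ x in Ω, ‖W x‖ ≤ C * t := by
      rw [integral_norm_eq_lintegral_enorm hW, ← eLpNorm_one_eq_lintegral_enorm]
      exact ENNReal.toReal_le_of_le_ofReal (by positivity) (hCW W t ht hW h)
    calc _ ≤ B * ∫ x in Ω, ‖W x‖ := h1
      _ ≤ B * (C * t) := by gcongr
      _ = _ := by rw [hB]; ring
  · obtain ⟨C, hC, hCW⟩ := hcomp 2 (hq₂ h2)
    refine ⟨C, hC, fun W t ht hW h φ => ?_⟩
    have hW2 : MemLp W 2 (volume.restrict Ω) :=
      ⟨hW, (hCW W t ht hW h).trans_lt ENNReal.ofReal_lt_top⟩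
    refine ⟨MemLp.integrable_mul (p := 2) (q := 2) hW2 (Lp.memLp (fn φ)), ?_⟩
    refine (abs_integral_mul_le_eLpNorm hW2 (Lp.memLp (fn φ))).trans ?_
    rw [← Lp.norm_def]
    have h1 : (eLpNorm W 2 (volume.restrict Ω)).toReal ≤ C * t :=
      ENNReal.toReal_le_of_le_ofReal (by positivity) (hCW W t ht hW h)
    gcongr
    exact le_add_of_nonneg_right (norm_nonneg _)

/-! ### Inversion of the linearisation and the contraction argument -/

section Abstract

variable {H L : Type*} [NormedAddCommGroup H] [InnerProductSpace ℝ H] [CompleteSpace H]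
  [NormedAddCommGroup L] [InnerProductSpace ℝ L] [CompleteSpace L]

/-- The operator that represents the form `⟪w, φ⟫ - b ⟪ι w, ι φ⟫`. -/
noncomputable def shiftedOp (ι : H →L[ℝ] L) (b : ℝ) : H →L[ℝ] H :=
  ContinuousLinearMap.id ℝ H - b • (ι.adjoint ∘L ι)

theorem inner_shiftedOp (ι : H →L[ℝ] L) (b : ℝ) (w φ : H) :
    inner ℝ (shiftedOp ι b w) φ = inner ℝ w φ - b * inner ℝ (ι w) (ι φ) := by
  simp [shiftedOp, inner_sub_left, inner_smul_left, ContinuousLinearMap.adjoint_inner_left]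

/-- The form `⟪w, φ⟫ - b ⟪ι w, ι φ⟫` is uniformly invertible although it may be indefinite. With
`w = z + m e`, where `e` plays the role of the constant function `1` and `ι z` is orthogonal to
`ι e`, the form is close to `‖z‖² + (ℓ - b) v m²`; so it becomes coercive when tested with
`z + sign (ℓ - b) m e`. -/
theorem shiftedOp_bijective_and_bound {ι : H →L[ℝ] L} {e : H} {ρ : H →L[ℝ] ℝ}
    {ℓ b κ Ce v r σ : ℝ} (hv : 0 < v) (hve : ‖ι e‖ ^ 2 = v) (hℓb : ℓ ≠ b) (hCe : ‖e‖ ≤ Ce)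
    (hκ : ∀ w, ‖ι w‖ ≤ κ * ‖w‖) (he : ∀ φ, inner ℝ e φ = ℓ * inner ℝ (ι e) (ι φ) + ρ φ)
    (hρ : ∀ φ, |ρ φ| ≤ r * ‖φ‖)
    (hσ : ∀ w, ‖ι (w - (inner ℝ (ι e) (ι w) / v) • e)‖ ≤ σ * ‖w‖)
    (hr₁ : r ≤ 1 / 4) (hr₂ : r ≤ |ℓ - b| * v / 4) (hr₃ : r * Ce ≤ |ℓ - b| * v / 2)
    (hbσ : |b| * σ ^ 2 ≤ 1 / 2) :
    Function.Surjective (shiftedOp ι b) ∧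
      ∀ w, ‖w‖ ≤ (1 + 2 * κ * Ce / √v) / min (1 / 8) (|ℓ - b| * v / (8 * Ce ^ 2)) *
        ‖shiftedOp ι b w‖ := by
  have hιe : ι e ≠ 0 := fun h => by rw [h] at hve; simp at hve; exact hv.ne hve
  have he0 : e ≠ 0 := fun h => hιe (by rw [h, map_zero])
  have hepos : 0 < ‖e‖ := norm_pos_iff.2 he0
  have hCe0 : 0 < Ce := hepos.trans_le hCe
  have hD : 0 < |ℓ - b| := abs_pos.2 (sub_ne_zero.2 hℓb)
  have hr0 : 0 ≤ r := by
    have := (abs_nonneg _).trans (hρ e)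
    exact nonneg_of_mul_nonneg_left this hepos
  have hκ0 : 0 ≤ κ := by
    have := (norm_nonneg _).trans (hκ e)
    exact nonneg_of_mul_nonneg_left this hepos
  have hιe_norm : ‖ι e‖ = √v := by rw [← hve, Real.sqrt_sq (norm_nonneg _)]
  obtain ⟨s, hs1, hs⟩ : ∃ s : ℝ, |s| = 1 ∧ s * (ℓ - b) = |ℓ - b| := by
    rcases le_or_gt 0 (ℓ - b) with h | h
    · exact ⟨1, by simp, by rw [one_mul, abs_of_nonneg h]⟩
    · exact ⟨-1, by simp, by rw [neg_one_mul, abs_of_neg h]⟩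
  have hss : s * s = 1 := by rw [← abs_mul_abs_self, hs1, mul_one]
  let μ : H →L[ℝ] ℝ := v⁻¹ • (innerSL ℝ (ι e) ∘L ι)
  have hμ : ∀ w, μ w = inner ℝ (ι e) (ι w) / v := fun w => by
    simp [μ, div_eq_inv_mul]
  have hμe : μ e = 1 := by rw [hμ, real_inner_self_eq_norm_sq, hve, div_self hv.ne']
  -- `T` is the involution `z + m e ↦ z + s m e`, where `m = μ (z + m e)`.
  let T : H →L[ℝ] H := ContinuousLinearMap.id ℝ H + (s - 1) • μ.smulRight e
  have hT : ∀ w, T w = w + ((s - 1) * μ w) • e := fun w => by simp [T, smul_smul]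
  have hTT : ∀ w, T (T w) = w := fun w => by
    rw [hT (T w), hT w, map_add, map_smul, hμe, add_assoc, ← add_smul, smul_eq_mul]
    have : (s - 1) * μ w + (s - 1) * (μ w + (s - 1) * μ w * 1) = 0 := by
      linear_combination μ w * (s - 1) * hss - μ w * (s - 2) * hss
    rw [this, zero_smul, add_zero]
  set κ₀ := min (1 / 8) (|ℓ - b| * v / (8 * Ce ^ 2)) with hκ₀
  have hκ₀pos : 0 < κ₀ := lt_min (by norm_num) (by positivity)
  have hcoer : ∀ w, κ₀ * ‖w‖ ^ 2 ≤ inner ℝ (shiftedOp ι b w) (T w) := by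
    intro w
    set m := μ w with hm
    set z := w - m • e with hz
    have hw : w = z + m • e := by rw [hz, sub_add_cancel]
    have hTw : T w = z + (s * m) • e := by
      rw [hT, ← hm, hz, sub_mul, one_mul, sub_smul]; abel
    have hez : inner ℝ (ι e) (ι z) = 0 := by
      rw [hz, map_sub, map_smul, inner_sub_right, inner_smul_right, real_inner_self_eq_norm_sq,
        hve, hm, hμ, div_mul_cancel₀ _ hv.ne', sub_self]
    have hιz : ‖ι z‖ ≤ σ * ‖z‖ := by
      have := hσ z
      rwa [hez, zero_div, zero_smul, sub_zero] at this
    have h1 : inner ℝ e z = ρ z := by rw [he, hez, mul_zero, zero_add]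
    have h2 : inner ℝ e e = ℓ * v + ρ e := by rw [he, real_inner_self_eq_norm_sq, hve]
    have h3 : inner ℝ (shiftedOp ι b w) (T w) = ‖z‖ ^ 2 - b * ‖ι z‖ ^ 2 + (1 + s) * m * ρ z +
        m ^ 2 * (|ℓ - b| * v + s * ρ e) := by
      rw [inner_shiftedOp, hTw]
      conv_lhs => rw [hw]
      simp only [map_add, map_smul, inner_add_left, inner_add_right, inner_smul_left,
        inner_smul_right, h1, h2, real_inner_comm e z, hez, real_inner_comm (ι e) (ι z),
        real_inner_self_eq_norm_sq, hve, RCLike.conj_to_real, ← hs]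
      ring
    have h4 : b * ‖ι z‖ ^ 2 ≤ 1 / 2 * ‖z‖ ^ 2 := by
      calc b * ‖ι z‖ ^ 2 ≤ |b| * (σ * ‖z‖) ^ 2 := by
            gcongr; exact le_abs_self b
        _ = (|b| * σ ^ 2) * ‖z‖ ^ 2 := by ring
        _ ≤ _ := by gcongr
    have h5 : -(r * (m ^ 2 + ‖z‖ ^ 2)) ≤ (1 + s) * m * ρ z := by
      have h6 : |(1 + s) * m * ρ z| ≤ 2 * |m| * (r * ‖z‖) := by
        rw [abs_mul, abs_mul]
        have : |1 + s| ≤ 2 := (abs_add_le _ _).trans (by rw [hs1]; norm_num)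
        gcongr
        exact hρ z
      have h7 : 2 * |m| * (r * ‖z‖) ≤ r * (m ^ 2 + ‖z‖ ^ 2) := by
        have := two_mul_le_add_sq |m| ‖z‖
        rw [sq_abs] at this
        nlinarith
      linarith [neg_abs_le ((1 + s) * m * ρ z)]
    have h8 : -(|ℓ - b| * v / 2) ≤ s * ρ e := by
      have : |s * ρ e| ≤ |ℓ - b| * v / 2 := by
        rw [abs_mul, hs1, one_mul]
        exact (hρ e).trans ((mul_le_mul_of_nonneg_left hCe hr0).trans hr₃)
      linarith [neg_abs_le (s * ρ e)]
    have h9 : m ^ 2 * (|ℓ - b| * v / 2) ≤ m ^ 2 * (|ℓ - b| * v + s * ρ e) := by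
      gcongr; linarith
    have h10 : r * m ^ 2 ≤ |ℓ - b| * v / 4 * m ^ 2 := by gcongr
    have h11 : r * ‖z‖ ^ 2 ≤ 1 / 4 * ‖z‖ ^ 2 := by gcongr
    have h12 : ‖w‖ ^ 2 ≤ 2 * ‖z‖ ^ 2 + 2 * (m ^ 2 * Ce ^ 2) := by
      have h13 : ‖w‖ ≤ ‖z‖ + |m| * Ce := by
        conv_lhs => rw [hw]
        refine (norm_add_le _ _).trans ?_
        rw [norm_smul, Real.norm_eq_abs]
        gcongr
      calc ‖w‖ ^ 2 ≤ (‖z‖ + |m| * Ce) ^ 2 := by gcongr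
        _ ≤ 2 * (‖z‖ ^ 2 + (|m| * Ce) ^ 2) := add_sq_le
        _ = _ := by rw [mul_pow, sq_abs]; ring
    have h14 : κ₀ * ‖w‖ ^ 2 ≤ 1 / 4 * ‖z‖ ^ 2 + |ℓ - b| * v / 4 * m ^ 2 := by
      calc κ₀ * ‖w‖ ^ 2 ≤ κ₀ * (2 * ‖z‖ ^ 2 + 2 * (m ^ 2 * Ce ^ 2)) := by gcongr
        _ = κ₀ * (2 * ‖z‖ ^ 2) + κ₀ * (2 * (m ^ 2 * Ce ^ 2)) := mul_add _ _ _
        _ ≤ (1 / 8) * (2 * ‖z‖ ^ 2) + (|ℓ - b| * v / (8 * Ce ^ 2)) * (2 * (m ^ 2 * Ce ^ 2)) := by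
            gcongr
            · exact min_le_left _ _
            · exact min_le_right _ _
        _ = _ := by field_simp; ring
    rw [h3]
    linarith
  constructor
  · have hunit : IsUnit (T.adjoint ∘L shiftedOp ι b) := by
      refine ContinuousLinearMap.isUnit_of_forall_le_norm_inner_map _ (c := ⟨κ₀, hκ₀pos.le⟩)
        hκ₀pos fun w => ?_
      rw [ContinuousLinearMap.comp_apply, ContinuousLinearMap.adjoint_inner_left, mul_comm]
      exact (hcoer w).trans (Real.le_norm_self _)
    intro y
    obtain ⟨x, hx⟩ := (ContinuousLinearMap.isUnit_iff_bijective.1 hunit).2 (T.adjoint y)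
    refine ⟨x, ?_⟩
    rw [ContinuousLinearMap.comp_apply, ← sub_eq_zero, ← map_sub] at hx
    rw [← sub_eq_zero, ← inner_self_eq_zero (𝕜 := ℝ)]
    conv_lhs => rw [← hTT (shiftedOp ι b x - y)]
    rw [← ContinuousLinearMap.adjoint_inner_right, hTT, hx, inner_zero_right]
  · intro w
    have hTn : ‖T w‖ ≤ (1 + 2 * κ * Ce / √v) * ‖w‖ := by
      have hsv : 0 < √v := Real.sqrt_pos.2 hv
      have hm : |μ w| ≤ κ * ‖w‖ / √v := by
        rw [hμ, abs_div, abs_of_pos hv, div_le_div_iff₀ hv hsv]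
        calc |inner ℝ (ι e) (ι w)| * √v ≤ (‖ι e‖ * ‖ι w‖) * √v := by
              gcongr; exact abs_real_inner_le_norm _ _
          _ ≤ (√v * (κ * ‖w‖)) * √v := by
              rw [hιe_norm]; gcongr; exact hκ w
          _ = κ * ‖w‖ * (√v * √v) := by ring
          _ = κ * ‖w‖ * v := by rw [Real.mul_self_sqrt hv.le]
      rw [hT]
      refine (norm_add_le _ _).trans ?_
      rw [norm_smul, norm_mul, Real.norm_eq_abs, Real.norm_eq_abs]
      have : |s - 1| ≤ 2 := (abs_sub s 1).trans (by rw [hs1]; norm_num)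
      calc ‖w‖ + |s - 1| * |μ w| * ‖e‖ ≤ ‖w‖ + 2 * (κ * ‖w‖ / √v) * Ce := by gcongr
        _ = _ := by ring
    rcases eq_or_ne w 0 with rfl | hw
    · simp
    have hw' : 0 < ‖w‖ := norm_pos_iff.2 hw
    rw [div_mul_eq_mul_div, le_div_iff₀ hκ₀pos]
    refine le_of_mul_le_mul_right ?_ hw'
    calc ‖w‖ * κ₀ * ‖w‖ = κ₀ * ‖w‖ ^ 2 := by ring
      _ ≤ inner ℝ (shiftedOp ι b w) (T w) := hcoer w
      _ ≤ ‖shiftedOp ι b w‖ * ‖T w‖ := real_inner_le_norm _ _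
      _ ≤ ‖shiftedOp ι b w‖ * ((1 + 2 * κ * Ce / √v) * ‖w‖) := by gcongr
      _ = _ := by ring

/-- A semilinear equation `A w = N w`, with `A` invertible and `N` a small Lipschitz perturbation
on a ball, has exactly one solution in this ball. -/
theorem exists_unique_solution_of_lipschitz {A : H →L[ℝ] H} {K θ δ : ℝ}
    (hsurj : Function.Surjective A) (hK0 : 0 ≤ K) (hK : ∀ w, ‖w‖ ≤ K * ‖A w‖) {N : H → H}
    (hδ : 0 < δ)
    (hN : ∀ w₁ w₂, ‖w₁‖ ≤ δ → ‖w₂‖ ≤ δ → ‖N w₁ - N w₂‖ ≤ θ * ‖w₁ - w₂‖)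
    (hθ : K * θ ≤ 1 / 2) (hN0 : K * ‖N 0‖ ≤ δ / 2) :
    ∃ w, ‖w‖ ≤ δ ∧ A w = N w ∧ ‖w‖ ≤ 2 * (K * ‖N 0‖) ∧ ∀ w', ‖w'‖ ≤ δ → A w' = N w' → w' = w := by
  choose S hS using hsurj
  have hdiff : ∀ w₁ w₂, ‖w₁‖ ≤ δ → ‖w₂‖ ≤ δ → K * ‖N w₁ - N w₂‖ ≤ 1 / 2 * ‖w₁ - w₂‖ := by
    intro w₁ w₂ h₁ h₂
    calc K * ‖N w₁ - N w₂‖ ≤ K * (θ * ‖w₁ - w₂‖) := by gcongr; exact hN _ _ h₁ h₂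
      _ = (K * θ) * ‖w₁ - w₂‖ := by ring
      _ ≤ _ := by gcongr
  have hSd : ∀ y₁ y₂, ‖S y₁ - S y₂‖ ≤ K * ‖y₁ - y₂‖ := fun y₁ y₂ => by
    have := hK (S y₁ - S y₂)
    rwa [map_sub, hS, hS] at this
  have hbound : ∀ w, ‖w‖ ≤ δ → K * ‖N w‖ ≤ 1 / 2 * ‖w‖ + K * ‖N 0‖ := by
    intro w hw
    have h1 := hdiff w 0 hw (by simpa using hδ.le)
    rw [sub_zero] at h1
    have h2 : ‖N w‖ ≤ ‖N w - N 0‖ + ‖N 0‖ := by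
      simpa using norm_add_le (N w - N 0) (N 0)
    have h3 : K * ‖N w‖ ≤ K * (‖N w - N 0‖ + ‖N 0‖) := by gcongr
    linarith
  have hmaps : Set.MapsTo (fun w => S (N w)) (Metric.closedBall 0 δ) (Metric.closedBall 0 δ) := by
    intro w hw
    rw [mem_closedBall_zero_iff] at hw ⊢
    have h1 := hK (S (N w))
    rw [hS] at h1
    linarith [hbound w hw]
  have hcontr : ContractingWith (1 / 2 : ℝ≥0) (hmaps.restrict _ _ _) := by
    refine ⟨by rw [← NNReal.coe_lt_coe]; norm_num, LipschitzWith.of_dist_le_mul fun x y => ?_⟩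
    have hx := mem_closedBall_zero_iff.1 x.2
    have hy := mem_closedBall_zero_iff.1 y.2
    rw [Subtype.dist_eq, Subtype.dist_eq, dist_eq_norm, dist_eq_norm]
    refine (hSd _ _).trans ((hdiff _ _ hx hy).trans (le_of_eq ?_))
    norm_num
  obtain ⟨w, hwδ, hfix, -, -⟩ := hcontr.exists_fixedPoint' (Metric.isClosed_closedBall.isComplete)
    hmaps (Metric.mem_closedBall_self hδ.le) (edist_ne_top _ _)
  rw [mem_closedBall_zero_iff] at hwδ
  have hw : A w = N w := by
    have := hS (N w)
    rwa [show S (N w) = w from hfix] at this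
  refine ⟨w, hwδ, hw, ?_, fun w' hw' h => ?_⟩
  · have h1 := hK w
    rw [hw] at h1
    linarith [hbound w hwδ]
  · have h1 := hK (w' - w)
    rw [map_sub, h, hw] at h1
    have h2 := hdiff w' w hw' hwδ
    have h3 : ‖w' - w‖ ≤ 0 := by linarith
    exact sub_eq_zero.1 (norm_le_zero_iff.1 h3)

/-- The semilinear problem `⟪w, φ⟫ - b ⟪ι w, ι φ⟫ = ⟪G (ι w), ι φ⟫ - c ρ φ` near `w = 0`. -/
theorem exists_unique_semilinear {ι : H →L[ℝ] L} {e : H} {ρ : H →L[ℝ] ℝ}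
    {ℓ b c κ Ce v r σ θ δ K : ℝ} (hv : 0 < v) (hve : ‖ι e‖ ^ 2 = v) (hℓb : ℓ ≠ b) (hCe : ‖e‖ ≤ Ce)
    (hκ0 : 0 ≤ κ) (hκ : ∀ w, ‖ι w‖ ≤ κ * ‖w‖)
    (he : ∀ φ, inner ℝ e φ = ℓ * inner ℝ (ι e) (ι φ) + ρ φ)
    (hr0 : 0 ≤ r) (hρ : ∀ φ, |ρ φ| ≤ r * ‖φ‖)
    (hσ : ∀ w, ‖ι (w - (inner ℝ (ι e) (ι w) / v) • e)‖ ≤ σ * ‖w‖)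
    (hr₁ : r ≤ 1 / 4) (hr₂ : r ≤ |ℓ - b| * v / 4) (hr₃ : r * Ce ≤ |ℓ - b| * v / 2)
    (hbσ : |b| * σ ^ 2 ≤ 1 / 2)
    (hK : K = (1 + 2 * κ * Ce / √v) / min (1 / 8) (|ℓ - b| * v / (8 * Ce ^ 2)))
    {G : L → L} (hG0 : G 0 = 0) (hδ : 0 < δ)
    (hG : ∀ w₁ w₂, ‖w₁‖ ≤ δ → ‖w₂‖ ≤ δ → ‖G (ι w₁) - G (ι w₂)‖ ≤ θ * ‖w₁ - w₂‖)
    (hθ : K * (κ * θ) ≤ 1 / 2) (hδr : K * (|c| * r) ≤ δ / 2) :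
    ∃ w, ‖w‖ ≤ δ ∧
      (∀ φ, inner ℝ w φ - b * inner ℝ (ι w) (ι φ) = inner ℝ (G (ι w)) (ι φ) - c * ρ φ) ∧
      ‖w‖ ≤ 2 * (K * (|c| * r)) ∧
      ∀ w', ‖w'‖ ≤ δ →
        (∀ φ, inner ℝ w' φ - b * inner ℝ (ι w') (ι φ) = inner ℝ (G (ι w')) (ι φ) - c * ρ φ) →
        w' = w := by
  obtain ⟨hsurj, hbound⟩ := shiftedOp_bijective_and_bound hv hve hℓb hCe hκ he hρ hσ hr₁ hr₂ hr₃ hbσ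
  rw [← hK] at hbound
  have hK0 : 0 ≤ K := by
    have hCe0 : 0 ≤ Ce := (norm_nonneg e).trans hCe
    rw [hK]
    positivity
  let ρd : H := (InnerProductSpace.toDual ℝ H).symm ρ
  have hρd : ∀ φ, inner ℝ ρd φ = ρ φ := fun φ => InnerProductSpace.toDual_symm_apply
  have hρn : ‖ρd‖ ≤ r := by
    rw [LinearIsometryEquiv.norm_map]
    exact ρ.opNorm_le_bound hr0 hρ
  let N : H → H := fun w => ι.adjoint (G (ι w)) - c • ρd
  have hNi : ∀ w φ, inner ℝ (N w) φ = inner ℝ (G (ι w)) (ι φ) - c * ρ φ := fun w φ => by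
    simp only [N, inner_sub_left, ContinuousLinearMap.adjoint_inner_left, inner_smul_left, hρd,
      RCLike.conj_to_real]
  have hιn : ‖ι.adjoint‖ ≤ κ := by
    rw [LinearIsometryEquiv.norm_map]
    exact ι.opNorm_le_bound hκ0 hκ
  have hN0 : ‖N 0‖ ≤ |c| * r := by
    simp only [N, map_zero, hG0, zero_sub, norm_neg, norm_smul, Real.norm_eq_abs]
    gcongr
  have hiff : ∀ w, shiftedOp ι b w = N w ↔
      ∀ φ, inner ℝ w φ - b * inner ℝ (ι w) (ι φ) = inner ℝ (G (ι w)) (ι φ) - c * ρ φ := by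
    intro w
    simp only [← hNi, ← inner_shiftedOp]
    exact ⟨fun h φ => by rw [h], fun h => ext_inner_right ℝ h⟩
  obtain ⟨w, h1, h2, h3, h4⟩ := exists_unique_solution_of_lipschitz hsurj hK0 hbound (N := N)
    (θ := κ * θ) hδ (fun w₁ w₂ k₁ k₂ => by
      simp only [N, sub_sub_sub_cancel_right, ← map_sub]
      calc _ ≤ ‖ι.adjoint‖ * ‖G (ι w₁) - G (ι w₂)‖ := ContinuousLinearMap.le_opNorm _ _
        _ ≤ κ * (θ * ‖w₁ - w₂‖) := by gcongr; exact hG _ _ k₁ k₂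
        _ = _ := by ring)
    hθ (le_trans (by gcongr) hδr)
  exact ⟨w, h1, (hiff w).1 h2, h3.trans (by gcongr), fun w' k1 k2 => h4 w' k1 ((hiff w').2 k2)⟩

end Abstract

/-! ### The energy space as a Hilbert space -/

theorem isClosed_H1 (Ω : Set (Rn n)) : IsClosed (H1 Ω : Set (L2Pair Ω)) := by
  have hset : (H1 Ω : Set (L2Pair Ω)) = {w | HasWeakGradient Ω w.1 w.2} := rfl
  simp only [hset, HasWeakGradient, Set.ofPred_forall]
  refine isClosed_iInter fun φ => isClosed_iInter fun hφ => isClosed_iInter fun hc =>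
    isClosed_iInter fun _ => isClosed_iInter fun v => ?_
  have hdc : Continuous (fun x => fderiv ℝ φ x v) :=
    (hφ.continuous_fderiv (by simp)).clm_apply continuous_const
  have hm1 : MemLp (fun x => fderiv ℝ φ x v) 2 (volume.restrict Ω) :=
    hdc.memLp_of_hasCompactSupport (hc.fderiv_apply ℝ v)
  have hm2 : MemLp (fun x => φ x • v) 2 (volume.restrict Ω) :=
    (hφ.continuous.smul continuous_const).memLp_of_hasCompactSupport hc.smul_right
  have h1 : ∀ w : L2Pair Ω, ∫ x in Ω, w.1 x * fderiv ℝ φ x v = inner ℝ (hm1.toLp _) w.1 := by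
    intro w
    rw [L2.inner_def]
    refine integral_congr_ae ?_
    filter_upwards [hm1.coeFn_toLp] with x hx
    rw [hx]
    simp
  have h2 : ∀ w : L2Pair Ω, ∫ x in Ω, inner ℝ (w.2 x) v * φ x = inner ℝ (hm2.toLp _) w.2 := by
    intro w
    rw [L2.inner_def]
    refine integral_congr_ae ?_
    filter_upwards [hm2.coeFn_toLp] with x hx
    rw [hx, inner_smul_left, real_inner_comm]
    simp [mul_comm]
  simp only [h1, h2]
  exact isClosed_eq (by fun_prop) (by fun_prop)

/-- Multiplication by a bounded function, as an operator on `L²`. -/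
noncomputable def mulL {E : Type*} [NormedAddCommGroup E] [NormedSpace ℝ E] {μ : Measure (Rn n)}
    (k : Lp ℝ ⊤ μ) : Lp E 2 μ →L[ℝ] Lp E 2 μ :=
  (ContinuousLinearMap.lsmul ℝ ℝ : ℝ →L[ℝ] E →L[ℝ] E).holderL μ ⊤ 2 2 k

theorem coeFn_mulL {E : Type*} [NormedAddCommGroup E] [NormedSpace ℝ E] {μ : Measure (Rn n)}
    (k : Lp ℝ ⊤ μ) (f : Lp E 2 μ) : mulL k f =ᵐ[μ] fun x => k x • f x := by
  filter_upwards [(ContinuousLinearMap.lsmul ℝ ℝ : ℝ →L[ℝ] E →L[ℝ] E).coeFn_holder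
    (r := 2) k f] with x hx
  exact hx

/-- The map `(α, β) ↦ (k₁ α, k₂ β)`; with `k₁ = a^{-1/2}` and `k₂ = d^{-1/2}` it recovers `(u, ∇u)`
from `(a^{1/2} u, d^{1/2} ∇u)`. -/
noncomputable def weightMap (k₁ k₂ : Lp ℝ ⊤ (volume.restrict Ω)) :
    WithLp 2 (Lp ℝ 2 (volume.restrict Ω) × Lp (Rn n) 2 (volume.restrict Ω)) →L[ℝ] L2Pair Ω :=
  (mulL k₁ ∘L WithLp.fstL 2 ℝ _ _).prod (mulL k₂ ∘L WithLp.sndL 2 ℝ _ _)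

/-- The energy space `X^{1/2}` as a Hilbert space: the closed subspace of all pairs
`(a^{1/2} u, d^{1/2} ∇u)` in `L² × L²`, where `k₁ = a^{-1/2}` and `k₂ = d^{-1/2}`. -/
noncomputable def energyHilbert (k₁ k₂ : Lp ℝ ⊤ (volume.restrict Ω)) :
    Submodule ℝ (WithLp 2 (Lp ℝ 2 (volume.restrict Ω) × Lp (Rn n) 2 (volume.restrict Ω))) :=
  (H1 Ω).comap (weightMap k₁ k₂).toLinearMap

instance (k₁ k₂ : Lp ℝ ⊤ (volume.restrict Ω)) : CompleteSpace (energyHilbert k₁ k₂) :=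
  ((isClosed_H1 Ω).preimage (weightMap k₁ k₂).continuous).completeSpace_coe

/-- The function `u` belonging to a pair `(a^{1/2} u, d^{1/2} ∇u)`. -/
noncomputable def toH1 (k₁ k₂ : Lp ℝ ⊤ (volume.restrict Ω)) : energyHilbert k₁ k₂ →ₗ[ℝ] H1 Ω :=
  (weightMap k₁ k₂).toLinearMap.submoduleComap (H1 Ω)

/-- The embedding of the energy space into `L²`. -/
noncomputable def energyEmb (k₁ k₂ : Lp ℝ ⊤ (volume.restrict Ω)) :
    energyHilbert k₁ k₂ →L[ℝ] Lp ℝ 2 (volume.restrict Ω) :=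
  mulL k₁ ∘L WithLp.fstL 2 ℝ _ _ ∘L (energyHilbert k₁ k₂).subtypeL

theorem fn_toH1 (k₁ k₂ : Lp ℝ ⊤ (volume.restrict Ω)) (w : energyHilbert k₁ k₂) :
    fn (toH1 k₁ k₂ w) = energyEmb k₁ k₂ w := rfl

theorem grad_toH1 (k₁ k₂ : Lp ℝ ⊤ (volume.restrict Ω)) (w : energyHilbert k₁ k₂) :
    grad (toH1 k₁ k₂ w) = mulL k₂ w.1.snd := rfl

section Weights

variable {a d : Rn n → ℝ} {k₁ k₂ : Lp ℝ ⊤ (volume.restrict Ω)}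

theorem exists_rsqrt_weight {m : ℝ} (hm : 0 < m) (ham : AEStronglyMeasurable a (volume.restrict Ω))
    (ha : ∀ᵐ x ∂(volume.restrict Ω), m ≤ a x) :
    ∃ k : Lp ℝ ⊤ (volume.restrict Ω), k =ᵐ[volume.restrict Ω] fun x => (√(a x))⁻¹ := by
  have h : MemLp (fun x => (√(a x))⁻¹) ⊤ (volume.restrict Ω) := by
    refine memLp_top_of_bound
      (Real.continuous_sqrt.comp_aestronglyMeasurable ham).aemeasurable.inv.aestronglyMeasurable
      (√m)⁻¹ ?_
    filter_upwards [ha] with x hx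
    rw [Real.norm_of_nonneg (by positivity)]
    have := Real.sqrt_pos.2 hm
    gcongr
  exact ⟨h.toLp _, h.coeFn_toLp⟩

theorem norm_mulL_le {E : Type*} [NormedAddCommGroup E] [NormedSpace ℝ E] {m : ℝ} (hm : 0 < m)
    (ha : ∀ᵐ x ∂(volume.restrict Ω), m ≤ a x)
    (hk : k₁ =ᵐ[volume.restrict Ω] fun x => (√(a x))⁻¹) (f : Lp E 2 (volume.restrict Ω)) :
    ‖mulL k₁ f‖ ≤ (√m)⁻¹ * ‖f‖ := by
  refine Lp.norm_le_mul_norm_of_ae_le_mul ?_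
  filter_upwards [coeFn_mulL k₁ f, hk, ha] with x h1 h2 h3
  have := Real.sqrt_pos.2 hm
  rw [h1, norm_smul, h2, Real.norm_of_nonneg (by positivity)]
  gcongr

theorem norm_energyEmb_le {m₀ : ℝ} (hm₀ : 0 < m₀) (ha : ∀ᵐ x ∂(volume.restrict Ω), m₀ ≤ a x)
    (hk₁ : k₁ =ᵐ[volume.restrict Ω] fun x => (√(a x))⁻¹) (w : energyHilbert k₁ k₂) :
    ‖energyEmb k₁ k₂ w‖ ≤ (√m₀)⁻¹ * ‖w‖ := by
  have h1 : ‖w.1.fst‖ ≤ ‖w‖ := WithLp.norm_fst_le _ w.1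
  have h2 : ‖mulL k₁ w.1.fst‖ ≤ (√m₀)⁻¹ * ‖w.1.fst‖ := norm_mulL_le hm₀ ha hk₁ _
  exact h2.trans (by gcongr)

theorem norm_grad_toH1_le {P : ℝ} (hP : 0 < P) (hd : ∀ᵐ x ∂(volume.restrict Ω), P ≤ d x)
    (hk₂ : k₂ =ᵐ[volume.restrict Ω] fun x => (√(d x))⁻¹) (w : energyHilbert k₁ k₂) :
    ‖grad (toH1 k₁ k₂ w)‖ ≤ (√P)⁻¹ * ‖w‖ := by
  have h1 : ‖w.1.snd‖ ≤ ‖w‖ := WithLp.norm_snd_le _ w.1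
  have h2 : ‖mulL k₂ w.1.snd‖ ≤ (√P)⁻¹ * ‖w.1.snd‖ := norm_mulL_le hP hd hk₂ _
  rw [grad_toH1]
  exact h2.trans (by gcongr)

theorem integral_weight_mul_inner {E : Type*} [NormedAddCommGroup E] [InnerProductSpace ℝ E]
    {m : ℝ} (hm : 0 < m) (ha : ∀ᵐ x ∂(volume.restrict Ω), m ≤ a x)
    (hk : k₁ =ᵐ[volume.restrict Ω] fun x => (√(a x))⁻¹) (f g : Lp E 2 (volume.restrict Ω)) :
    ∫ x in Ω, a x * inner ℝ (mulL k₁ f x) (mulL k₁ g x) = inner ℝ f g := by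
  rw [L2.inner_def]
  refine integral_congr_ae ?_
  filter_upwards [coeFn_mulL k₁ f, coeFn_mulL k₁ g, hk, ha] with x h1 h2 h3 h4
  have hs := Real.sqrt_pos.2 (hm.trans_le h4)
  have hsq := Real.mul_self_sqrt (hm.le.trans h4)
  rw [h1, h2, h3, inner_smul_left, inner_smul_right, RCLike.conj_to_real]
  field_simp
  rw [sq, hsq, mul_comm]

theorem energyForm_toH1 {m₀ : ℝ} (hm₀ : 0 < m₀) (ha : ∀ᵐ x ∂(volume.restrict Ω), m₀ ≤ a x)
    (hd : ∀ᵐ x ∂(volume.restrict Ω), m₀ ≤ d x)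
    (hk₁ : k₁ =ᵐ[volume.restrict Ω] fun x => (√(a x))⁻¹)
    (hk₂ : k₂ =ᵐ[volume.restrict Ω] fun x => (√(d x))⁻¹) (w w' : energyHilbert k₁ k₂) :
    energyForm d a (toH1 k₁ k₂ w) (toH1 k₁ k₂ w') = inner ℝ w w' := by
  have h1 := integral_weight_mul_inner hm₀ ha hk₁ w.1.fst w'.1.fst
  have h2 := integral_weight_mul_inner hm₀ hd hk₂ w.1.snd w'.1.snd
  have h3 : inner ℝ w w' = inner ℝ w.1.fst w'.1.fst + inner ℝ w.1.snd w'.1.snd := rfl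
  have h4 : ∫ x in Ω, a x * (fn (toH1 k₁ k₂ w) x * fn (toH1 k₁ k₂ w') x) =
      inner ℝ w.1.fst w'.1.fst := by
    rw [← h1]
    refine integral_congr_ae (Eventually.of_forall fun x => ?_)
    exact congrArg (a x * ·) (mul_comm _ _)
  exact (add_comm _ _).trans (h3.trans (congrArg₂ (· + ·) h4.symm h2.symm)).symm

theorem toH1_mem {m₀ : ℝ} (hm₀ : 0 < m₀) (ha : ∀ᵐ x ∂(volume.restrict Ω), m₀ ≤ a x)
    (hk₁ : k₁ =ᵐ[volume.restrict Ω] fun x => (√(a x))⁻¹) (w : energyHilbert k₁ k₂) :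
    toH1 k₁ k₂ w ∈ energySpace Ω a := by
  refine (memLp_congr_ae ?_).1 (Lp.memLp w.1.fst)
  filter_upwards [coeFn_mulL k₁ w.1.fst, hk₁, ha] with x h1 h2 h3
  have h4 : fn (toH1 k₁ k₂ w) x = mulL k₁ w.1.fst x := rfl
  have hs := Real.sqrt_pos.2 (hm₀.trans_le h3)
  rw [h4, h1, h2, abs_of_pos (hm₀.trans_le h3), smul_eq_mul, mul_inv_cancel_left₀ hs.ne']

theorem exists_toH1_eq {m₀ D : ℝ} (hm₀ : 0 < m₀) (ha : ∀ᵐ x ∂(volume.restrict Ω), m₀ ≤ a x)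
    (hd : ∀ᵐ x ∂(volume.restrict Ω), m₀ ≤ d x) (hD : ∀ᵐ x ∂(volume.restrict Ω), d x ≤ D)
    (hdm : AEStronglyMeasurable d (volume.restrict Ω))
    (hk₁ : k₁ =ᵐ[volume.restrict Ω] fun x => (√(a x))⁻¹)
    (hk₂ : k₂ =ᵐ[volume.restrict Ω] fun x => (√(d x))⁻¹) {u : H1 Ω} (hu : u ∈ energySpace Ω a) :
    ∃ w, toH1 k₁ k₂ w = u := by
  have hu' : MemLp (fun x => √|a x| * fn u x) 2 (volume.restrict Ω) := hu
  have hG : MemLp (fun x => √(d x) • grad u x) 2 (volume.restrict Ω) := by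
    refine ((Lp.memLp (grad u)).norm.const_mul √D).mono'
      ((Real.continuous_sqrt.comp_aestronglyMeasurable hdm).smul (Lp.memLp (grad u)).1) ?_
    filter_upwards [hD] with x hx
    rw [norm_smul, Real.norm_of_nonneg (Real.sqrt_nonneg _)]
    exact mul_le_mul_of_nonneg_right (Real.sqrt_le_sqrt hx) (norm_nonneg _)
  have e1 : mulL k₁ (hu'.toLp _) = fn u := by
    refine Lp.ext ?_
    filter_upwards [coeFn_mulL k₁ (hu'.toLp _), hk₁, ha, hu'.coeFn_toLp] with x h1 h2 h3 h4
    have hs := Real.sqrt_pos.2 (hm₀.trans_le h3)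
    rw [h1, h2, h4, abs_of_pos (hm₀.trans_le h3), smul_eq_mul, inv_mul_cancel_left₀ hs.ne']
  have e2 : mulL k₂ (hG.toLp _) = grad u := by
    refine Lp.ext ?_
    filter_upwards [coeFn_mulL k₂ (hG.toLp _), hk₂, hd, hG.coeFn_toLp] with x h1 h2 h3 h4
    have hs := Real.sqrt_pos.2 (hm₀.trans_le h3)
    rw [h1, h2, h4, inv_smul_smul₀ hs.ne']
  have e3 : weightMap k₁ k₂ (WithLp.toLp 2 (hu'.toLp _, hG.toLp _)) = u.1 := Prod.ext e1 e2
  refine ⟨⟨WithLp.toLp 2 (hu'.toLp _, hG.toLp _), ?_⟩, Subtype.ext e3⟩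
  change weightMap k₁ k₂ (WithLp.toLp 2 (hu'.toLp _, hG.toLp _)) ∈ H1 Ω
  rw [e3]
  exact u.2

/-- The energy space, presented as an abstract Hilbert space `H` with a linear map `T` onto the
subspace `X^{1/2}` of `H¹` that carries the scalar product of `H` to the energy form, and with the
embedding `ι` into `L²`. The gradient bound holds for every lower bound `P` of the diffusion
coefficient. -/
theorem exists_hilbert_model {m₀ D : ℝ} (hm₀ : 0 < m₀)
    (ham : AEStronglyMeasurable a (volume.restrict Ω)) (ha : ∀ᵐ x ∂(volume.restrict Ω), m₀ ≤ a x)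
    (hdm : AEStronglyMeasurable d (volume.restrict Ω)) (hd : ∀ᵐ x ∂(volume.restrict Ω), m₀ ≤ d x)
    (hD : ∀ᵐ x ∂(volume.restrict Ω), d x ≤ D) :
    ∃ (H : Type) (_ : NormedAddCommGroup H) (_ : InnerProductSpace ℝ H) (_ : CompleteSpace H)
      (T : H →ₗ[ℝ] H1 Ω) (ι : H →L[ℝ] Lp ℝ 2 (volume.restrict Ω)),
      (∀ w, fn (T w) = ι w) ∧ (∀ w w', energyForm d a (T w) (T w') = inner ℝ w w') ∧
      (∀ w, T w ∈ energySpace Ω a) ∧ (∀ u ∈ energySpace Ω a, ∃ w, T w = u) ∧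
      (∀ w, ‖ι w‖ ≤ (√m₀)⁻¹ * ‖w‖) ∧
      ∀ P, 0 < P → (∀ᵐ x ∂(volume.restrict Ω), P ≤ d x) → ∀ w, ‖grad (T w)‖ ≤ (√P)⁻¹ * ‖w‖ := by
  obtain ⟨k₁, hk₁⟩ := exists_rsqrt_weight hm₀ ham ha
  obtain ⟨k₂, hk₂⟩ := exists_rsqrt_weight hm₀ hdm hd
  exact ⟨energyHilbert k₁ k₂, inferInstance, inferInstance, inferInstance, toH1 k₁ k₂,
    energyEmb k₁ k₂, fn_toH1 k₁ k₂, energyForm_toH1 hm₀ ha hd hk₁ hk₂, toH1_mem hm₀ ha hk₁,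
    fun u hu => exists_toH1_eq hm₀ ha hd hD hdm hk₁ hk₂ hu, norm_energyEmb_le hm₀ ha hk₁,
    fun P hP hdP w => norm_grad_toH1_le hP hdP hk₂ w⟩

end Weights

/-! ### Equilibria for a globally Lipschitz nonlinearity -/

/-- Lipschitz estimate in `L²` for a superposition operator whose slope is small near `0`, on
functions `z + m` with a small constant part `m`. A change of `z` costs the global Lipschitz
constant; a change of `m` costs only the small slope `η`, except where `|z|` exceeds `r / 2`, a set
that is controlled by `‖z‖`. -/
theorem norm_compLp_sub_le {μ : Measure (Rn n)} {g : ℝ → ℝ} {Λ : ℝ≥0} (hg : LipschitzWith Λ g)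
    (hg0 : g 0 = 0) {r η : ℝ} (hr : 0 < r) (hη : 0 ≤ η)
    (hsmall : ∀ s t, |s| ≤ r → |t| ≤ r → |g s - g t| ≤ η * |s - t|)
    {o : Lp ℝ 2 μ} (ho : o =ᵐ[μ] fun _ => (1 : ℝ)) (z₁ z₂ : Lp ℝ 2 μ) {m₁ m₂ : ℝ}
    (hm₁ : |m₁| ≤ r / 2) (hm₂ : |m₂| ≤ r / 2) :
    ‖hg.compLp hg0 (z₁ + m₁ • o) - hg.compLp hg0 (z₂ + m₂ • o)‖ ≤
      Λ * ‖z₁ - z₂‖ + |m₁ - m₂| * (η * ‖o‖ + 2 * Λ / r * ‖z₂‖) := by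
  have hpt : ∀ x y : ℝ, |g (x + m₁) - g (y + m₂)| ≤
      Λ * |x - y| + |m₁ - m₂| * (η + 2 * Λ / r * |y|) := by
    intro x y
    have hL : ∀ s t, |g s - g t| ≤ Λ * |s - t| := fun s t => by
      simpa [Real.dist_eq] using hg.dist_le_mul s t
    have h1 : |g (x + m₁) - g (y + m₁)| ≤ Λ * |x - y| := by
      simpa using hL (x + m₁) (y + m₁)
    have h2 : |g (y + m₁) - g (y + m₂)| ≤ |m₁ - m₂| * (η + 2 * Λ / r * |y|) := by
      have he : (y + m₁) - (y + m₂) = m₁ - m₂ := by ring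
      rcases le_or_gt |y| (r / 2) with hy | hy
      · have := hsmall (y + m₁) (y + m₂) ((abs_add_le _ _).trans (by linarith))
          ((abs_add_le _ _).trans (by linarith))
        rw [he] at this
        have h3 : 0 ≤ |m₁ - m₂| * (2 * Λ / r * |y|) := by positivity
        linarith
      · have := hL (y + m₁) (y + m₂)
        rw [he] at this
        have h3 : (Λ : ℝ) ≤ 2 * Λ / r * |y| := by
          rw [div_mul_eq_mul_div, le_div_iff₀ hr]
          nlinarith [Λ.coe_nonneg]
        have h4 : Λ * |m₁ - m₂| ≤ (2 * Λ / r * |y|) * |m₁ - m₂| := by gcongr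
        have h5 : 0 ≤ |m₁ - m₂| * η := by positivity
        linarith
    have h3 := abs_sub_le (g (x + m₁)) (g (y + m₁)) (g (y + m₂))
    linarith
  have h1 : ‖hg.compLp hg0 (z₁ + m₁ • o) - hg.compLp hg0 (z₂ + m₂ • o)‖ ≤
      ‖(Λ : ℝ) • |z₁ - z₂| + |m₁ - m₂| • (η • o + (2 * Λ / r) • |z₂|)‖ := by
    refine Lp.norm_le_norm_of_ae_le ?_
    filter_upwards [Lp.coeFn_sub (hg.compLp hg0 (z₁ + m₁ • o)) (hg.compLp hg0 (z₂ + m₂ • o)),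
      hg.coeFn_compLp hg0 (z₁ + m₁ • o), hg.coeFn_compLp hg0 (z₂ + m₂ • o),
      Lp.coeFn_add z₁ (m₁ • o), Lp.coeFn_add z₂ (m₂ • o), Lp.coeFn_smul m₁ o, Lp.coeFn_smul m₂ o,
      Lp.coeFn_add ((Λ : ℝ) • |z₁ - z₂|) (|m₁ - m₂| • (η • o + (2 * Λ / r) • |z₂|)),
      Lp.coeFn_smul (Λ : ℝ) |z₁ - z₂|, Lp.coeFn_smul |m₁ - m₂| (η • o + (2 * Λ / r) • |z₂|),
      Lp.coeFn_add (η • o) ((2 * (Λ : ℝ) / r) • |z₂|), Lp.coeFn_smul η o,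
      Lp.coeFn_smul (2 * (Λ : ℝ) / r) |z₂|, Lp.coeFn_abs (z₁ - z₂), Lp.coeFn_abs z₂,
      Lp.coeFn_sub z₁ z₂, ho] with x a1 a2 a3 a4 a5 a6 a7 b1 b2 b3 b4 b5 b6 c1 c2 c3 c4
    rw [a1, Pi.sub_apply, a2, a3, Function.comp_apply, Function.comp_apply, a4, a5, Pi.add_apply,
      Pi.add_apply, a6, a7, b1, Pi.add_apply, b2, b3, Pi.smul_apply, Pi.smul_apply, Pi.smul_apply,
      Pi.smul_apply, b4, Pi.add_apply, b5, b6, Pi.smul_apply, Pi.smul_apply, c1, c2, c3,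
      Pi.sub_apply, c4]
    simp only [smul_eq_mul, mul_one]
    exact (hpt _ _).trans (Real.le_norm_self _)
  refine h1.trans ((norm_add_le _ _).trans (add_le_add ?_ ?_))
  · rw [norm_smul, norm_abs_eq_norm, Real.norm_of_nonneg Λ.coe_nonneg]
  · rw [norm_smul, Real.norm_eq_abs, abs_abs]
    gcongr
    refine (norm_add_le _ _).trans (le_of_eq ?_)
    rw [norm_smul, norm_smul, norm_abs_eq_norm, Real.norm_of_nonneg hη,
      Real.norm_of_nonneg (by positivity)]

theorem constH1_mem_energySpace (hΩb : Bornology.IsBounded Ω) {a : Rn n → ℝ}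
    (ha : Integrable a (volume.restrict Ω)) (c : ℝ) : constH1 hΩb c ∈ energySpace Ω a := by
  have h1 : MemLp (fun x => √|a x|) 2 (volume.restrict Ω) := by
    refine (memLp_two_iff_integrable_sq
      ((Real.continuous_sqrt.comp continuous_abs).comp_aestronglyMeasurable ha.1)).2 ?_
    refine ha.abs.congr (Eventually.of_forall fun x => ?_)
    exact (Real.sq_sqrt (abs_nonneg _)).symm
  refine (memLp_congr_ae ?_).1 (h1.mul_const c)
  filter_upwards [(memLp_const_of_isBounded hΩb c).coeFn_toLp] with x hx
  exact congrArg (√|a x| * ·) hx.symm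

theorem fn_constH1 (hΩb : Bornology.IsBounded Ω) (c : ℝ) :
    fn (constH1 hΩb c) =ᵐ[volume.restrict Ω] fun _ => c :=
  (memLp_const_of_isBounded hΩb c).coeFn_toLp

theorem smul_constH1_one (hΩb : Bornology.IsBounded Ω) (c : ℝ) :
    c • constH1 hΩb 1 = constH1 hΩb c := by
  refine Subtype.ext (Prod.ext ?_ (smul_zero c))
  refine Lp.ext ?_
  filter_upwards [Lp.coeFn_smul c (fn (constH1 hΩb 1)), fn_constH1 hΩb 1, fn_constH1 hΩb c]
    with x h1 h2 h3
  refine h1.trans ?_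
  rw [Pi.smul_apply, h2, smul_eq_mul, mul_one]
  exact h3.symm

/-- The orthogonal projection is the best approximation in the direction of `o`. -/
theorem norm_sub_proj_le {L : Type*} [NormedAddCommGroup L] [InnerProductSpace ℝ L] {o : L} {v : ℝ}
    (hv : 0 < v) (ho : ‖o‖ ^ 2 = v) (x : L) (m : ℝ) :
    ‖x - (inner ℝ o x / v) • o‖ ≤ ‖x - m • o‖ := by
  refine (sq_le_sq₀ (norm_nonneg _) (norm_nonneg _)).1 ?_
  set k := inner ℝ o x / v with hk
  have hkv : inner ℝ o x = k * v := by rw [hk, div_mul_cancel₀ _ hv.ne']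
  have h : ∀ t : ℝ, ‖x - t • o‖ ^ 2 = ‖x‖ ^ 2 - 2 * t * (k * v) + t ^ 2 * v := fun t => by
    rw [norm_sub_sq_real, inner_smul_right, real_inner_comm, hkv, norm_smul, mul_pow, ho,
      Real.norm_eq_abs, sq_abs]
    ring
  rw [h, h]
  nlinarith [mul_nonneg hv.le (sq_nonneg (k - m))]

section Equation

variable {a d : Rn n → ℝ} {H : Type*} [NormedAddCommGroup H] [InnerProductSpace ℝ H]
  {T : H →ₗ[ℝ] H1 Ω} {ι : H →L[ℝ] Lp ℝ 2 (volume.restrict Ω)}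

/-- The functional `φ ↦ ∫ W φ` on the energy space, as a continuous linear functional. -/
theorem exists_functional {κ R : ℝ} {W : Rn n → ℝ} (hfn : ∀ w, fn (T w) = ι w)
    (hι : ∀ w, ‖ι w‖ ≤ κ * ‖w‖) (hT : ∀ w, ‖grad (T w)‖ ≤ κ * ‖w‖) (hR : 0 ≤ R)
    (hW : ∀ φ : H1 Ω, Integrable (fun x => W x * fn φ x) (volume.restrict Ω) ∧
      |∫ x in Ω, W x * fn φ x| ≤ R * (‖fn φ‖ + ‖grad φ‖)) :
    ∃ ρ : H →L[ℝ] ℝ, (∀ w, ρ w = ∫ x in Ω, W x * ι w x) ∧ ∀ w, |ρ w| ≤ 2 * κ * R * ‖w‖ := by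
  have hi : ∀ w : H, Integrable (fun x => W x * ι w x) (volume.restrict Ω) := fun w => by
    have h := (hW (T w)).1
    rwa [hfn] at h
  have hb : ∀ w : H, |∫ x in Ω, W x * ι w x| ≤ 2 * κ * R * ‖w‖ := by
    intro w
    have h1 := (hW (T w)).2
    rw [hfn] at h1
    refine h1.trans ?_
    calc R * (‖ι w‖ + ‖grad (T w)‖) ≤ R * (κ * ‖w‖ + κ * ‖w‖) := by
          gcongr
          exacts [hι w, hT w]
      _ = _ := by ring
  let ρ₀ : H →ₗ[ℝ] ℝ :=
    { toFun := fun w => ∫ x in Ω, W x * ι w x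
      map_add' := fun w w' => by
        rw [map_add, ← integral_add (hi w) (hi w')]
        refine integral_congr_ae ?_
        filter_upwards [Lp.coeFn_add (ι w) (ι w')] with x hx
        rw [hx, Pi.add_apply, mul_add]
      map_smul' := fun s w => by
        rw [map_smul, RingHom.id_apply, smul_eq_mul, ← integral_const_mul]
        refine integral_congr_ae ?_
        filter_upwards [Lp.coeFn_smul s (ι w)] with x hx
        rw [hx, Pi.smul_apply, smul_eq_mul, mul_left_comm] }
  exact ⟨ρ₀.mkContinuous _ hb, fun w => rfl, hb⟩

/-- Testing the constant function `1` against `φ` gives `∫ a φ`, which splits into the limit part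
`ℓ ∫ φ` and the residual `∫ (a - ℓ) φ`. -/
theorem inner_eq_of_eq_constH1_one {ℓ : ℝ} (hΩb : Bornology.IsBounded Ω)
    (hfn : ∀ w, fn (T w) = ι w) (hform : ∀ w w', energyForm d a (T w) (T w') = inner ℝ w w')
    (hW : ∀ φ : H1 Ω, Integrable (fun x => (a x - ℓ) * fn φ x) (volume.restrict Ω))
    {e : H} (he : T e = constH1 hΩb 1) (φ : H) :
    inner ℝ e φ = ℓ * inner ℝ (ι e) (ι φ) + ∫ x in Ω, (a x - ℓ) * ι φ x := by
  have hfe : ι e =ᵐ[volume.restrict Ω] fun _ => (1 : ℝ) := by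
    rw [← hfn, he]
    exact fn_constH1 hΩb 1
  have hge : grad (T e) = 0 := by
    rw [he]
    rfl
  have h1 : ∫ x in Ω, d x * inner ℝ (grad (T e) x) (grad (T φ) x) = 0 := by
    rw [hge]
    refine integral_eq_zero_of_ae ?_
    filter_upwards [Lp.coeFn_zero (Rn n) 2 (volume.restrict Ω)] with x hx
    rw [hx]
    simp
  have hi : Integrable (fun x => ι e x * ι φ x) (volume.restrict Ω) :=
    MemLp.integrable_mul (p := 2) (q := 2) (Lp.memLp _) (Lp.memLp _)
  have hi' := hW (T φ)
  rw [hfn] at hi'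
  rw [← hform, energyForm, h1, zero_add, hfn, hfn, L2.inner_def, ← integral_const_mul,
    ← integral_add _ hi']
  · refine integral_congr_ae ?_
    filter_upwards [hfe] with x hx
    rw [hx]
    simp
    ring
  · refine (hi.const_mul ℓ).congr (Eventually.of_forall fun x => ?_)
    simp [mul_comm]

theorem comp_add_smul_ae_eq {μ : Measure (Rn n)} {ℓ b c : ℝ} {Λ : ℝ≥0} {F g : ℝ → ℝ}
    (hg : LipschitzWith Λ g) (hg0 : g 0 = 0) (hgF : ∀ s, F (s + c) = ℓ * c + b * s + g s)
    {o : Lp ℝ 2 μ} (ho : o =ᵐ[μ] fun _ => (1 : ℝ)) (z : Lp ℝ 2 μ) :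
    (fun x => F ((z + c • o) x)) =ᵐ[μ] ⇑((ℓ * c) • o + b • z + hg.compLp hg0 z) := by
  filter_upwards [ho, Lp.coeFn_add z (c • o), Lp.coeFn_smul c o,
    Lp.coeFn_add ((ℓ * c) • o + b • z) (hg.compLp hg0 z),
    Lp.coeFn_add ((ℓ * c) • o) (b • z), Lp.coeFn_smul (ℓ * c) o, Lp.coeFn_smul b z,
    hg.coeFn_compLp hg0 z] with x h1 h2 h3 h4 h5 h6 h7 h8
  rw [h2, h4, Pi.add_apply, Pi.add_apply, h5, Pi.add_apply, h8, h3, h6, h7, Pi.smul_apply,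
    Pi.smul_apply, Pi.smul_apply, h1, smul_eq_mul, smul_eq_mul, smul_eq_mul, mul_one, mul_one]
  exact hgF _

/-- The equation for `u = w + c`, after subtracting the linear part `s ↦ ℓ c + b s` of `F (c + s)`
at the limit equilibrium `c`. -/
theorem isWeakEquilibrium_iff_semilinear {ℓ b c : ℝ} {Λ : ℝ≥0} {F g : ℝ → ℝ}
    (hΩb : Bornology.IsBounded Ω)
    (hfn : ∀ w, fn (T w) = ι w) (hform : ∀ w w', energyForm d a (T w) (T w') = inner ℝ w w')
    (hmem : ∀ w, T w ∈ energySpace Ω a) (hsurj : ∀ u ∈ energySpace Ω a, ∃ w, T w = u)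
    {e : H} (hee : T e = constH1 hΩb 1) {ρ : H →L[ℝ] ℝ}
    (he : ∀ φ, inner ℝ e φ = ℓ * inner ℝ (ι e) (ι φ) + ρ φ)
    (hg : LipschitzWith Λ g) (hg0 : g 0 = 0) (hgF : ∀ s, F (s + c) = ℓ * c + b * s + g s)
    (w : H) :
    IsWeakEquilibrium d a F (T (w + c • e)) ↔
      ∀ φ, inner ℝ w φ - b * inner ℝ (ι w) (ι φ) =
        inner ℝ (hg.compLp hg0 (ι w)) (ι φ) - c * ρ φ := by
  have hfe : ι e =ᵐ[volume.restrict Ω] fun _ => (1 : ℝ) := by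
    rw [← hfn, hee]
    exact fn_constH1 hΩb 1
  have hFy := comp_add_smul_ae_eq hg hg0 hgF hfe (ι w)
  rw [← map_smul, ← map_add, ← hfn] at hFy
  generalize hG : hg.compLp hg0 (ι w) = G at hFy ⊢
  have hR : ∀ φ : H, ∫ x in Ω, F (fn (T (w + c • e)) x) * fn (T φ) x =
        ℓ * c * inner ℝ (ι e) (ι φ) + b * inner ℝ (ι w) (ι φ) + inner ℝ G (ι φ) := by
    intro φ
    have h1 : ∫ x in Ω, F (fn (T (w + c • e)) x) * fn (T φ) x =
        inner ℝ ((ℓ * c) • ι e + b • ι w + G) (ι φ) := by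
      rw [L2.inner_def]
      refine integral_congr_ae ?_
      filter_upwards [hFy] with x hx
      rw [hx, hfn]
      exact mul_comm _ _
    rw [h1, inner_add_left, inner_add_left, real_inner_smul_left, real_inner_smul_left]
  have hL : ∀ φ : H, energyForm d a (T (w + c • e)) (T φ) =
        inner ℝ w φ + c * (ℓ * inner ℝ (ι e) (ι φ) + ρ φ) := by
    intro φ
    rw [hform, inner_add_left, real_inner_smul_left, he]
  constructor
  · intro h φ
    have h1 := h.eq _ (hmem φ)
    rw [hL, hR] at h1
    linarith
  · intro h
    refine ⟨hmem _, fun φ hφ => ?_, fun φ hφ => ?_⟩ <;> obtain ⟨ψ, rfl⟩ := hsurj φ hφ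
    · have hint : Integrable (fun x => ((ℓ * c) • ι e + b • ι w + G) x * ι ψ x)
          (volume.restrict Ω) := MemLp.integrable_mul (p := 2) (q := 2) (Lp.memLp _) (Lp.memLp _)
      refine hint.congr ?_
      filter_upwards [hFy] with x hx
      rw [hx, hfn]
    · rw [hL, hR]
      linarith [h ψ]

end Equation

/-- Lipschitz estimate for the superposition operator of `g` on a ball of the energy space: the
constant `θ` is small with `σ`, which measures the deviation from the constants, and `η`, the slope
of `g` near `0`. -/
theorem norm_compLp_emb_sub_le {H : Type*} [NormedAddCommGroup H] [InnerProductSpace ℝ H]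
    {μ : Measure (Rn n)} {ι : H →L[ℝ] Lp ℝ 2 μ} {g : ℝ → ℝ} {Λ : ℝ≥0} (hg : LipschitzWith Λ g)
    (hg0 : g 0 = 0) {r η κ σ δ v : ℝ} (hr : 0 < r) (hη : 0 ≤ η)
    (hsmall : ∀ s t, |s| ≤ r → |t| ≤ r → |g s - g t| ≤ η * |s - t|)
    {e : H} (he : ι e =ᵐ[μ] fun _ => (1 : ℝ)) (hv : 0 < v) (hve : ‖ι e‖ ^ 2 = v)
    (hκ : ∀ w, ‖ι w‖ ≤ κ * ‖w‖) (hκ0 : 0 ≤ κ) (hσ0 : 0 ≤ σ)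
    (hσ : ∀ w, ‖ι (w - (inner ℝ (ι e) (ι w) / v) • e)‖ ≤ σ * ‖w‖)
    (hδ : κ / √v * δ ≤ r / 2) {w₁ w₂ : H} (hw₁ : ‖w₁‖ ≤ δ) (hw₂ : ‖w₂‖ ≤ δ) :
    ‖hg.compLp hg0 (ι w₁) - hg.compLp hg0 (ι w₂)‖ ≤
      (Λ * σ + κ / √v * (η * √v + 2 * Λ / r * (σ * δ))) * ‖w₁ - w₂‖ := by
  have hsv : 0 < √v := Real.sqrt_pos.2 hv
  have hen : ‖ι e‖ = √v := by rw [← hve, Real.sqrt_sq (norm_nonneg _)]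
  have hm : ∀ w, |inner ℝ (ι e) (ι w) / v| ≤ κ / √v * ‖w‖ := by
    intro w
    rw [abs_div, abs_of_pos hv, div_le_iff₀ hv]
    calc |inner ℝ (ι e) (ι w)| ≤ ‖ι e‖ * ‖ι w‖ := abs_real_inner_le_norm _ _
      _ ≤ √v * (κ * ‖w‖) := by rw [hen]; gcongr; exact hκ w
      _ = κ / √v * ‖w‖ * (√v * √v) := by field_simp
      _ = _ := by rw [Real.mul_self_sqrt hv.le]
  have hdec : ∀ w, ι w = ι (w - (inner ℝ (ι e) (ι w) / v) • e) +
      (inner ℝ (ι e) (ι w) / v) • ι e := by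
    intro w
    rw [map_sub, map_smul, sub_add_cancel]
  have hms : inner ℝ (ι e) (ι w₁) / v - inner ℝ (ι e) (ι w₂) / v =
      inner ℝ (ι e) (ι (w₁ - w₂)) / v := by
    rw [map_sub, inner_sub_right, sub_div]
  have hzs : ι (w₁ - (inner ℝ (ι e) (ι w₁) / v) • e) - ι (w₂ - (inner ℝ (ι e) (ι w₂) / v) • e) =
      ι ((w₁ - w₂) - (inner ℝ (ι e) (ι (w₁ - w₂)) / v) • e) := by
    rw [← hms, ← map_sub, sub_smul]
    congr 1
    abel
  have hb : ∀ w, ‖w‖ ≤ δ → |inner ℝ (ι e) (ι w) / v| ≤ r / 2 := fun w hw =>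
    (hm w).trans (le_trans (by gcongr) hδ)
  have h := norm_compLp_sub_le hg hg0 hr hη hsmall he
    (ι (w₁ - (inner ℝ (ι e) (ι w₁) / v) • e)) (ι (w₂ - (inner ℝ (ι e) (ι w₂) / v) • e))
    (hb w₁ hw₁) (hb w₂ hw₂)
  rw [← hdec, ← hdec, hzs, hms, hen] at h
  refine h.trans ?_
  have h1 := hσ (w₁ - w₂)
  have h2 := hm (w₁ - w₂)
  have h3 : ‖ι (w₂ - (inner ℝ (ι e) (ι w₂) / v) • e)‖ ≤ σ * δ := (hσ w₂).trans (by gcongr)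
  have hδ0 : 0 ≤ δ := (norm_nonneg _).trans hw₁
  calc _ ≤ Λ * (σ * ‖w₁ - w₂‖) + κ / √v * ‖w₁ - w₂‖ * (η * √v + 2 * Λ / r * (σ * δ)) := by
        gcongr
    _ = _ := by ring

set_option maxHeartbeats 1000000 in
/-- Equilibria near a nondegenerate constant `c`, for a globally Lipschitz nonlinearity: the ball,
the admissible size of the perturbation `R` of the potential and of the deviation `σ` from the
constants, and the constant in the estimate do not depend on the coefficients. -/
theorem exists_uniform_equilibria (hΩ : IsOpen Ω) (hΩb : Bornology.IsBounded Ω)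
    (hΩn : Ω.Nonempty) {m₀ ℓ b c : ℝ} (hm₀ : 0 < m₀) (hℓb : ℓ ≠ b) {F : ℝ → ℝ} {Λ : ℝ≥0}
    (hF : LipschitzWith Λ F) (hFc : F c = ℓ * c)
    (hFb : ∀ η : ℝ, 0 < η → ∃ r : ℝ, 0 < r ∧ ∀ s t, |s - c| ≤ r → |t - c| ≤ r →
      |F s - F t - b * (s - t)| ≤ η * |s - t|) :
    ∃ δ : ℝ, 0 < δ ∧ ∃ r₁ : ℝ, 0 < r₁ ∧ ∃ σ₁ : ℝ, 0 < σ₁ ∧ ∃ C : ℝ, 0 < C ∧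
      ∀ (a d : Rn n → ℝ) (R σ D : ℝ), AEStronglyMeasurable a (volume.restrict Ω) →
        AEStronglyMeasurable d (volume.restrict Ω) →
        (∀ᵐ x ∂(volume.restrict Ω), m₀ ≤ a x) → (∀ᵐ x ∂(volume.restrict Ω), m₀ ≤ d x) →
        (∀ᵐ x ∂(volume.restrict Ω), d x ≤ D) → 0 ≤ R → R ≤ r₁ → 0 ≤ σ → σ ≤ σ₁ →
        (∀ φ : H1 Ω, Integrable (fun x => (a x - ℓ) * fn φ x) (volume.restrict Ω) ∧
          |∫ x in Ω, (a x - ℓ) * fn φ x| ≤ R * (‖fn φ‖ + ‖grad φ‖)) →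
        (∀ w ∈ energySpace Ω a, ∃ m : ℝ, eLpNorm (fun x => fn w x - m) 2 (volume.restrict Ω) ≤
          ENNReal.ofReal (σ * energyNorm d a w)) →
        ∃ u : H1 Ω, IsWeakEquilibrium d a F u ∧ energyNorm d a (u - constH1 hΩb c) ≤ δ ∧
          energyNorm d a (u - constH1 hΩb c) ≤ C * R ∧
          ∀ u' : H1 Ω, IsWeakEquilibrium d a F u' → energyNorm d a (u' - constH1 hΩb c) ≤ δ →
            u' = u := by
  have hfin : IsFiniteMeasure (volume.restrict Ω) :=
    isFiniteMeasure_restrict.2 hΩb.measure_lt_top.ne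
  obtain ⟨v, hvd⟩ : ∃ v : ℝ, v = ‖fn (constH1 hΩb 1)‖ ^ 2 := ⟨_, rfl⟩
  have hv : 0 < v := by
    rw [hvd]
    refine pow_pos (norm_pos_iff.2 fun h0 => ?_) 2
    have h1 := fn_constH1 hΩb 1
    rw [h0] at h1
    have h2 : ∀ᵐ x ∂(volume.restrict Ω), False := by
      filter_upwards [h1, Lp.coeFn_zero ℝ 2 (volume.restrict Ω)] with x h3 h4
      rw [h4] at h3
      exact zero_ne_one h3
    have h3 : (volume.restrict Ω : Measure (Rn n)) Set.univ = 0 := by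
      simpa [ae_iff] using h2
    rw [Measure.restrict_apply_univ] at h3
    exact (hΩ.measure_pos volume hΩn).ne' h3
  obtain ⟨κ, hκd⟩ : ∃ κ : ℝ, κ = (√m₀)⁻¹ := ⟨_, rfl⟩
  have hκ : 0 < κ := by
    rw [hκd]
    have := Real.sqrt_pos.2 hm₀
    positivity
  have hsv : 0 < √v := Real.sqrt_pos.2 hv
  have hℓb' : 0 < |ℓ - b| := abs_pos.2 (sub_ne_zero.2 hℓb)
  obtain ⟨Ce, hCe⟩ : ∃ Ce : ℝ, Ce = |ℓ| * v + 1 := ⟨_, rfl⟩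
  have hCe0 : 0 < Ce := by rw [hCe]; positivity
  obtain ⟨K, hK⟩ : ∃ K : ℝ, K = (1 + 2 * κ * Ce / √v) / min (1 / 8) (|ℓ - b| * v / (8 * Ce ^ 2)) :=
    ⟨_, rfl⟩
  have hK0 : 0 < K := by rw [hK]; positivity
  obtain ⟨Lg, hLg⟩ : ∃ Lg : ℝ≥0, Lg = Λ + ‖b‖₊ := ⟨_, rfl⟩
  let g : ℝ → ℝ := fun s => F (s + c) - ℓ * c - b * s
  have hgF : ∀ s, F (s + c) = ℓ * c + b * s + g s := fun s => by
    simp only [g]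
    ring
  have hg0 : g 0 = 0 := by simp [g, hFc]
  have hg : LipschitzWith Lg g := by
    refine LipschitzWith.of_dist_le_mul fun s t => ?_
    have h1 : |F (s + c) - F (t + c)| ≤ Λ * |s - t| := by
      simpa [Real.dist_eq] using hF.dist_le_mul (s + c) (t + c)
    rw [Real.dist_eq, Real.dist_eq, hLg, NNReal.coe_add, coe_nnnorm, Real.norm_eq_abs, add_mul,
      ← abs_mul]
    have h2 : g s - g t = (F (s + c) - F (t + c)) - b * (s - t) := by
      simp only [g]
      ring
    rw [h2]
    exact (abs_sub _ _).trans (by gcongr)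
  -- slope of `g` near `0` for which its contribution to `K κ θ` is at most `1 / 4`
  obtain ⟨η, hη⟩ : ∃ η : ℝ, η = 1 / (4 * (K * κ ^ 2 + 1)) := ⟨_, rfl⟩
  have hη0 : 0 < η := by rw [hη]; positivity
  obtain ⟨r₀, hr₀, hr₀'⟩ := hFb η hη0
  have hsmall : ∀ s t, |s| ≤ r₀ → |t| ≤ r₀ → |g s - g t| ≤ η * |s - t| := by
    intro s t hs ht
    have h1 := hr₀' (s + c) (t + c) (by simpa using hs) (by simpa using ht)
    have h2 : g s - g t = F (s + c) - F (t + c) - b * (s + c - (t + c)) := by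
      simp only [g]
      ring
    rw [h2]
    refine h1.trans (le_of_eq ?_)
    rw [add_sub_add_right_eq_sub]
  -- for `‖w‖ ≤ δ` the constant part of `w` is at most `r₀ / 2`
  obtain ⟨δ, hδ⟩ : ∃ δ : ℝ, δ = r₀ * √v / (2 * κ) := ⟨_, rfl⟩
  have hδ0 : 0 < δ := by rw [hδ]; positivity
  have hδr : κ / √v * δ ≤ r₀ / 2 := by
    rw [hδ]
    refine le_of_eq ?_
    field_simp
  -- `Q` is the coefficient of `σ` in `K κ θ`, where `θ` is the Lipschitz constant on the ball.
  obtain ⟨Q, hQ⟩ : ∃ Q : ℝ, Q = K * κ * (Lg + κ / √v * (2 * Lg / r₀) * δ) := ⟨_, rfl⟩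
  have hQ0 : 0 ≤ Q := by rw [hQ]; positivity
  -- bound for the norm `r = 2 κ R` of the residual functional
  obtain ⟨X, hX⟩ : ∃ X : ℝ, X = min (1 / 4) (min (|ℓ - b| * v / 4)
    (min (|ℓ - b| * v / (2 * Ce)) (δ / (2 * (K * |c| + 1))))) := ⟨_, rfl⟩
  have hX0 : 0 < X := by rw [hX]; positivity
  refine ⟨δ, hδ0, X / (2 * κ), by positivity,
    min 1 (min (1 / (4 * (Q + 1))) (1 / (2 * (|b| + 1)))), by positivity,
    4 * K * κ * |c| + 1, by positivity, ?_⟩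
  intro a d R σ D ham hdm ha hd hD hR0 hR hσ0 hσ hW hP
  obtain ⟨H, _, _, _, T, ι, hfn, hform, hmem, hsurj, hι, hgrad⟩ :=
    exists_hilbert_model hm₀ ham ha hdm hd hD
  rw [← hκd] at hι
  have hgrad' := hgrad m₀ hm₀ hd
  rw [← hκd] at hgrad'
  obtain ⟨ρ, hρ, hρb⟩ := exists_functional (T := T) hfn hι hgrad' hR0 hW
  have hnorm : ∀ w, energyNorm d a (T w) = ‖w‖ := fun w => by
    rw [energyNorm, hform, real_inner_self_eq_norm_sq, Real.sqrt_sq (norm_nonneg _)]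
  have haint : Integrable a (volume.restrict Ω) := by
    have h1 : Integrable (fun x => a x - ℓ) (volume.restrict Ω) := by
      refine (hW (constH1 hΩb 1)).1.congr ?_
      filter_upwards [fn_constH1 hΩb 1] with x hx
      rw [hx, mul_one]
    exact (h1.add (integrable_const ℓ)).congr (Eventually.of_forall fun x => sub_add_cancel _ _)
  -- `e` represents the constant function `1`, and `w + c • e` the function `w + c`
  obtain ⟨e, hee⟩ := hsurj _ (constH1_mem_energySpace hΩb haint 1)
  have hιe : ι e =ᵐ[volume.restrict Ω] fun _ => (1 : ℝ) := by
    rw [← hfn, hee]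
    exact fn_constH1 hΩb 1
  have hve : ‖ι e‖ ^ 2 = v := by rw [hvd, ← hfn, hee]
  have he : ∀ φ, inner ℝ e φ = ℓ * inner ℝ (ι e) (ι φ) + ρ φ := fun φ => by
    rw [hρ]
    exact inner_eq_of_eq_constH1_one hΩb hfn hform (fun φ => (hW φ).1) hee φ
  obtain ⟨r, hr⟩ : ∃ r : ℝ, r = 2 * κ * R := ⟨_, rfl⟩
  rw [← hr] at hρb
  have hr0 : 0 ≤ r := by rw [hr]; positivity
  have hrX : r ≤ X := by
    rw [hr]
    rw [le_div_iff₀ (by positivity)] at hR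
    linarith
  have hX' := hrX
  rw [hX, le_min_iff, le_min_iff, le_min_iff] at hX'
  obtain ⟨hr₁, hr₂, hr₃, hr₄⟩ := hX'
  rw [le_min_iff, le_min_iff] at hσ
  obtain ⟨hσ₁, hσ₂, hσ₃⟩ := hσ
  -- `‖e‖² = ∫ a`, which differs from `ℓ v` by at most `r ‖e‖`
  have heCe : ‖e‖ ≤ Ce := by
    have h1 := he e
    rw [real_inner_self_eq_norm_sq, real_inner_self_eq_norm_sq, hve] at h1
    have h2 := (le_abs_self _).trans (hρb e)
    have h3 : ℓ * v ≤ |ℓ| * v := by gcongr; exact le_abs_self ℓ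
    have h4 : r * ‖e‖ ≤ 1 / 4 * ‖e‖ := by gcongr
    have h5 : 0 ≤ |ℓ| * v := by positivity
    by_contra! h6
    rw [hCe] at h6
    nlinarith [norm_nonneg e]
  have hσw : ∀ w, ‖ι (w - (inner ℝ (ι e) (ι w) / v) • e)‖ ≤ σ * ‖w‖ := by
    intro w
    obtain ⟨m, hm⟩ := hP (T w) (hmem w)
    rw [hnorm] at hm
    rw [map_sub, map_smul]
    refine (norm_sub_proj_le hv hve (ι w) m).trans ?_
    rw [Lp.norm_def]
    refine ENNReal.toReal_le_of_le_ofReal (by positivity) (le_trans (le_of_eq ?_) hm)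
    refine eLpNorm_congr_ae ?_
    filter_upwards [Lp.coeFn_sub (ι w) (m • ι e), Lp.coeFn_smul m (ι e), hιe] with x h1 h2 h3
    rw [h1, Pi.sub_apply, h2, Pi.smul_apply, h3, hfn, smul_eq_mul, mul_one]
  have hbσ : |b| * σ ^ 2 ≤ 1 / 2 := by
    rw [le_div_iff₀ (by positivity)] at hσ₃
    have h1 : σ ^ 2 ≤ σ := by nlinarith
    nlinarith [abs_nonneg b, mul_le_mul_of_nonneg_left h1 (abs_nonneg b)]
  have hθ : K * (κ * (Lg * σ + κ / √v * (η * √v + 2 * Lg / r₀ * (σ * δ)))) ≤ 1 / 2 := by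
    have h1 : K * (κ * (Lg * σ + κ / √v * (η * √v + 2 * Lg / r₀ * (σ * δ)))) =
        Q * σ + K * κ ^ 2 * η := by
      rw [hQ]
      field_simp
      ring
    have h2 : Q * σ ≤ 1 / 4 := by
      rw [le_div_iff₀ (by positivity)] at hσ₂
      nlinarith
    have h3 : K * κ ^ 2 * η ≤ 1 / 4 := by
      rw [hη, mul_one_div, div_le_iff₀ (by positivity)]
      linarith
    linarith
  have hδc : K * (|c| * r) ≤ δ / 2 := by
    rw [le_div_iff₀ (by positivity)] at hr₄
    nlinarith [abs_nonneg c]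
  have hr₃' : r * Ce ≤ |ℓ - b| * v / 2 := by
    rw [le_div_iff₀ (by positivity)] at hr₃
    linarith
  obtain ⟨w, hw1, hw2, hw3, hw4⟩ := exists_unique_semilinear (c := c) hv hve hℓb heCe hκ.le hι he hr0
    hρb hσw hr₁ hr₂ hr₃' hbσ hK (G := hg.compLp hg0) (hg.compLp_zero hg0) hδ0
    (fun w₁ w₂ h1 h2 => norm_compLp_emb_sub_le hg hg0 hr₀ hη0.le hsmall hιe hv hve hι hκ.le hσ0 hσw
      hδr h1 h2) hθ hδc
  have hiff := isWeakEquilibrium_iff_semilinear hΩb hfn hform hmem hsurj hee he hg hg0 hgF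
  have hsub : ∀ w, T (w + c • e) - constH1 hΩb c = T w := fun w => by
    rw [map_add, map_smul, hee, smul_constH1_one, add_sub_cancel_right]
  refine ⟨T (w + c • e), (hiff w).2 hw2, ?_, ?_, ?_⟩
  · rw [hsub, hnorm]
    exact hw1
  · rw [hsub, hnorm]
    refine hw3.trans ?_
    rw [hr]
    linarith
  · intro u' hu' hn'
    obtain ⟨w'', rfl⟩ := hsurj u' hu'.mem
    obtain ⟨w', rfl⟩ : ∃ w', w'' = w' + c • e := ⟨w'' - c • e, (sub_add_cancel _ _).symm⟩
    rw [hsub, hnorm] at hn'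
    rw [hw4 w' hn' ((hiff w').1 hu')]

/-! ### Truncation of the nonlinearity and the limit of large diffusion -/

theorem Dissipative.exists_forall_div_neg {f : ℝ → ℝ} (hf : Dissipative f) :
    ∃ M : ℝ, ∀ s, M < |s| → f s / s < 0 := by
  have h : ∀ᶠ s in cocompact ℝ, ((f s / s : ℝ) : EReal) < 0 := eventually_lt_of_limsup_lt hf
  rw [← Metric.cobounded_eq_cocompact] at h
  obtain ⟨M, -, hM⟩ := (hasBasis_cobounded_norm (E := ℝ)).eventually_iff.1 h
  refine ⟨M, fun s hs => ?_⟩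
  have := hM (x := s) (by simpa using hs.le)
  exact_mod_cast this

/-- The truncation of `f` that is constant beyond `[-M, M]`. -/
def truncate (M : ℝ) (f : ℝ → ℝ) (s : ℝ) : ℝ := f (max (-M) (min M s))

theorem truncate_of_abs_le {M : ℝ} {f : ℝ → ℝ} {s : ℝ} (hs : |s| ≤ M) : truncate M f s = f s := by
  obtain ⟨h1, h2⟩ := abs_le.1 hs
  rw [truncate, min_eq_right h2, max_eq_right h1]

theorem exists_lipschitzWith_truncate {M : ℝ} (hM : 0 ≤ M) {f : ℝ → ℝ} (hf : ContDiff ℝ 1 f) :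
    ∃ Λ : ℝ≥0, LipschitzWith Λ (truncate M f) := by
  obtain ⟨Λ, hΛ⟩ :=
    hf.contDiffOn.exists_lipschitzOnWith one_ne_zero (convex_Icc (-M) M) isCompact_Icc
  refine ⟨Λ * 1, ?_⟩
  have h1 : LipschitzWith 1 fun s : ℝ => max (-M) (min M s) :=
    (LipschitzWith.id.const_min M).const_max (-M)
  rw [← lipschitzOnWith_univ] at h1 ⊢
  exact hΛ.comp h1 fun s _ => ⟨le_max_left _ _, max_le (by linarith) (min_le_left _ _)⟩

/-- A `C¹` function is strictly differentiable, and near `c` the truncation changes nothing. -/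
theorem exists_slope_bound_truncate {M c : ℝ} (hc : |c| < M) {f : ℝ → ℝ} (hf : ContDiff ℝ 1 f)
    {η : ℝ} (hη : 0 < η) :
    ∃ r : ℝ, 0 < r ∧ ∀ s t, |s - c| ≤ r → |t - c| ≤ r →
      |truncate M f s - truncate M f t - deriv f c * (s - t)| ≤ η * |s - t| := by
  have h := (hf.contDiffAt (x := c)).hasStrictDerivAt one_ne_zero
  have h' := (hasStrictFDerivAt_iff_isLittleO.1 h.hasStrictFDerivAt).def hη
  rw [nhds_prod_eq, (Metric.nhds_basis_closedBall.prod_self).eventually_iff] at h'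
  obtain ⟨r, hr, hr'⟩ := h'
  refine ⟨min r (M - |c|), lt_min hr (sub_pos.2 hc), fun s t hs ht => ?_⟩
  rw [le_min_iff] at hs ht
  have hb : ∀ s, |s - c| ≤ M - |c| → |s| ≤ M := fun s hs => by
    have := abs_sub_abs_le_abs_sub s c
    linarith
  rw [truncate_of_abs_le (hb s hs.2), truncate_of_abs_le (hb t ht.2)]
  have := hr' (x := (s, t)) ⟨by simpa [Real.dist_eq] using hs.1, by simpa [Real.dist_eq] using ht.1⟩
  simpa [mul_comm] using this

theorem IsWeakEquilibrium.congr {d a : Rn n → ℝ} {f g : ℝ → ℝ} {u : H1 Ω}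
    (hu : IsWeakEquilibrium d a f u)
    (hfg : ∀ᵐ x ∂(volume.restrict Ω), f (fn u x) = g (fn u x)) : IsWeakEquilibrium d a g u := by
  have h : ∀ φ : H1 Ω, (fun x => f (fn u x) * fn φ x) =ᵐ[volume.restrict Ω]
      fun x => g (fn u x) * fn φ x := fun φ => by
    filter_upwards [hfg] with x hx
    rw [hx]
  exact ⟨hu.mem, fun φ hφ => (hu.integrable φ hφ).congr (h φ),
    fun φ hφ => (hu.eq φ hφ).trans (integral_congr_ae (h φ))⟩

theorem IsWeakEquilibrium.isEquilibrium {d a : Rn n → ℝ} {f : ℝ → ℝ} {u : H1 Ω}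
    (hu : IsWeakEquilibrium d a f u)
    (hf : MemLp (fun x => f (fn u x)) 2 (volume.restrict Ω)) : IsEquilibrium d a f u := by
  refine ⟨hf.toLp _, hf.coeFn_toLp, hu.mem, fun φ hφ => (hu.eq φ hφ).trans ?_⟩
  refine integral_congr_ae ?_
  filter_upwards [hf.coeFn_toLp] with x hx
  rw [hx]

theorem norm_grad_le_energyNorm {d a : Rn n → ℝ} {m₀ D P : ℝ} (hm₀ : 0 < m₀)
    (ham : AEStronglyMeasurable a (volume.restrict Ω)) (ha : ∀ᵐ x ∂(volume.restrict Ω), m₀ ≤ a x)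
    (hdm : AEStronglyMeasurable d (volume.restrict Ω)) (hd : ∀ᵐ x ∂(volume.restrict Ω), m₀ ≤ d x)
    (hD : ∀ᵐ x ∂(volume.restrict Ω), d x ≤ D) (hP : 0 < P)
    (hdP : ∀ᵐ x ∂(volume.restrict Ω), P ≤ d x) {u : H1 Ω} (hu : u ∈ energySpace Ω a) :
    ‖grad u‖ ≤ (√P)⁻¹ * energyNorm d a u := by
  obtain ⟨H, _, _, _, T, ι, -, hform, -, hsurj, -, hgrad⟩ :=
    exists_hilbert_model hm₀ ham ha hdm hd hD
  obtain ⟨w, rfl⟩ := hsurj u hu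
  rw [energyNorm, hform, real_inner_self_eq_norm_sq, Real.sqrt_sq (norm_nonneg _)]
  exact hgrad P hP hdP w

/-- By the Poincaré inequality, large diffusion forces functions of bounded energy to be nearly
constant. -/
theorem exists_eLpNorm_sub_le_energyNorm {d a : Rn n → ℝ} {m₀ D P : ℝ} {C : ℝ≥0} (hm₀ : 0 < m₀)
    (hC : ∀ (u : Rn n → ℝ) (G : Rn n → Rn n), MemLp u 2 (volume.restrict Ω) →
      MemLp G 2 (volume.restrict Ω) → HasWeakGradient Ω u G →
      ∃ m : ℝ, eLpNorm (fun x => u x - m) 2 (volume.restrict Ω) ≤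
        C * eLpNorm G 2 (volume.restrict Ω))
    (ham : AEStronglyMeasurable a (volume.restrict Ω)) (ha : ∀ᵐ x ∂(volume.restrict Ω), m₀ ≤ a x)
    (hdm : AEStronglyMeasurable d (volume.restrict Ω)) (hd : ∀ᵐ x ∂(volume.restrict Ω), m₀ ≤ d x)
    (hD : ∀ᵐ x ∂(volume.restrict Ω), d x ≤ D) (hP : 0 < P)
    (hdP : ∀ᵐ x ∂(volume.restrict Ω), P ≤ d x) {u : H1 Ω} (hu : u ∈ energySpace Ω a) :
    ∃ m : ℝ, eLpNorm (fun x => fn u x - m) 2 (volume.restrict Ω) ≤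
      ENNReal.ofReal (C * (√P)⁻¹ * energyNorm d a u) := by
  obtain ⟨m, hm⟩ := hC (fn u) (grad u) (Lp.memLp _) (Lp.memLp _) u.2
  refine ⟨m, hm.trans ?_⟩
  have h1 := norm_grad_le_energyNorm hm₀ ham ha hdm hd hD hP hdP hu
  have h2 : eLpNorm (grad u) 2 (volume.restrict Ω) = ENNReal.ofReal ‖grad u‖ := by
    rw [Lp.norm_def, ENNReal.ofReal_toReal (Lp.eLpNorm_ne_top _)]
  rw [h2, ← ENNReal.ofReal_coe_nnreal, ← ENNReal.ofReal_mul C.coe_nonneg, mul_assoc]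
  gcongr

/-- The linearisation at a hyperbolic equilibrium of the limit equation is nondegenerate. -/
theorem IsHyperbolic.ne_deriv {ℓ c : ℝ} {f : ℝ → ℝ} (h : IsHyperbolic ℓ f c) : ℓ ≠ deriv f c := by
  intro h0
  have h1 : limitLinearization ℓ f c = 0 := by simp [limitLinearization, h0]
  have h2 : (0 : ℂ) ∈ spectrum ℂ (limitLinearization ℓ f c) ∩ {μ : ℂ | μ.re = 0} := by
    refine ⟨?_, rfl⟩
    rw [h1, spectrum.zero_mem_iff]
    exact not_isUnit_zero
  rw [IsHyperbolic] at h
  rw [h] at h2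
  exact h2

theorem minDiffusion_le {d : Rn n → ℝ} {m₀ : ℝ} (hd : ∀ x ∈ closure Ω, m₀ ≤ d x) {x : Rn n}
    (hx : x ∈ closure Ω) : minDiffusion Ω d ≤ d x :=
  csInf_le ⟨m₀, by rintro _ ⟨y, hy, rfl⟩; exact hd y hy⟩ ⟨x, hx, rfl⟩

end LargeDiffusion

open LargeDiffusion

theorem mainTheorem3 {n : ℕ} (hn : 1 ≤ n)
    -- the domain
    (Ω : Set (LargeDiffusion.Rn n)) (hΩ_open : IsOpen Ω) (hΩ_conn : IsConnected Ω)
    (hΩ_bdd : Bornology.IsBounded Ω) (hΩ_smooth : LargeDiffusion.HasSmoothBoundary Ω)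
    (ε₀ : ℝ) (hε₀ : 0 < ε₀) (m₀ : ℝ) (hm₀ : 0 < m₀)
    -- the potentials
    (q : ℝ≥0∞) (hq₁ : 1 ≤ q) (hq₂ : 2 ≤ n → 2 ≤ q)
    (V : ℝ → LargeDiffusion.Rn n → ℝ) (V₀ lam : ℝ) (τ : ℝ → ℝ)
    (hV : ∀ ε ∈ Set.Ioo 0 ε₀, MemLp (V ε) q (volume.restrict Ω))
    (hτ_pos : ∀ ε ∈ Set.Ioo 0 ε₀, 0 < τ ε) (hτ_mono : MonotoneOn τ (Set.Ioo 0 ε₀))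
    (hτ_lim : Tendsto τ (𝓝[>] 0) (𝓝 0))
    (hVτ : ∀ ε ∈ Set.Ioo 0 ε₀,
      eLpNorm (fun x => V ε x - V₀) q (volume.restrict Ω) ≤ ENNReal.ofReal (τ ε))
    (hV_low : ∀ ε ∈ Set.Ioo 0 ε₀, ∀ᵐ x ∂(volume.restrict Ω), m₀ ≤ V ε x + lam)
    -- the diffusion coefficients
    (p : ℝ → LargeDiffusion.Rn n → ℝ)
    (hp_smooth : ∀ ε ∈ Set.Ioo 0 ε₀, ContDiffOn ℝ ∞ (p ε) (closure Ω))
    (hp_low : ∀ ε ∈ Set.Ioo 0 ε₀, ∀ x ∈ closure Ω, m₀ ≤ p ε x)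
    (hp_lim : Tendsto (fun ε => LargeDiffusion.minDiffusion Ω (p ε)) (𝓝[>] 0) atTop)
    -- the nonlinearity
    (f : ℝ → ℝ) (hf : ContDiff ℝ 1 f) (hf_growth : LargeDiffusion.GrowthCondition n f)
    (hf_diss : LargeDiffusion.Dissipative f)
    -- a hyperbolic equilibrium of the limit equation
    (c : ℝ) (hc : c ∈ LargeDiffusion.limitEquilibria (lam + V₀) f)
    (hc_hyp : LargeDiffusion.IsHyperbolic (lam + V₀) f c) :
    ∃ δ : ℝ, 0 < δ ∧ ∃ ε₁ ∈ Set.Ioo 0 ε₀, ∃ C : ℝ, 0 < C ∧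
      ∀ ε ∈ Set.Ioc 0 ε₁, ∃ u : LargeDiffusion.H1 Ω,
        LargeDiffusion.IsEquilibrium (p ε) (fun x => lam + V ε x) f u ∧
        LargeDiffusion.energyNorm (p ε) (fun x => lam + V ε x)
          (u - LargeDiffusion.constH1 hΩ_bdd c) ≤ δ ∧
        LargeDiffusion.energyNorm (p ε) (fun x => lam + V ε x)
          (u - LargeDiffusion.constH1 hΩ_bdd c) ≤
            C * (τ ε + LargeDiffusion.minDiffusion Ω (p ε) ^ (-(1 / 2) : ℝ)) ∧
        ∀ v : LargeDiffusion.H1 Ω,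
          LargeDiffusion.IsWeakEquilibrium (p ε) (fun x => lam + V ε x) f v →
          LargeDiffusion.energyNorm (p ε) (fun x => lam + V ε x)
            (v - LargeDiffusion.constH1 hΩ_bdd c) ≤ δ →
          v = u := by
  have hfin : IsFiniteMeasure (volume.restrict Ω) :=
    isFiniteMeasure_restrict.2 hΩ_bdd.measure_lt_top.ne
  -- Beyond `M` the nonlinearity points towards `0`, so that equilibria take values in `[-M, M]`.
  obtain ⟨M₀, hM₀⟩ := hf_diss.exists_forall_div_neg
  obtain ⟨M, hM⟩ : ∃ M : ℝ, M = max M₀ (max |c| 0) + 1 := ⟨_, rfl⟩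
  have hMM₀ : M₀ < M := by
    rw [hM]
    linarith [le_max_left M₀ (max |c| 0)]
  have hMc : |c| < M := by
    rw [hM]
    linarith [le_max_right M₀ (max |c| 0), le_max_left |c| 0]
  have hM0 : 0 < M := (abs_nonneg c).trans_lt hMc
  have hf1 : ∀ s, M ≤ s → f s ≤ 0 := fun s hs => by
    have h1 : 0 < s := hM0.trans_le hs
    have h2 := hM₀ s (by rw [abs_of_pos h1]; exact hMM₀.trans_le hs)
    exact not_lt.1 fun h => h2.not_ge (div_nonneg h.le h1.le)
  have hf2 : ∀ s, s ≤ -M → 0 ≤ f s := fun s hs => by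
    have h1 : s < 0 := by linarith
    have h2 := hM₀ s (by rw [abs_of_neg h1]; linarith)
    exact not_lt.1 fun h => h2.not_ge (div_nonneg_of_nonpos h.le h1.le)
  have ht1 : ∀ s, M < s → truncate M f s ≤ 0 := fun s hs => by
    rw [truncate, min_eq_left hs.le, max_eq_right (by linarith)]
    exact hf1 M le_rfl
  have ht2 : ∀ s, s < -M → 0 ≤ truncate M f s := fun s hs => by
    rw [truncate, max_eq_left ((min_le_right _ _).trans hs.le)]
    exact hf2 (-M) le_rfl
  obtain ⟨Λ, hΛ⟩ := exists_lipschitzWith_truncate hM0.le hf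
  have hFc : truncate M f c = (lam + V₀) * c := by
    rw [truncate_of_abs_le hMc.le]
    exact (sub_eq_zero.1 hc).symm
  obtain ⟨δ, hδ, r₁, hr₁, σ₁, hσ₁, C, hC, hmain⟩ := exists_uniform_equilibria hΩ_open hΩ_bdd
    hΩ_conn.nonempty hm₀ hc_hyp.ne_deriv hΛ hFc
    (fun η hη => exists_slope_bound_truncate hMc hf hη)
  obtain ⟨CR, hCR, hW⟩ :=
    exists_abs_integral_mul_fn_le hn hΩ_open hΩ_bdd hΩ_conn hq₁ hq₂
  obtain ⟨CP, hCP⟩ := hΩ_smooth.poincareOn hΩ_open hΩ_bdd hΩ_conn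
  have hev : ∀ᶠ ε in 𝓝[>] (0 : ℝ), ε ∈ Set.Ioo 0 ε₀ ∧ CR * τ ε ≤ r₁ ∧
      0 < minDiffusion Ω (p ε) ∧ CP * (√(minDiffusion Ω (p ε)))⁻¹ ≤ σ₁ := by
    have h1 : Tendsto (fun ε => CR * τ ε) (𝓝[>] 0) (𝓝 0) := by
      simpa using hτ_lim.const_mul CR
    have h2 : Tendsto (fun ε => (CP : ℝ) * (√(minDiffusion Ω (p ε)))⁻¹) (𝓝[>] 0) (𝓝 0) := by
      simpa using (Real.tendsto_sqrt_atTop.comp hp_lim).inv_tendsto_atTop.const_mul (CP : ℝ)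
    filter_upwards [Ioo_mem_nhdsGT hε₀, h1.eventually_le_const hr₁,
      hp_lim.eventually_gt_atTop 0, h2.eventually_le_const hσ₁] with ε k1 k2 k3 k4
    exact ⟨k1, k2, k3, k4⟩
  obtain ⟨ε₁, hε₁, hε₁'⟩ := mem_nhdsGT_iff_exists_Ioc_subset.1 hev
  have hε₁0 : 0 < ε₁ := hε₁
  refine ⟨δ, hδ, ε₁, (hε₁' ⟨hε₁0, le_rfl⟩).1, C * CR + 1, by positivity, fun ε hε => ?_⟩
  obtain ⟨hεI, hτr, hP, hPσ⟩ := hε₁' hε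
  have hτ0 := (hτ_pos ε hεI).le
  have hsub : ∀ᵐ x ∂(volume.restrict Ω), x ∈ Ω := ae_restrict_mem hΩ_open.measurableSet
  have ham : AEStronglyMeasurable (fun x => lam + V ε x) (volume.restrict Ω) :=
    aestronglyMeasurable_const.add (hV ε hεI).1
  have ha : ∀ᵐ x ∂(volume.restrict Ω), m₀ ≤ lam + V ε x := by
    filter_upwards [hV_low ε hεI] with x hx
    rwa [add_comm]
  have hpc : ContinuousOn (p ε) (closure Ω) := (hp_smooth ε hεI).continuousOn
  have hdm : AEStronglyMeasurable (p ε) (volume.restrict Ω) :=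
    (hpc.mono subset_closure).aestronglyMeasurable hΩ_open.measurableSet
  have hd : ∀ᵐ x ∂(volume.restrict Ω), m₀ ≤ p ε x := by
    filter_upwards [hsub] with x hx
    exact hp_low ε hεI x (subset_closure hx)
  have hdP : ∀ᵐ x ∂(volume.restrict Ω), minDiffusion Ω (p ε) ≤ p ε x := by
    filter_upwards [hsub] with x hx
    exact minDiffusion_le (hp_low ε hεI) (subset_closure hx)
  obtain ⟨D, hD'⟩ := hΩ_bdd.isCompact_closure.bddAbove_image hpc
  have hD : ∀ᵐ x ∂(volume.restrict Ω), p ε x ≤ D := by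
    filter_upwards [hsub] with x hx
    exact hD' ⟨x, subset_closure hx, rfl⟩
  have hres : ∀ φ : H1 Ω,
      Integrable (fun x => (lam + V ε x - (lam + V₀)) * fn φ x) (volume.restrict Ω) ∧
      |∫ x in Ω, (lam + V ε x - (lam + V₀)) * fn φ x| ≤ CR * τ ε * (‖fn φ‖ + ‖grad φ‖) := by
    simp only [add_sub_add_left_eq_sub]
    exact hW _ _ hτ0 ((hV ε hεI).1.sub aestronglyMeasurable_const) (hVτ ε hεI)
  obtain ⟨u, hu, hu1, hu2, hu3⟩ := hmain (fun x => lam + V ε x) (p ε) (CR * τ ε)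
    (CP * (√(minDiffusion Ω (p ε)))⁻¹) D ham hdm ha hd hD (by positivity) hτr (by positivity) hPσ
    hres (fun w hw => exists_eLpNorm_sub_le_energyNorm hm₀ hCP ham ha hdm hd hD hP hdP hw)
  have hd0 : ∀ᵐ x ∂(volume.restrict Ω), 0 ≤ p ε x := hd.mono fun x hx => hm₀.le.trans hx
  have huM : ∀ᵐ x ∂(volume.restrict Ω), |fn u x| ≤ M :=
    hu.ae_abs_le hΩ_open hΩ_bdd hm₀ hd0 ham ha hM0.le ht1 ht2
  have huf : ∀ᵐ x ∂(volume.restrict Ω), truncate M f (fn u x) = f (fn u x) :=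
    huM.mono fun x hx => truncate_of_abs_le hx
  have hfu : MemLp (fun x => f (fn u x)) 2 (volume.restrict Ω) := by
    obtain ⟨B, hB⟩ := (isCompact_Icc (a := -M) (b := M)).exists_bound_of_continuousOn
      hf.continuous.continuousOn
    refine MemLp.of_bound (hf.continuous.comp_aestronglyMeasurable (Lp.memLp _).1) B ?_
    filter_upwards [huM] with x hx
    exact hB _ (abs_le.1 hx)
  refine ⟨u, (hu.congr huf).isEquilibrium hfu, hu1, hu2.trans ?_, fun v hv hvδ => ?_⟩
  · have h1 : 0 ≤ minDiffusion Ω (p ε) ^ (-(1 / 2) : ℝ) := by positivity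
    have h2 : 0 ≤ C * CR := by positivity
    nlinarith [mul_nonneg h2 h1]
  -- A weak equilibrium for `f` is bounded by `M`, hence also one for the truncation.
  · have hvM : ∀ᵐ x ∂(volume.restrict Ω), |fn v x| ≤ M :=
      hv.ae_abs_le hΩ_open hΩ_bdd hm₀ hd0 ham ha hM0.le (fun s hs => hf1 s hs.le)
        (fun s hs => hf2 s hs.le)
    exact hu3 v (hv.congr (hvM.mono fun x hx => (truncate_of_abs_le hx).symm)) hvδ
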